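/- **Solvability of the quasi-compressible system.** Write $\mathbb R_+=(0,\infty)$, $L^2=L^2(\mathbb R_+;\mathbb C)$, $H^k=H^k(\mathbb R_+;\mathbb C)$. Let $m\in(0,1/\sqrt3)$ and let $U\in C^3([0,\infty))$ be a real boundary layer profile satisfying: * $U(0)=0$, $U(Y)>0$ for $Y>0$, $\lim_{Y\to\infty}U(Y)=1$, $U'(0)=1$; * there are $s_0,s_1,s_2>0$ with $s_1e^{-s_0Y}\le U'(Y)\le s_2e^{-s_0Y}$ for all $Y\ge0$; * there is $\sigma_1>0$ with $\dfrac{-U''(1-m^2U^2)-2m^2U|U'|^2}{|U''|+|U'|^2}\ge\sigma_1$ for all $Y>0$; * there is $\sigma_2>0$ with $\left|\dfrac{U'''}{U''}\right|+\dfrac{|U''|}{U'}+\dfrac{1-U}{U'}\le\sigma_2$ for all $Y>0$. For $\alpha\in(0,1)$, $\varepsilon>0$ and $c\in\mathbb C$ put $n=\alpha/\sqrt\varepsilon$, $\Delta_\alpha=\partial_Y^2-\alpha^2$, $\operatorname{div}(u,v)=i\alpha u+\partial_Yv$, $A=1-m^2(U-c)^2$, $\Lambda(\Psi)=\partial_Y(A^{-1}\partial_Y\Psi)-\alpha^2\Psi$,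 $$\Omega(s_1,s_2)=s_2-\frac1{i\alpha}\partial_Y(A^{-1}s_1),\qquad \|f\|_{L^2_w}=\big\||U''|^{-1/2}f\big\|_{L^2},$$ and, for $\gamma>0$, $$\Sigma_Q=\{c\in\mathbb C:\ \operatorname{Im}c>\max\{\gamma^{-1}|c|^2,\gamma^{-1}n^{-1}\},\ |c|<\gamma\}.$$ Then there are constants $\gamma>0$ and $C\geq 0$, depending only on $m$ and $U$, such that for all $\alpha\in(0,1)$, $\varepsilon>0$ and $c\in\Sigma_Q$ the following holds. For every $(s_1,s_2)\in H^1\times H^1$ with $\|\Omega(s_1,s_2)\|_{L^2_w}<\infty$ the quasi-compressible system $$\begin{cases} i\alpha(U-c)\varrho+\operatorname{div}(u,v)=0,\\ \sqrt\varepsilon\,\Delta_\alpha\big(u+(U-c)\varrho\big)-i\alpha(U-c)u-v\,\partial_YU-i\alpha m^{-2}\varrho=s_1,\\ \sqrt\varepsilon\,\Delta_\alpha v-i\alpha(U-c)v-m^{-2}\partial_Y\varrho=s_2,\\ v|_{Y=0}=0 \end{cases}$$ has a solution $(\varrho,u,v)\in H^2\times H^2\times H^2$ with $$\|u\|_{H^1}+\|m^{-2}\varrho\|_{H^2}+\|v\|_{H^2}+\alpha^{-1}\|\operatorname{div}(u,v)\|_{H^1}\le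 C\Big(\frac1{\operatorname{Im}c}\|\Omega(s_1,s_2)\|_{L^2_w}+\frac1\alpha\|s_1\|_{L^2}+\|s_2\|_{L^2}+\|\operatorname{div}(s_1,s_2)\|_{L^2}\Big),$$ $$\|\partial_Y^2u\|_{L^2}\le C\Big(\frac{n^{1/2}}{(\operatorname{Im}c)^{1/2}}\|\Omega(s_1,s_2)\|_{L^2_w}+\frac1\alpha\|s_1\|_{L^2}+\|s_2\|_{L^2}+\|\operatorname{div}(s_1,s_2)\|_{L^2}\Big).$$ This solution comes from the compressible Orr–Sommerfeld equation: there is $\Psi\in H^4$ with $\Lambda(\Psi),\partial_Y\Lambda(\Psi)\in L^2_w$, $$\frac in\Lambda(\Delta_\alpha\Psi)+(U-c)\Lambda(\Psi)-\partial_Y(A^{-1}\partial_YU)\Psi=\Omega(s_1,s_2),\qquad \Psi|_{Y=0}=\Lambda(\Psi)|_{Y=0}=0,$$ such that $\partial_Y\Psi=u+(U-c)\varrho$, $-i\alpha\Psi=v$ and $$m^{-2}\varrho=-A^{-1}\Big[\frac in\Delta_\alpha\partial_Y\Psi+(U-c)\partial_Y\Psi-\Psi\,\partial_YU+\frac1{i\alpha}s_1\Big].$$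 Moreover, for fixed $\alpha,\varepsilon$ these solutions can be chosen as a function of $(c,s_1,s_2)$ such that, if $D\subseteq\Sigma_Q$ is open and $c\mapsto s_1(\cdot;c)$, $c\mapsto s_2(\cdot;c)$ are analytic on $D$ with values in $H^1$ and $c\mapsto\Omega(s_1,s_2)(\cdot;c)$ is analytic on $D$ with values in $L^2_w$, then $c\mapsto(\varrho,u,v)(\cdot;c)$ is analytic on $D$ with values in $H^2\times H^2\times H^2$. -/

import Mathlib

open MeasureTheory Set Filter Topology
open scoped ENNReal NNReal ContDiff

noncomputable section

namespace QuasiCompressible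

/-! ### Sobolev spaces on the half line -/

/-- Lebesgue measure on the open half line `ℝ₊ = (0, ∞)`. -/
abbrev halfLine : Measure ℝ := volume.restrict (Ioi (0 : ℝ))

/-- `g` is the weak (distributional) derivative of `f` on `(0, ∞)`. -/
def IsWeakDeriv (f g : ℝ → ℂ) : Prop :=
  LocallyIntegrableOn f (Ioi 0) ∧ LocallyIntegrableOn g (Ioi 0) ∧
    ∀ φ : ℝ → ℝ, ContDiff ℝ ∞ φ → HasCompactSupport φ → tsupport φ ⊆ Ioi 0 →
      ∫ Y in Ioi 0, deriv φ Y • f Y = -∫ Y in Ioi 0, φ Y • g Y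

open Classical in
/-- The weak derivative `∂_Y f` on `(0, ∞)`, determined almost everywhere; it has the junk
value `0` if `f` has no weak derivative. -/
def weakDeriv (f : ℝ → ℂ) : ℝ → ℂ :=
  if h : ∃ g, IsWeakDeriv f g then h.choose else 0

/-- The space `L²(ℝ₊)` of complex valued functions. -/
abbrev L2 : Type := Lp ℂ 2 halfLine

theorem L2.locallyIntegrableOn (f : L2) : LocallyIntegrableOn (f : ℝ → ℂ) (Ioi 0) :=
  locallyIntegrableOn_of_locallyIntegrable_restrict
    ((Lp.memLp f).locallyIntegrable (by norm_num))

theorem L2.integrable_smul (f : L2) {φ : ℝ → ℝ} (hφ : Continuous φ)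
    (hc : HasCompactSupport φ) : Integrable (fun Y => φ Y • f Y) halfLine := by
  have h : MemLp φ 2 halfLine := (hφ.memLp_of_hasCompactSupport hc).restrict _
  exact memLp_one_iff_integrable.1 ((Lp.memLp f).smul h)

/-- The space `H^k(ℝ₊)`, presented as the space of tuples
`(f, ∂_Y f, …, ∂_Y^k f)` in `L²(ℝ₊)^(k+1)` whose consecutive entries are weak derivatives of
each other. The norm inherited from the `ℓ²` product is the usual one,
`‖f‖_{H^k}² = ∑_{j ≤ k} ‖∂_Y^j f‖_{L²}²`. -/
def sobolevSubmodule (k : ℕ) : Submodule ℂ (PiLp 2 (fun _ : Fin (k + 1) => L2)) where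
  carrier := {F | ∀ j : Fin k, IsWeakDeriv (F j.castSucc) (F j.succ)}
  zero_mem' := by
    intro j
    refine ⟨L2.locallyIntegrableOn _, L2.locallyIntegrableOn _, fun φ _ _ _ => ?_⟩
    have h0 : ((0 : L2) : ℝ → ℂ) =ᵐ[halfLine] 0 := Lp.coeFn_zero ℂ 2 halfLine
    have h1 : ∫ Y in Ioi 0, deriv φ Y • ((0 : L2) : ℝ → ℂ) Y = 0 := by
      refine integral_eq_zero_of_ae ?_
      filter_upwards [h0] with Y hY
      rw [hY, Pi.zero_apply, smul_zero]
    have h2 : ∫ Y in Ioi 0, φ Y • ((0 : L2) : ℝ → ℂ) Y = 0 := by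
      refine integral_eq_zero_of_ae ?_
      filter_upwards [h0] with Y hY
      rw [hY, Pi.zero_apply, smul_zero]
    change ∫ Y in Ioi 0, deriv φ Y • ((0 : L2) : ℝ → ℂ) Y = -∫ Y in Ioi 0, φ Y • ((0 : L2) : ℝ → ℂ) Y
    rw [h1, h2, neg_zero]
  add_mem' := by
    intro F G hF hG j
    refine ⟨L2.locallyIntegrableOn _, L2.locallyIntegrableOn _, fun φ h hc hs => ?_⟩
    have key : ∀ (f g : L2) (ψ : ℝ → ℝ), Continuous ψ → HasCompactSupport ψ →
        ∫ Y in Ioi 0, ψ Y • ((f + g : L2) : ℝ → ℂ) Y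
          = (∫ Y in Ioi 0, ψ Y • f Y) + ∫ Y in Ioi 0, ψ Y • g Y := by
      intro f g ψ h1 h2
      rw [← integral_add (f.integrable_smul h1 h2) (g.integrable_smul h1 h2)]
      refine integral_congr_ae ?_
      filter_upwards [Lp.coeFn_add f g] with Y hY
      rw [hY, Pi.add_apply, smul_add]
    have hd : Continuous (deriv φ) := h.continuous_deriv (by norm_num)
    change ∫ Y in Ioi 0, deriv φ Y • ((F j.castSucc + G j.castSucc : L2) : ℝ → ℂ) Y
      = -∫ Y in Ioi 0, φ Y • ((F j.succ + G j.succ : L2) : ℝ → ℂ) Y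
    rw [key _ _ _ hd hc.deriv, key _ _ _ h.continuous hc, (hF j).2.2 φ h hc hs,
      (hG j).2.2 φ h hc hs]
    ring
  smul_mem' := by
    intro a F hF j
    refine ⟨L2.locallyIntegrableOn _, L2.locallyIntegrableOn _, fun φ h hc hs => ?_⟩
    have key : ∀ (f : L2) (ψ : ℝ → ℝ),
        ∫ Y in Ioi 0, ψ Y • ((a • f : L2) : ℝ → ℂ) Y = a * ∫ Y in Ioi 0, ψ Y • f Y := by
      intro f ψ
      rw [← integral_const_mul]
      refine integral_congr_ae ?_
      filter_upwards [Lp.coeFn_smul a f] with Y hY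
      simp only [hY, Pi.smul_apply, smul_eq_mul, Complex.real_smul]
      ring
    change ∫ Y in Ioi 0, deriv φ Y • ((a • F j.castSucc : L2) : ℝ → ℂ) Y
      = -∫ Y in Ioi 0, φ Y • ((a • F j.succ : L2) : ℝ → ℂ) Y
    rw [key, key, (hF j).2.2 φ h hc hs]
    ring

/-- The normed space `H^k(ℝ₊)`. -/
abbrev SobolevH (k : ℕ) : Type := ↥(sobolevSubmodule k)

/-- An element of `H^k(ℝ₊)` as a function. -/
instance SobolevH.instCoeFun (k : ℕ) : CoeFun (SobolevH k) (fun _ => ℝ → ℂ) :=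
  ⟨fun F => ((F : PiLp 2 (fun _ : Fin (k + 1) => L2)) 0 : L2)⟩

/-- `‖f‖_{L²(ℝ₊)}`, with values in `[0, ∞]`. -/
def l2Norm (f : ℝ → ℂ) : ℝ≥0∞ := eLpNorm f 2 halfLine

/-- `‖f‖_{H^k(ℝ₊)}`, with values in `[0, ∞]`: the norm of `f` as an element of `H^k(ℝ₊)` if it
is one (the infimum is then over a single element), and `∞` if it is not. -/
def sobolevNorm (k : ℕ) (f : ℝ → ℂ) : ℝ≥0∞ :=
  ⨅ (F : SobolevH k) (_ : (F : ℝ → ℂ) =ᵐ[halfLine] f), ‖F‖ₑ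

/-- The boundary condition `f|_{Y=0} = 0`, for the representative of `f` that is continuous on
`[0, ∞)`. -/
def VanishesAtZero (f : ℝ → ℂ) : Prop :=
  ∃ g : ℝ → ℂ, ContinuousOn g (Ici 0) ∧ f =ᵐ[halfLine] g ∧ g 0 = 0

/-! ### The boundary layer profile -/

/-- `∂_Y^k U` on `[0, ∞)` (one sided at `0`), for a profile `U` on `[0, ∞)`. -/
def dProfile (k : ℕ) (U : ℝ → ℝ) (Y : ℝ) : ℝ := iteratedDerivWithin k U (Ici 0) Y

/-- The function `H` of the uniform subsonic condition. -/
def subsonicH (m : ℝ) (U : ℝ → ℝ) (Y : ℝ) : ℝ :=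
  (-dProfile 2 U Y * (1 - m ^ 2 * U Y ^ 2) - 2 * m ^ 2 * U Y * |dProfile 1 U Y| ^ 2) /
    (|dProfile 2 U Y| + |dProfile 1 U Y| ^ 2)

/-- The class of (uniformly subsonic, at Mach number `m`) boundary layer profiles. -/
structure IsBoundaryLayerProfile (m : ℝ) (U : ℝ → ℝ) : Prop where
  contDiffOn : ContDiffOn ℝ 3 U (Ici 0)
  zero : U 0 = 0
  pos : ∀ Y, 0 < Y → 0 < U Y
  tendsto_one : Tendsto U atTop (𝓝 1)
  deriv_zero : dProfile 1 U 0 = 1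
  deriv_bounds : ∃ s₀ s₁ s₂ : ℝ, 0 < s₀ ∧ 0 < s₁ ∧ 0 < s₂ ∧ ∀ Y, 0 ≤ Y →
    s₁ * Real.exp (-s₀ * Y) ≤ dProfile 1 U Y ∧ dProfile 1 U Y ≤ s₂ * Real.exp (-s₀ * Y)
  subsonic : ∃ σ₁ : ℝ, 0 < σ₁ ∧ ∀ Y, 0 < Y → σ₁ ≤ subsonicH m U Y
  ratio_bounds : ∃ σ₂ : ℝ, 0 < σ₂ ∧ ∀ Y, 0 < Y →
    |dProfile 3 U Y / dProfile 2 U Y| + |dProfile 2 U Y| / dProfile 1 U Y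
      + (1 - U Y) / dProfile 1 U Y ≤ σ₂

/-- The function `|∂_Y² U|^{-1/2} f`. -/
def weighted (U : ℝ → ℝ) (f : ℝ → ℂ) (Y : ℝ) : ℂ :=
  ((|dProfile 2 U Y| ^ (-(1 / 2) : ℝ) : ℝ) : ℂ) * f Y

/-- `‖f‖_{L²_w} = ‖ |∂_Y² U|^{-1/2} f ‖_{L²}`, with values in `[0, ∞]`. -/
def l2wNorm (U : ℝ → ℝ) (f : ℝ → ℂ) : ℝ≥0∞ := l2Norm (weighted U f)

/-- The family `c ↦ f c` is analytic on `D` with values in `L²_w`. Multiplication by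
`|∂_Y² U|^{-1/2}` is an isometry of `L²_w` onto `L²`, so this is analyticity of
`c ↦ |∂_Y² U|^{-1/2} f c` with values in `L²`. -/
def AnalyticInL2w (U : ℝ → ℝ) (f : ℂ → ℝ → ℂ) (D : Set ℂ) : Prop :=
  ∃ G : ℂ → L2, AnalyticOnNhd ℂ G D ∧
    ∀ c ∈ D, (G c : ℝ → ℂ) =ᵐ[halfLine] weighted U (f c)

/-! ### The quasi-compressible system and its stream function -/

/-- `n = α / √ε`. -/
def nParam (α ε : ℝ) : ℝ := α / √ε

/-- `Δ_α f = ∂_Y² f - α² f`. -/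
def laplacian (α : ℝ) (f : ℝ → ℂ) (Y : ℝ) : ℂ :=
  weakDeriv (weakDeriv f) Y - (α : ℂ) ^ 2 * f Y

/-- `div_α (u, v) = i α u + ∂_Y v`. -/
def divergence (α : ℝ) (u v : ℝ → ℂ) (Y : ℝ) : ℂ :=
  Complex.I * α * u Y + weakDeriv v Y

/-- `A = 1 - m² (U - c)²`. -/
def coeffA (m : ℝ) (U : ℝ → ℝ) (c : ℂ) (Y : ℝ) : ℂ := 1 - (m : ℂ) ^ 2 * (U Y - c) ^ 2

/-- `Λ(Ψ) = ∂_Y (A⁻¹ ∂_Y Ψ) - α² Ψ`. -/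
def lambdaOp (m : ℝ) (U : ℝ → ℝ) (α : ℝ) (c : ℂ) (Ψ : ℝ → ℂ) (Y : ℝ) : ℂ :=
  weakDeriv (fun Z => (coeffA m U c Z)⁻¹ * weakDeriv Ψ Z) Y - (α : ℂ) ^ 2 * Ψ Y

/-- `Ω(s₁, s₂) = s₂ - (i α)⁻¹ ∂_Y (A⁻¹ s₁)`. -/
def omegaOp (m : ℝ) (U : ℝ → ℝ) (α : ℝ) (c : ℂ) (s₁ s₂ : ℝ → ℂ) (Y : ℝ) : ℂ :=
  s₂ Y - (Complex.I * α)⁻¹ * weakDeriv (fun Z => (coeffA m U c Z)⁻¹ * s₁ Z) Y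

/-- The compressible Orr-Sommerfeld operator
`(i/n) Λ(Δ_α Ψ) + (U - c) Λ(Ψ) - ∂_Y (A⁻¹ ∂_Y U) Ψ`. -/
def orrSommerfeld (m : ℝ) (U : ℝ → ℝ) (α ε : ℝ) (c : ℂ) (Ψ : ℝ → ℂ) (Y : ℝ) : ℂ :=
  Complex.I / nParam α ε * lambdaOp m U α c (laplacian α Ψ) Y
    + (U Y - c) * lambdaOp m U α c Ψ Y
    - weakDeriv (fun Z => (coeffA m U c Z)⁻¹ * dProfile 1 U Z) Y * Ψ Y

/-- `(ϱ, u, v)` solves the quasi-compressible system with source `(s₁, s₂)`. -/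
structure SolvesQuasiCompressible (m : ℝ) (U : ℝ → ℝ) (α ε : ℝ) (c : ℂ) (s₁ s₂ ϱ u v : ℝ → ℂ) :
    Prop where
  continuity : ∀ᵐ Y ∂halfLine, Complex.I * α * (U Y - c) * ϱ Y + divergence α u v Y = 0
  momentum₁ : ∀ᵐ Y ∂halfLine,
    (√ε : ℂ) * laplacian α (fun Z => u Z + (U Z - c) * ϱ Z) Y
      - Complex.I * α * (U Y - c) * u Y - v Y * dProfile 1 U Y
      - Complex.I * α * ((m : ℂ) ^ 2)⁻¹ * ϱ Y = s₁ Y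
  momentum₂ : ∀ᵐ Y ∂halfLine,
    (√ε : ℂ) * laplacian α v Y - Complex.I * α * (U Y - c) * v Y
      - ((m : ℂ) ^ 2)⁻¹ * weakDeriv ϱ Y = s₂ Y
  boundary : VanishesAtZero v

/-- `Ψ` solves `OS(Ψ) = Ω(s₁, s₂)` with `Ψ = Λ(Ψ) = 0` at `Y = 0`, and
`Λ(Ψ)`, `∂_Y Λ(Ψ)` belong to `L²_w`. -/
structure SolvesOrrSommerfeld (m : ℝ) (U : ℝ → ℝ) (α ε : ℝ) (c : ℂ) (s₁ s₂ Ψ : ℝ → ℂ) :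
    Prop where
  equation : ∀ᵐ Y ∂halfLine, orrSommerfeld m U α ε c Ψ Y = omegaOp m U α c s₁ s₂ Y
  boundary : VanishesAtZero Ψ
  boundary_lambda : VanishesAtZero (lambdaOp m U α c Ψ)
  weighted_lambda : l2wNorm U (lambdaOp m U α c Ψ) < ⊤
  weighted_deriv_lambda : l2wNorm U (weakDeriv (lambdaOp m U α c Ψ)) < ⊤

/-- `Ψ` is the stream function of `(ϱ, u, v)`: `∂_Y Ψ = u + (U - c) ϱ`, `-i α Ψ = v`, and
`m⁻² ϱ = -A⁻¹ [(i/n) Δ_α ∂_Y Ψ + (U - c) ∂_Y Ψ - Ψ ∂_Y U + (i α)⁻¹ s₁]`. -/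
structure IsStreamFunction (m : ℝ) (U : ℝ → ℝ) (α ε : ℝ) (c : ℂ) (s₁ ϱ u v Ψ : ℝ → ℂ) :
    Prop where
  tangential : ∀ᵐ Y ∂halfLine, weakDeriv Ψ Y = u Y + (U Y - c) * ϱ Y
  normal : ∀ᵐ Y ∂halfLine, -Complex.I * α * Ψ Y = v Y
  density : ∀ᵐ Y ∂halfLine, ((m : ℂ) ^ 2)⁻¹ * ϱ Y =
    -(coeffA m U c Y)⁻¹ * (Complex.I / nParam α ε * laplacian α (weakDeriv Ψ) Y
      + (U Y - c) * weakDeriv Ψ Y - Ψ Y * dProfile 1 U Y + (Complex.I * α)⁻¹ * s₁ Y)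

/-- The set `Σ_Q` of spectral parameters, with smallness parameter `γ`:
`Im c > max {γ⁻¹ |c|², γ⁻¹ n⁻¹}` and `|c| < γ`. -/
def sigmaQ (γ α ε : ℝ) : Set ℂ :=
  {c | max (γ⁻¹ * ‖c‖ ^ 2) (γ⁻¹ * (nParam α ε)⁻¹) < c.im ∧ ‖c‖ < γ}

end QuasiCompressible

end

open MeasureTheory Set Filter Topology
open scoped ENNReal NNReal ContDiff

noncomputable section

namespace QuasiCompressible

open scoped InnerProductSpace BoundedContinuousFunction ComplexConjugate
open ContinuousLinearMap (adjoint adjoint_inner_right)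

/-! ### Weak derivatives and primitives -/

/-! Write z = U - c, θ = √(-U''), U' = τθ. Eliminating the pressure from the system leaves the
compressible Orr–Sommerfeld equation for a stream function Ψ. Conversely, if Ψ solves that equation,
the pressure given by the stated formula has exactly the derivative required by the second momentum
equation (`isWeakDeriv_pr₀`), and the system follows by algebra. What remains is to solve the
fourth-order equation with good bounds.

The unknown is f = θ⁻¹Λ(Ψ), which lies in H¹₀ because Λ(Ψ) vanishes at the wall; Ψ is recovered from
Λ(Ψ) = θf by Lax–Milgram. Two identities are decisive: Λ(Δ_αΨ) = ∂_Y(A⁻¹∂_Y³Ψ - α²∂_YΨ) - α²Λ(Ψ),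
and ∂_Y(A⁻¹U') = -θ²A⁻²E with E = A - 2m²zτ², which is invertible for small c by the subsonic
condition. With Ω = θG, dividing the equation by θ and multiplying by p = A²/E gives
(i/n)(p/θ)∂_Y(θJ) - (iα²/n)pf + zpf + θΨ = pG, where J is f' plus terms bounded by ‖f‖. The weak
form of the left side is `opL`.

Test with f and take minus the imaginary part (`opL_coercive`). The viscous term yields ‖f'‖²/n up
to errors of size ‖f‖²/n. The function zp is real at c = 0 and has there a real, strictly negative
c-derivative, because m² < 1/3; hence -Im(zp) ≥ k Im c - M|c|². The weight p was chosen so that the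
nonlocal term is θΨ: tested with f it reduces to A⁻¹|Ψ'|², whose imaginary part has the good sign up
to |c| Im c. On Σ_Q the quantities 1/n, |c|² and |c| Im c are all at most γ Im c, so for small γ
they are absorbed. This gives ‖f‖ ≲ ‖G‖/Im c and ‖f'‖ ≲ √(n/Im c)‖G‖.

Uniformity in α comes from a Hardy inequality with the decaying weight θ (`h10_hardy`), which bounds
‖∂_YΨ‖ and α‖Ψ‖ by ‖f‖. Analyticity in c holds because the coefficients are holomorphic with values
in the Banach algebra of bounded continuous functions and inversion of operators is holomorphic. -/

theorem absolutelyContinuous_primitive {f : ℝ → ℂ} {a b c : ℝ}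
    (h : IntervalIntegrable f volume a b) (hc : c ∈ uIcc a b) :
    AbsolutelyContinuousOnInterval (fun x => ∫ v in c..x, f v) a b := by
  have hcst : ∀ z : ℂ, AbsolutelyContinuousOnInterval (fun _ : ℝ => z) a b := fun z =>
    (contDiff_const (n := 1)).contDiffOn.absolutelyContinuousOnInterval
  have hre : IntervalIntegrable (fun x => (f x).re) volume a b :=
    ⟨h.1.re, h.2.re⟩
  have him : IntervalIntegrable (fun x => (f x).im) volume a b :=
    ⟨h.1.im, h.2.im⟩
  have h1 := (hre.absolutelyContinuousOnInterval_intervalIntegral hc).fun_smul (hcst 1)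
  have h2 := (him.absolutelyContinuousOnInterval_intervalIntegral hc).fun_smul (hcst Complex.I)
  have h3 := h1.fun_add h2
  have key : ∀ x ∈ uIcc a b, (∫ v in c..x, f v)
      = (∫ v in c..x, (f v).re) • (1 : ℂ) + (∫ v in c..x, (f v).im) • Complex.I := by
    intro x hx
    have hi : IntervalIntegrable f volume c x := h.mono_set (uIcc_subset_uIcc hc hx)
    have e1 := Complex.reCLM.intervalIntegral_comp_comm hi
    have e2 := Complex.imCLM.intervalIntegral_comp_comm hi
    simp only [Complex.reCLM_apply, Complex.imCLM_apply] at e1 e2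
    rw [e1, e2]
    apply Complex.ext <;> simp
  rw [absolutelyContinuousOnInterval_iff] at h3 ⊢
  intro ε hε
  obtain ⟨δ, hδ, h⟩ := h3 ε hε
  refine ⟨δ, hδ, fun E hE hlt => ?_⟩
  convert h E hE hlt using 2 with i hi
  rw [key _ (hE.1 i hi).1, key _ (hE.1 i hi).2]

/-- The difference between `H` and a primitive of `h` is absolutely continuous with derivative zero
almost everywhere, hence constant. -/
theorem integral_eq_sub_of_absolutelyContinuous {H h : ℝ → ℂ} {a b : ℝ}
    (hH : AbsolutelyContinuousOnInterval H a b) (hh : IntervalIntegrable h volume a b)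
    (hd : ∀ᵐ x, x ∈ uIcc a b → HasDerivAt H (h x) x) :
    ∫ x in a..b, h x = H b - H a := by
  have hp := absolutelyContinuous_primitive hh (c := a) (by simp)
  obtain ⟨C, hC⟩ := (hH.fun_sub hp).const_of_ae_hasDerivAt_zero (by
    filter_upwards [hd, hh.ae_hasDerivAt_integral] with x hx₁ hx₂ hx₃
    convert! (hx₁ hx₃).sub (hx₂ hx₃ a (by simp)) using 1
    simp)
  have h1 := hC a (by simp)
  have h2 := hC b (by simp)
  simp only [intervalIntegral.integral_same, sub_zero] at h1
  rw [h1, ← h2]; ring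

theorem LocallyIntegrableOn.intervalIntegrable_Ioi {g : ℝ → ℂ}
    (hg : LocallyIntegrableOn g (Ioi 0)) {a b : ℝ} (ha : 0 < a) (hb : 0 < b) :
    IntervalIntegrable g volume a b := by
  apply IntegrableOn.intervalIntegrable
  apply hg.integrableOn_compact_subset _ isCompact_uIcc
  intro x hx
  exact lt_of_lt_of_le (lt_min ha hb) hx.1

/-- A compact subset of `(0, ∞)` lies in some `[l, r]` with `0 < l < 1 < r`. -/
theorem exists_Icc_of_tsupport {φ : ℝ → ℝ} (hc : HasCompactSupport φ) (hs : tsupport φ ⊆ Ioi 0) :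
    ∃ l r : ℝ, 0 < l ∧ l < 1 ∧ 1 < r ∧ ∀ x, x ∉ Ioo l r → φ x = 0 ∧ deriv φ x = 0 := by
  have hK : IsCompact (tsupport φ ∪ {1}) := hc.isCompact.union isCompact_singleton
  have hne : (tsupport φ ∪ {1} : Set ℝ).Nonempty := ⟨1, by simp⟩
  obtain ⟨a, ha, hal⟩ := hK.exists_isLeast hne
  obtain ⟨b, hb, hbg⟩ := hK.exists_isGreatest hne
  have ha0 : 0 < a := by
    rcases ha with h | h
    · exact hs h
    · rw [mem_singleton_iff.1 h]; norm_num
  have ha1 : a ≤ 1 := hal (by simp)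
  have hb1 : 1 ≤ b := hbg (by simp)
  refine ⟨a / 2, b + 1, by linarith, by linarith, by linarith, fun x hx => ?_⟩
  have key : x ∉ tsupport φ := fun hne => by
    have hx' : x ∈ tsupport φ ∪ {1} := Or.inl hne
    exact hx ⟨by linarith [hal hx'], by linarith [hbg hx']⟩
  exact ⟨image_eq_zero_of_notMem_tsupport key,
    image_eq_zero_of_notMem_tsupport fun h => key (tsupport_deriv_subset h)⟩

theorem setIntegral_Ioi_eq_interval {f : ℝ → ℂ} {l r : ℝ} (hl : 0 < l) (hlr : l < r)
    (hf : ∀ x, x ∉ Ioo l r → f x = 0) : ∫ Y in Ioi 0, f Y = ∫ Y in l..r, f Y := by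
  rw [intervalIntegral.integral_of_le hlr.le]
  apply setIntegral_eq_of_subset_of_forall_sdiff_eq_zero measurableSet_Ioi
  · intro x hx; exact hl.trans hx.1
  · intro x hx
    exact hf x fun h => hx.2 ⟨h.1, h.2.le⟩

theorem continuousOn_primitive {g : ℝ → ℂ} (hg : LocallyIntegrableOn g (Ioi 0)) :
    ContinuousOn (fun Y => ∫ t in (1 : ℝ)..Y, g t) (Ioi 0) := by
  intro Y hY
  have hY0 : (0 : ℝ) < Y := hY
  have h := absolutelyContinuous_primitive (c := 1)
    (LocallyIntegrableOn.intervalIntegrable_Ioi hg (a := min (Y / 2) 1) (b := max (2 * Y) 1)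
      (by positivity) (by positivity)) (by
        rw [uIcc_of_le (by simp)]; simp)
  have hc := h.continuousOn
  have hlt : min (Y / 2) 1 < Y := lt_of_le_of_lt (min_le_left _ _) (by linarith)
  have hgt : Y < max (2 * Y) 1 := lt_of_lt_of_le (by linarith) (le_max_left _ _)
  rw [uIcc_of_le (by simp)] at hc
  exact ((hc Y ⟨hlt.le, hgt.le⟩).continuousAt (Icc_mem_nhds hlt hgt)).continuousWithinAt

/-- Product of a `C¹` function and an absolutely continuous one. -/
theorem isWeakDeriv_mul_primitive {a a' g : ℝ → ℂ} (C : ℂ) (ha : ∀ Y, 0 < Y → HasDerivAt a (a' Y) Y)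
    (ha' : ContinuousOn a' (Ioi 0)) (hg : LocallyIntegrableOn g (Ioi 0)) :
    IsWeakDeriv (fun Y => a Y * (C + ∫ t in (1 : ℝ)..Y, g t))
      (fun Y => a' Y * (C + ∫ t in (1 : ℝ)..Y, g t) + a Y * g Y) := by
  have hF := continuousOn_primitive hg
  have hac : ContinuousOn a (Ioi 0) := fun Y hY => (ha Y hY).continuousAt.continuousWithinAt
  have hF' : ContinuousOn (fun Y => C + ∫ t in (1 : ℝ)..Y, g t) (Ioi 0) := continuousOn_const.add hF
  have hag : LocallyIntegrableOn (fun Y => a Y * g Y) (Ioi 0) :=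
    hg.continuousOn_mul hac isOpen_Ioi.isLocallyClosed
  have h2 : LocallyIntegrableOn (fun Y => a' Y * (C + ∫ t in (1 : ℝ)..Y, g t) + a Y * g Y) (Ioi 0) :=
    ((ha'.mul hF').locallyIntegrableOn measurableSet_Ioi).add hag
  refine ⟨(hac.mul hF').locallyIntegrableOn measurableSet_Ioi, h2, ?_⟩
  intro φ hφ hc hs
  obtain ⟨l, r, hl, hl1, hr1, hz⟩ := exists_Icc_of_tsupport hc hs
  have hlr : l < r := hl1.trans hr1
  have hdz : ∀ x, x ∉ Ioo l r → deriv φ x = 0 := fun x hx => (hz x hx).2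
  replace hz : ∀ x, x ∉ Ioo l r → φ x = 0 := fun x hx => (hz x hx).1
  have hr : 0 < r := hl.trans hlr
  have hsub : uIcc l r ⊆ Ioi 0 := by
    rw [uIcc_of_le hlr.le]; exact fun x hx => hl.trans_le hx.1
  rw [setIntegral_Ioi_eq_interval hl hlr (fun x hx => by rw [hdz x hx, zero_smul]),
    setIntegral_Ioi_eq_interval hl hlr (fun x hx => by rw [hz x hx, zero_smul])]
  have hgi := LocallyIntegrableOn.intervalIntegrable_Ioi hg hl hr
  have hdc : Continuous (deriv φ) := hφ.continuous_deriv (by norm_num)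
  have hpa : AbsolutelyContinuousOnInterval (fun Y => φ Y • a Y) l r := by
    have hd : ∀ x ∈ uIcc l r, HasDerivWithinAt (fun Y => φ Y • a Y)
        (φ x • a' x + deriv φ x • a x) (uIcc l r) x := fun x hx =>
      (((hφ.differentiable (by norm_num)) x).hasDerivAt.smul (ha x (hsub hx))).hasDerivWithinAt
    have hcont : ContinuousOn (fun x => φ x • a' x + deriv φ x • a x) (uIcc l r) :=
      (hφ.continuous.continuousOn.smul (ha'.mono hsub)).add
        (hdc.continuousOn.smul (hac.mono hsub))
    apply ContDiffOn.absolutelyContinuousOnInterval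
    have hu : UniqueDiffOn ℝ (uIcc l r) := by
      rw [uIcc_of_le hlr.le]; exact uniqueDiffOn_Icc hlr
    refine (contDiffOn_one_iff_derivWithin hu).2 ⟨fun x hx => (hd x hx).differentiableWithinAt, ?_⟩
    exact hcont.congr fun x hx => (hd x hx).derivWithin (hu x hx)
  have hH := hpa.fun_smul (((contDiff_const (n := 1) (c := C)).contDiffOn.absolutelyContinuousOnInterval).fun_add
    (absolutelyContinuous_primitive hgi (c := 1) (by rw [uIcc_of_le hlr.le]; exact ⟨hl1.le, hr1.le⟩)))
  have hi1 : IntervalIntegrable (fun Y => deriv φ Y • (a Y * (C + ∫ t in (1 : ℝ)..Y, g t))) volume l r :=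
    (hdc.continuousOn.smul ((hac.mul hF').mono hsub)).intervalIntegrable
  have hi2 : IntervalIntegrable (fun Y => φ Y • (a' Y * (C + ∫ t in (1 : ℝ)..Y, g t) + a Y * g Y)) volume l r :=
    (LocallyIntegrableOn.intervalIntegrable_Ioi h2 hl hr).continuousOn_smul hφ.continuous.continuousOn
  -- The product φ · a · (C + ∫ g) is absolutely continuous and vanishes at both ends of [l, r], so
  -- its derivative integrates to zero.
  have := integral_eq_sub_of_absolutelyContinuous hH (hi1.add hi2) (by
    filter_upwards [hgi.ae_hasDerivAt_integral] with x hx hxm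
    have h1 := ((hφ.differentiable (by norm_num)) x).hasDerivAt.smul (ha x (hsub hxm))
    have h2 := h1.smul ((hx hxm 1 (by rw [uIcc_of_le hlr.le]; exact ⟨hl1.le, hr1.le⟩)).const_add C)
    convert! h2 using 1
    simp only [smul_eq_mul, Complex.real_smul, Pi.smul_apply']
    ring)
  rw [intervalIntegral.integral_add hi1 hi2] at this
  simp only [hz l (by simp), hz r (by simp), zero_smul, sub_zero] at this
  exact eq_neg_of_add_eq_zero_left this

theorem IsWeakDeriv.congr {f f₂ g g₂ : ℝ → ℂ} (h : IsWeakDeriv f g)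
    (hf : f =ᵐ[halfLine] f₂) (hg : g =ᵐ[halfLine] g₂) : IsWeakDeriv f₂ g₂ := by
  refine ⟨h.1.congr hf, h.2.1.congr hg, fun φ h1 h2 h3 => ?_⟩
  rw [integral_congr_ae (hf.symm.mono fun Y hY => by show _ = deriv φ Y • f Y; rw [← hY]),
    h.2.2 φ h1 h2 h3, integral_congr_ae (hg.mono fun Y hY => by show _ = φ Y • g₂ Y; rw [← hY])]

/-- The difference of the two candidates integrates to zero against every test function in (0, ∞),
which forces it to vanish almost everywhere. -/
theorem IsWeakDeriv.unique {f g₁ g₂ : ℝ → ℂ} (h₁ : IsWeakDeriv f g₁) (h₂ : IsWeakDeriv f g₂) :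
    g₁ =ᵐ[halfLine] g₂ := by
  have key := isOpen_Ioi.ae_eq_zero_of_integral_contDiff_smul_eq_zero
    (μ := volume) (h₁.2.1.sub h₂.2.1) (fun φ hφ hc hs => by
      obtain ⟨l, r, hl, hl1, hr1, hz⟩ := exists_Icc_of_tsupport hc hs
      have hlr := hl1.trans hr1
      have e := (h₁.2.2 φ hφ hc hs).symm.trans (h₂.2.2 φ hφ hc hs)
      rw [neg_inj, setIntegral_Ioi_eq_interval hl hlr (fun x hx => by rw [(hz x hx).1, zero_smul]),
        setIntegral_Ioi_eq_interval hl hlr (fun x hx => by rw [(hz x hx).1, zero_smul])] at e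
      rw [← setIntegral_eq_integral_of_forall_compl_eq_zero (s := Ioi 0) (fun x hx => by
        rw [(hz x fun h => hx (hl.trans h.1)).1, zero_smul]),
        setIntegral_Ioi_eq_interval hl hlr (fun x hx => by rw [(hz x hx).1, zero_smul])]
      simp only [Pi.sub_apply, smul_sub]
      rw [intervalIntegral.integral_sub, e, sub_self]
      · exact (LocallyIntegrableOn.intervalIntegrable_Ioi h₁.2.1 hl (hl.trans hlr)).continuousOn_smul
          hφ.continuous.continuousOn
      · exact (LocallyIntegrableOn.intervalIntegrable_Ioi h₂.2.1 hl (hl.trans hlr)).continuousOn_smul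
          hφ.continuous.continuousOn)
  rw [Filter.EventuallyEq, ae_restrict_iff' measurableSet_Ioi]
  filter_upwards [key] with x hx hx0
  exact sub_eq_zero.1 (hx hx0)

theorem IsWeakDeriv.sub {f₁ f₂ g₁ g₂ : ℝ → ℂ} (h₁ : IsWeakDeriv f₁ g₁) (h₂ : IsWeakDeriv f₂ g₂) :
    IsWeakDeriv (fun Y => f₁ Y - f₂ Y) (fun Y => g₁ Y - g₂ Y) := by
  refine ⟨h₁.1.sub h₂.1, h₁.2.1.sub h₂.2.1, fun φ hφ hc hs => ?_⟩
  obtain ⟨l, r, hl, hl1, hr1, hz⟩ := exists_Icc_of_tsupport hc hs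
  have hlr := hl1.trans hr1
  have e1 := h₁.2.2 φ hφ hc hs
  have e2 := h₂.2.2 φ hφ hc hs
  have hr := hl.trans hlr
  have hd : Continuous (deriv φ) := hφ.continuous_deriv (by norm_num)
  have hz0 : ∀ f : ℝ → ℂ, ∫ Y in Ioi 0, φ Y • f Y = ∫ Y in l..r, φ Y • f Y := fun f =>
    setIntegral_Ioi_eq_interval hl hlr (fun x hx => by rw [(hz x hx).1, zero_smul])
  have hz1 : ∀ f : ℝ → ℂ, ∫ Y in Ioi 0, deriv φ Y • f Y = ∫ Y in l..r, deriv φ Y • f Y := fun f =>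
    setIntegral_Ioi_eq_interval hl hlr (fun x hx => by rw [(hz x hx).2, zero_smul])
  rw [hz0, hz1] at e1 e2 ⊢
  simp only [smul_sub]
  rw [intervalIntegral.integral_sub, intervalIntegral.integral_sub, e1, e2]
  · ring
  · exact (LocallyIntegrableOn.intervalIntegrable_Ioi h₁.2.1 hl hr).continuousOn_smul
      hφ.continuous.continuousOn
  · exact (LocallyIntegrableOn.intervalIntegrable_Ioi h₂.2.1 hl hr).continuousOn_smul
      hφ.continuous.continuousOn
  · exact (LocallyIntegrableOn.intervalIntegrable_Ioi h₁.1 hl hr).continuousOn_smul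
      hd.continuousOn
  · exact (LocallyIntegrableOn.intervalIntegrable_Ioi h₂.1 hl hr).continuousOn_smul
      hd.continuousOn

/-- A smooth function compactly supported in `(0, ∞)` with vanishing integral is the derivative
of such a function. -/
theorem exists_primitive_test {χ : ℝ → ℝ} (hχ : ContDiff ℝ ∞ χ) {l r : ℝ} (hl : 0 < l)
    (hz : ∀ x, x ∉ Ioo l r → χ x = 0) (hint : ∫ x in l..r, χ x = 0) :
    ∃ φ : ℝ → ℝ, ContDiff ℝ ∞ φ ∧ HasCompactSupport φ ∧ tsupport φ ⊆ Ioi 0 ∧ deriv φ = χ := by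
  have hd : ∀ x, HasDerivAt (fun x => ∫ t in l..x, χ t) (χ x) x := fun x =>
    intervalIntegral.integral_hasDerivAt_right (hχ.continuous.intervalIntegrable _ _)
      (hχ.continuous.stronglyMeasurableAtFilter _ _) hχ.continuous.continuousAt
  have hde : deriv (fun x => ∫ t in l..x, χ t) = χ := funext fun x => (hd x).deriv
  have hsup : Function.support (fun x => ∫ t in l..x, χ t) ⊆ Icc l r := by
    intro x hx
    by_contra hxn
    apply hx
    rcases lt_or_ge x l with h | h
    · apply intervalIntegral.integral_zero_ae
      filter_upwards with t ht
      rw [uIoc_of_ge h.le] at ht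
      exact hz t fun h' => absurd ht.2 (not_le.2 h'.1)
    · have hrx : r < x := by
        by_contra h'
        exact hxn ⟨h, not_lt.1 h'⟩
      show ∫ t in l..x, χ t = 0
      rw [← intervalIntegral.integral_add_adjacent_intervals
        (hχ.continuous.intervalIntegrable l r) (hχ.continuous.intervalIntegrable r x), hint, zero_add]
      apply intervalIntegral.integral_zero_ae
      filter_upwards with t ht
      rw [uIoc_of_le hrx.le] at ht
      exact hz t fun h' => absurd ht.1 (not_lt.2 h'.2.le)
  have hts : tsupport (fun x => ∫ t in l..x, χ t) ⊆ Icc l r := closure_minimal hsup isClosed_Icc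
  refine ⟨_, ?_, HasCompactSupport.of_support_subset_isCompact isCompact_Icc hsup,
    hts.trans fun x hx => hl.trans_le hx.1, hde⟩
  rw [contDiff_infty_iff_deriv, hde]
  exact ⟨fun x => (hd x).differentiableAt, hχ⟩

theorem IsWeakDeriv.weakDeriv_eq {f g : ℝ → ℂ} (h : IsWeakDeriv f g) :
    weakDeriv f =ᵐ[halfLine] g := by
  have h' : ∃ g, IsWeakDeriv f g := ⟨g, h⟩
  unfold weakDeriv
  rw [dif_pos h']
  exact h'.choose_spec.unique h

/-- The du Bois-Reymond lemma. -/
theorem IsWeakDeriv.exists_eq_primitive {f g : ℝ → ℂ} (h : IsWeakDeriv f g) :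
    ∃ C : ℂ, f =ᵐ[halfLine] fun Y => C + ∫ t in (1 : ℝ)..Y, g t := by
  have hF : IsWeakDeriv (fun Y => ∫ t in (1 : ℝ)..Y, g t) g := by
    simpa using isWeakDeriv_mul_primitive (a := fun _ => 1) (a' := fun _ => 0) 0
      (fun Y _ => hasDerivAt_const Y 1) continuousOn_const h.2.1
  have hd := h.sub hF
  set u : ℝ → ℂ := fun Y => f Y - ∫ t in (1 : ℝ)..Y, g t with hu
  -- η is a test function of integral one supported in [1, 3]. For any test function ψ, the function
  -- ψ - (∫ψ)η has zero integral and so is the derivative of a test function; since u has weak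
  -- derivative zero, ∫ψu = (∫ψ)(∫ηu), and the constant is ∫ηu.
  let η₀ : ContDiffBump (2 : ℝ) := ⟨1 / 2, 1, by norm_num, by norm_num⟩
  let η : ℝ → ℝ := η₀.normed volume
  have hη : ContDiff ℝ ∞ η := η₀.contDiff_normed
  have hηc : HasCompactSupport η := η₀.hasCompactSupport_normed
  have hηs : tsupport η ⊆ Ioi 0 := by
    show tsupport (η₀.normed volume) ⊆ Ioi 0
    rw [η₀.tsupport_normed_eq]
    intro x hx
    rw [mem_closedBall_iff_norm, Real.norm_eq_abs] at hx
    have := (abs_le.1 hx).1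
    show 0 < x
    change -(1 : ℝ) ≤ x - 2 at this
    linarith
  obtain ⟨l₁, r₁, hl₁, hl1₁, hr1₁, hz₁⟩ := exists_Icc_of_tsupport hηc hηs
  set C : ℂ := ∫ Y in Ioi 0, η Y • u Y with hC
  refine ⟨C, ?_⟩
  have key := isOpen_Ioi.ae_eq_zero_of_integral_contDiff_smul_eq_zero
    (μ := volume) (f := fun Y => u Y - C) (hd.1.sub (continuousOn_const.locallyIntegrableOn
      measurableSet_Ioi)) (fun ψ hψ hψc hψs => by
      obtain ⟨l₂, r₂, hl₂, hl1₂, hr1₂, hz₂⟩ := exists_Icc_of_tsupport hψc hψs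
      set l := min l₁ l₂ with hl
      set r := max r₁ r₂ with hr
      have hl0 : 0 < l := lt_min hl₁ hl₂
      have hlr : l < r := (min_lt_of_left_lt hl1₁).trans (lt_max_of_lt_left hr1₁)
      have hη0 : ∀ x, x ∉ Ioo l r → η x = 0 := fun x hx => (hz₁ x fun h' =>
        hx ⟨lt_of_le_of_lt (min_le_left _ _) h'.1, lt_of_lt_of_le h'.2 (le_max_left _ _)⟩).1
      have hψ0 : ∀ x, x ∉ Ioo l r → ψ x = 0 := fun x hx => (hz₂ x fun h' =>
        hx ⟨lt_of_le_of_lt (min_le_right _ _) h'.1, lt_of_lt_of_le h'.2 (le_max_right _ _)⟩).1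
      have hηi : ∫ x in l..r, η x = 1 := by
        rw [← η₀.integral_normed (μ := volume), intervalIntegral.integral_of_le hlr.le]
        exact setIntegral_eq_integral_of_forall_compl_eq_zero fun x hx =>
          hη0 x fun h' => hx ⟨h'.1, h'.2.le⟩
      set m : ℝ := ∫ x in l..r, ψ x with hm
      have hmη : Continuous fun x => m * η x := continuous_const.mul hη.continuous
      obtain ⟨φ, hφ, hφc, hφs, hφd⟩ := exists_primitive_test (χ := fun x => ψ x - m * η x)
        (hψ.sub (contDiff_const.mul hη)) hl0
        (fun x hx => by rw [hη0 x hx, hψ0 x hx]; ring) (by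
          rw [intervalIntegral.integral_sub (hψ.continuous.intervalIntegrable _ _)
            (hmη.intervalIntegrable _ _),
            intervalIntegral.integral_const_mul, hηi]; ring)
      have e := hd.2.2 φ hφ hφc hφs
      have hui : IntervalIntegrable u volume l r :=
        LocallyIntegrableOn.intervalIntegrable_Ioi hd.1 hl0 (hl0.trans hlr)
      have hi1 : IntervalIntegrable (fun Y => ψ Y • u Y) volume l r :=
        hui.continuousOn_smul hψ.continuous.continuousOn
      have hi2 : IntervalIntegrable (fun Y => η Y • u Y) volume l r :=
        hui.continuousOn_smul hη.continuous.continuousOn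
      rw [hφd, setIntegral_Ioi_eq_interval hl0 hlr
        (fun x hx => by simp only [hη0 x hx, hψ0 x hx]; simp)] at e
      simp only [sub_self, smul_zero, integral_zero, neg_zero, sub_smul, mul_smul] at e
      have hi3 : IntervalIntegrable (fun Y => m • η Y • u Y) volume l r := hi2.smul m
      rw [intervalIntegral.integral_sub hi1 hi3, intervalIntegral.integral_smul,
        ← setIntegral_Ioi_eq_interval (f := fun Y => η Y • u Y) hl0 hlr
          (fun x hx => by rw [hη0 x hx, zero_smul]), ← hC] at e
      rw [← setIntegral_eq_integral_of_forall_compl_eq_zero (s := Ioi 0) (fun x hx => by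
        rw [hψ0 x fun h' => hx (hl0.trans h'.1), zero_smul]),
        setIntegral_Ioi_eq_interval hl0 hlr (fun x hx => by rw [hψ0 x hx, zero_smul])]
      simp only [smul_sub]
      have hi4 : IntervalIntegrable (fun Y => ψ Y • C) volume l r :=
        (hψ.continuous.smul continuous_const).intervalIntegrable _ _
      rw [intervalIntegral.integral_sub hi1 hi4,
        intervalIntegral.integral_smul_const]
      exact e)
  rw [Filter.EventuallyEq, ae_restrict_iff' measurableSet_Ioi]
  filter_upwards [key] with x hx hx0
  have := hx hx0
  rw [hu] at this
  linear_combination this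

/-- The du Bois-Reymond lemma replaces `f` by an absolutely continuous representative, to which the
classical product rule applies. -/
theorem IsWeakDeriv.mul_left {a a' f g : ℝ → ℂ} (h : IsWeakDeriv f g)
    (ha : ∀ Y, 0 < Y → HasDerivAt a (a' Y) Y) (ha' : ContinuousOn a' (Ioi 0)) :
    IsWeakDeriv (fun Y => a Y * f Y) (fun Y => a' Y * f Y + a Y * g Y) := by
  obtain ⟨C, hC⟩ := h.exists_eq_primitive
  refine (isWeakDeriv_mul_primitive C ha ha' h.2.1).congr ?_ ?_
  · filter_upwards [hC] with Y hY; rw [hY]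
  · filter_upwards [hC] with Y hY; rw [hY]

theorem IsWeakDeriv.const_mul {f g : ℝ → ℂ} (h : IsWeakDeriv f g) (c : ℂ) :
    IsWeakDeriv (fun Y => c * f Y) (fun Y => c * g Y) := by
  simpa using h.mul_left (a := fun _ => c) (a' := fun _ => 0) (fun Y _ => hasDerivAt_const Y c)
    continuousOn_const

theorem IsWeakDeriv.add {f₁ f₂ g₁ g₂ : ℝ → ℂ} (h₁ : IsWeakDeriv f₁ g₁) (h₂ : IsWeakDeriv f₂ g₂) :
    IsWeakDeriv (fun Y => f₁ Y + f₂ Y) (fun Y => g₁ Y + g₂ Y) := by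
  simpa using h₁.sub (h₂.const_mul (-1))

theorem isWeakDeriv_of_hasDerivAt {a a' : ℝ → ℂ} (ha : ∀ Y, 0 < Y → HasDerivAt a (a' Y) Y)
    (ha' : ContinuousOn a' (Ioi 0)) : IsWeakDeriv a a' := by
  have := isWeakDeriv_mul_primitive (g := 0) 1 ha ha'
    (continuousOn_const.locallyIntegrableOn measurableSet_Ioi)
  simpa using this

/-! ### Multiplication operators on `L²` -/

theorem memLp_mul_boundedContinuous (φ : ℝ →ᵇ ℂ) (f : L2) :
    MemLp (fun Y => φ Y * f Y) 2 halfLine := by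
  have := (Lp.memLp f).smul (r := 2) (φ.memLp_top (μ := halfLine))
  exact this

/-- Multiplication by bounded continuous functions on `L²(ℝ₊)`. -/
def mulL : (ℝ →ᵇ ℂ) →L[ℂ] L2 →L[ℂ] L2 :=
  LinearMap.mkContinuous₂
    (LinearMap.mk₂ ℂ (fun φ f => (memLp_mul_boundedContinuous φ f).toLp _)
      (fun φ ψ f => by
        rw [← MemLp.toLp_add]
        refine MemLp.toLp_congr _ _ (.of_forall fun Y => ?_)
        simp [add_mul])
      (fun c φ f => by
        rw [← MemLp.toLp_const_smul]
        refine MemLp.toLp_congr _ _ (.of_forall fun Y => ?_)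
        simp [mul_assoc])
      (fun φ f g => by
        rw [← MemLp.toLp_add]
        refine MemLp.toLp_congr _ _ ?_
        filter_upwards [Lp.coeFn_add f g] with Y hY
        rw [Pi.add_apply, hY, Pi.add_apply, mul_add])
      (fun c φ f => by
        rw [← MemLp.toLp_const_smul]
        refine MemLp.toLp_congr _ _ ?_
        filter_upwards [Lp.coeFn_smul c f] with Y hY
        simp only [hY, Pi.smul_apply, smul_eq_mul]
        ring)) 1 (fun φ f => by
      rw [one_mul]
      apply Lp.norm_le_mul_norm_of_ae_le_mul
      filter_upwards [(memLp_mul_boundedContinuous φ f).coeFn_toLp] with Y hY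
      simp only [LinearMap.mk₂_apply, hY, norm_mul]
      gcongr
      exact φ.norm_coe_le_norm Y)

theorem coeFn_mulL (φ : ℝ →ᵇ ℂ) (f : L2) : mulL φ f =ᵐ[halfLine] fun Y => φ Y * f Y :=
  (memLp_mul_boundedContinuous φ f).coeFn_toLp

theorem norm_mulL_le (φ : ℝ →ᵇ ℂ) (f : L2) : ‖mulL φ f‖ ≤ ‖φ‖ * ‖f‖ := by
  apply Lp.norm_le_mul_norm_of_ae_le_mul
  filter_upwards [coeFn_mulL φ f] with Y hY
  rw [hY, norm_mul]
  gcongr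
  exact φ.norm_coe_le_norm Y

theorem integrable_inner_mulL (f g : L2) (φ : ℝ →ᵇ ℂ) :
    Integrable (fun Y => φ Y * g Y * conj (f Y)) halfLine := by
  refine (L2.integrable_inner (𝕜 := ℂ) f (mulL φ g)).congr ?_
  filter_upwards [coeFn_mulL φ g] with Y hY
  rw [hY, RCLike.inner_apply]

theorem inner_mulL (f g : L2) (φ : ℝ →ᵇ ℂ) :
    ⟪f, mulL φ g⟫_ℂ = ∫ Y in Ioi 0, φ Y * g Y * conj (f Y) := by
  rw [L2.inner_def]
  refine integral_congr_ae ?_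
  filter_upwards [coeFn_mulL φ g] with Y hY
  rw [hY, RCLike.inner_apply]

theorem norm_sq_eq_integral (f : L2) : ‖f‖ ^ 2 = ∫ Y in Ioi 0, ‖f Y‖ ^ 2 := by
  have h := inner_self_eq_norm_sq (𝕜 := ℂ) f
  rw [← h, L2.inner_def, ← integral_re (L2.integrable_inner (𝕜 := ℂ) f f)]
  refine integral_congr_ae (.of_forall fun Y => ?_)
  exact inner_self_eq_norm_sq (𝕜 := ℂ) (f Y)

theorem integrable_norm_sq (f : L2) : Integrable (fun Y => ‖f Y‖ ^ 2) halfLine :=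
  (Lp.memLp f).integrable_norm_pow (by norm_num)

theorem re_inner_mulL_ge {φ : ℝ →ᵇ ℂ} {k : ℝ} (hφ : ∀ Y, 0 < Y → k ≤ (φ Y).re) (f : L2) :
    k * ‖f‖ ^ 2 ≤ (⟪f, mulL φ f⟫_ℂ).re := by
  rw [inner_mulL, norm_sq_eq_integral, ← integral_const_mul]
  have h := integral_re (integrable_inner_mulL f f φ)
  refine le_trans ?_ (le_of_eq h)
  refine setIntegral_mono_on ((integrable_norm_sq f).const_mul k)
    (integrable_inner_mulL f f φ).re measurableSet_Ioi fun Y hY => ?_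
  show _ ≤ (φ Y * f Y * conj (f Y)).re
  rw [mul_assoc, Complex.mul_conj, Complex.re_mul_ofReal, Complex.normSq_eq_norm_sq]
  exact mul_le_mul_of_nonneg_right (hφ Y hY) (sq_nonneg _)

theorem inner_mulL_comm {φ : ℝ →ᵇ ℂ} (hφ : ∀ Y, conj (φ Y) = φ Y) (f g : L2) :
    ⟪f, mulL φ g⟫_ℂ = ⟪mulL φ f, g⟫_ℂ := by
  rw [L2.inner_def, L2.inner_def]
  refine integral_congr_ae ?_
  filter_upwards [coeFn_mulL φ g, coeFn_mulL φ f] with Y h1 h2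
  rw [h1, h2, RCLike.inner_apply, RCLike.inner_apply, map_mul, hφ]
  ring

/-- A real test function as an element of `L²`. -/
def testL2 (φ : ℝ → ℝ) (h : Continuous φ) (hc : HasCompactSupport φ) : L2 :=
  MemLp.toLp (fun Y => (φ Y : ℂ)) (((h.memLp_of_hasCompactSupport hc).restrict _).ofReal)

theorem coeFn_testL2 {φ : ℝ → ℝ} (h : Continuous φ) (hc : HasCompactSupport φ) :
    testL2 φ h hc =ᵐ[halfLine] fun Y => (φ Y : ℂ) := MemLp.coeFn_toLp _

theorem inner_testL2 {φ : ℝ → ℝ} (h : Continuous φ) (hc : HasCompactSupport φ) (f : L2) :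
    ⟪testL2 φ h hc, f⟫_ℂ = ∫ Y in Ioi 0, φ Y • f Y := by
  rw [L2.inner_def]
  refine integral_congr_ae ?_
  filter_upwards [coeFn_testL2 h hc] with Y h1
  rw [h1, RCLike.inner_apply, Complex.conj_ofReal, Complex.real_smul]
  ring

/-- For a fixed test function the weak-derivative identity equates two continuous functionals of the
tuple, so the space is an intersection of closed sets. Completeness of H² is needed for the
orthogonal projection onto it. -/
theorem isClosed_sobolevSubmodule (k : ℕ) :
    IsClosed (sobolevSubmodule k : Set (PiLp 2 (fun _ : Fin (k + 1) => L2))) := by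
  have : (sobolevSubmodule k : Set (PiLp 2 (fun _ : Fin (k + 1) => L2))) =
      ⋂ (j : Fin k) (φ : ℝ → ℝ) (h : ContDiff ℝ ∞ φ) (hc : HasCompactSupport φ)
        (_ : tsupport φ ⊆ Ioi 0),
        {F | ⟪testL2 (deriv φ) (h.continuous_deriv (by norm_num)) hc.deriv, F j.castSucc⟫_ℂ =
          -⟪testL2 φ h.continuous hc, F j.succ⟫_ℂ} := by
    ext F
    simp only [mem_iInter, inner_testL2, mem_ofPred_eq]
    constructor
    · intro hF j φ h hc hs
      exact (hF j).2.2 φ h hc hs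
    · intro hF j
      exact ⟨L2.locallyIntegrableOn _, L2.locallyIntegrableOn _, fun φ h hc hs => hF j φ h hc hs⟩
  rw [this]
  refine isClosed_iInter fun j => isClosed_iInter fun φ => isClosed_iInter fun h =>
    isClosed_iInter fun hc => isClosed_iInter fun hs => ?_
  exact isClosed_eq (continuous_const.inner (PiLp.continuous_apply 2 _ _))
    (continuous_const.inner (PiLp.continuous_apply 2 _ _)).neg

instance (k : ℕ) : CompleteSpace (SobolevH k) :=
  (isClosed_sobolevSubmodule k).completeSpace_coe

/-! ### The space `H¹₀` -/

/-- The space `H¹₀(ℝ₊)`, presented as the space of pairs `(f, ∂_Y f)` in `L²(ℝ₊)²` for which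
integration by parts against test functions on the whole line has no boundary term. -/
def h10 : Submodule ℂ (WithLp 2 (L2 × L2)) :=
  (Submodule.span ℂ {F | ∃ (φ : ℝ → ℝ) (h : ContDiff ℝ ∞ φ) (hc : HasCompactSupport φ),
    F = WithLp.toLp 2 (testL2 (deriv φ) (h.continuous_deriv (by norm_num)) hc.deriv,
      testL2 φ h.continuous hc)})ᗮ

/-- The Hilbert space `H¹₀(ℝ₊)`. -/
abbrev H10 : Type := ↥h10

instance : CompleteSpace H10 :=
  (Submodule.isClosed_orthogonal _).completeSpace_coe

/-- The function underlying an element of `H¹₀`. -/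
def valL : H10 →L[ℂ] L2 := (WithLp.fstL 2 ℂ L2 L2).comp h10.subtypeL

/-- The derivative of an element of `H¹₀`. -/
def derL : H10 →L[ℂ] L2 := (WithLp.sndL 2 ℂ L2 L2).comp h10.subtypeL

theorem h10_norm_sq (F : H10) : ‖F‖ ^ 2 = ‖valL F‖ ^ 2 + ‖derL F‖ ^ 2 := by
  exact WithLp.prod_norm_sq_eq_of_L2 (F : WithLp 2 (L2 × L2))

theorem h10_integral (F : H10) {φ : ℝ → ℝ} (h : ContDiff ℝ ∞ φ) (hc : HasCompactSupport φ) :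
    ∫ Y in Ioi 0, deriv φ Y • valL F Y = -∫ Y in Ioi 0, φ Y • derL F Y := by
  have := (Submodule.mem_orthogonal _ _).1 F.2 _ (Submodule.subset_span ⟨φ, h, hc, rfl⟩)
  rw [WithLp.prod_inner_apply] at this
  rw [← inner_testL2 (h.continuous_deriv (by norm_num)) hc.deriv, ← inner_testL2 h.continuous hc]
  exact eq_neg_of_add_eq_zero_left this

theorem h10_isWeakDeriv (F : H10) : IsWeakDeriv (valL F) (derL F) :=
  ⟨L2.locallyIntegrableOn _, L2.locallyIntegrableOn _, fun _ h hc _ => h10_integral F h hc⟩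

/-- The orthogonality that defines `h10` is here the integration by parts of a smooth ψ on the line
against φ. As φ is supported away from 0, there is no boundary term, whatever ψ does at the origin.
-/
theorem exists_h10_test {φ : ℝ → ℝ} (h : ContDiff ℝ ∞ φ) (hc : HasCompactSupport φ)
    (hs : tsupport φ ⊆ Ioi 0) : ∃ F : H10, valL F = testL2 φ h.continuous hc ∧
      derL F = testL2 (deriv φ) (h.continuous_deriv (by norm_num)) hc.deriv := by
  refine ⟨⟨WithLp.toLp 2 (testL2 φ h.continuous hc,
    testL2 (deriv φ) (h.continuous_deriv (by norm_num)) hc.deriv), ?_⟩, rfl, rfl⟩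
  rw [h10, Submodule.mem_orthogonal]
  intro u hu
  induction hu using Submodule.span_induction with
  | mem u hu =>
    obtain ⟨ψ, hψ, hψc, rfl⟩ := hu
    rw [WithLp.prod_inner_apply]
    show ⟪testL2 (deriv ψ) (hψ.continuous_deriv (by norm_num)) hψc.deriv,
      testL2 φ h.continuous hc⟫_ℂ + ⟪testL2 ψ hψ.continuous hψc,
      testL2 (deriv φ) (h.continuous_deriv (by norm_num)) hc.deriv⟫_ℂ = 0
    have hw : IsWeakDeriv (fun Y => (ψ Y : ℂ)) (fun Y => ((deriv ψ Y : ℝ) : ℂ)) :=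
      isWeakDeriv_of_hasDerivAt
        (fun Y _ => ((hψ.differentiable (by norm_num)) Y).hasDerivAt.ofReal_comp)
        (Complex.continuous_ofReal.comp (hψ.continuous_deriv (by norm_num))).continuousOn
    have e := hw.2.2 φ h hc hs
    rw [inner_testL2, inner_testL2]
    have e1 : ∫ Y in Ioi 0, deriv ψ Y • testL2 φ h.continuous hc Y
        = ∫ Y in Ioi 0, φ Y • ((deriv ψ Y : ℝ) : ℂ) := by
      refine integral_congr_ae ?_
      filter_upwards [coeFn_testL2 h.continuous hc] with Y hY
      rw [hY, Complex.real_smul, Complex.real_smul, mul_comm]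
    have e2 : ∫ Y in Ioi 0, ψ Y • testL2 (deriv φ) (h.continuous_deriv (by norm_num)) hc.deriv Y
        = ∫ Y in Ioi 0, deriv φ Y • (ψ Y : ℂ) := by
      refine integral_congr_ae ?_
      filter_upwards [coeFn_testL2 (h.continuous_deriv (by norm_num)) hc.deriv] with Y hY
      rw [hY, Complex.real_smul, Complex.real_smul, mul_comm]
    rw [e1, e2, e, add_neg_cancel]
  | zero => simp
  | add x y _ _ hx hy => rw [inner_add_left, hx, hy, add_zero]
  | smul c x _ hx => rw [inner_smul_left, hx, mul_zero]

/-- Weak formulations tested on `H¹₀`. -/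
theorem isWeakDeriv_of_forall_h10 {X Z : L2}
    (h : ∀ F : H10, ⟪derL F, X⟫_ℂ + ⟪valL F, Z⟫_ℂ = 0) : IsWeakDeriv X Z := by
  refine ⟨L2.locallyIntegrableOn _, L2.locallyIntegrableOn _, fun φ hφ hc hs => ?_⟩
  obtain ⟨F, h1, h2⟩ := exists_h10_test hφ hc hs
  have := h F
  rw [h1, h2, inner_testL2, inner_testL2] at this
  exact eq_neg_of_add_eq_zero_left this

theorem L2.intervalIntegrable (f : L2) {b : ℝ} (hb : 0 ≤ b) : IntervalIntegrable f volume 0 b := by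
  rw [intervalIntegrable_iff_integrableOn_Ioc_of_le hb]
  have h : MemLp f 2 (volume.restrict (Ioc 0 b)) :=
    (Lp.memLp f).mono_measure (Measure.restrict_mono (fun x hx => hx.1) le_rfl)
  exact memLp_one_iff_integrable.1 (h.mono_exponent (by norm_num))

theorem L2.continuousOn_primitive (f : L2) :
    ContinuousOn (fun Y => ∫ t in (0 : ℝ)..Y, f t) (Ici 0) := by
  intro Y hY
  have hY0 : (0 : ℝ) ≤ Y := hY
  have h := (absolutelyContinuous_primitive (c := 0)
    (L2.intervalIntegrable f (b := Y + 1) (by positivity)) (by simp)).continuousOn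
  rw [uIcc_of_le (by positivity)] at h
  refine (h Y ⟨hY, by linarith⟩).mono_of_mem_nhdsWithin ?_
  rw [← Ici_inter_Iic]
  exact inter_mem_nhdsWithin _ (Iic_mem_nhds (by linarith))

/-- A priori the representative is C plus the primitive from 0. The definition of `h10` permits test
functions equal to one at the origin; integration by parts against such a cutoff leaves the boundary
term -C, which therefore vanishes. This is how the Dirichlet condition is encoded. -/
theorem h10_eq_primitive (F : H10) : valL F =ᵐ[halfLine] fun Y => ∫ t in (0 : ℝ)..Y, derL F t := by
  obtain ⟨C₁, hC₁⟩ := (h10_isWeakDeriv F).exists_eq_primitive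
  set C : ℂ := C₁ - ∫ t in (0 : ℝ)..1, derL F t with hC
  have hval : valL F =ᵐ[halfLine] fun Y => C + ∫ t in (0 : ℝ)..Y, derL F t := by
    filter_upwards [hC₁, ae_restrict_mem measurableSet_Ioi] with Y hY hY0
    have h0 : (0 : ℝ) ≤ Y := le_of_lt hY0
    rw [hY, hC, ← intervalIntegral.integral_add_adjacent_intervals
      (L2.intervalIntegrable _ zero_le_one)
      ((L2.intervalIntegrable (derL F) zero_le_one).symm.trans (L2.intervalIntegrable _ h0))]
    ring
  let φ : ContDiffBump (0 : ℝ) := ⟨1, 2, by norm_num, by norm_num⟩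
  have hφ : ContDiff ℝ ∞ φ := φ.contDiff
  have hz : ∀ x, x ∉ Ioo (-3 : ℝ) 3 → φ x = 0 ∧ deriv φ x = 0 := by
    intro x hx
    have hx' : x ∉ tsupport φ := by
      rw [φ.tsupport_eq, mem_closedBall_iff_norm, Real.norm_eq_abs, sub_zero]
      intro h
      have := abs_le.1 (show |x| ≤ 2 from h)
      exact hx ⟨by linarith, by linarith⟩
    exact ⟨image_eq_zero_of_notMem_tsupport hx',
      image_eq_zero_of_notMem_tsupport fun h => hx' (tsupport_deriv_subset h)⟩
  have hdc : Continuous (deriv φ) := hφ.continuous_deriv (by norm_num)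
  have hint := h10_integral F hφ φ.hasCompactSupport
  have hto : ∀ f : ℝ → ℂ, (∀ x, x ∉ Ioo (-3 : ℝ) 3 → f x = 0) →
      ∫ Y in Ioi 0, f Y = ∫ Y in (0 : ℝ)..3, f Y := by
    intro f hf
    rw [intervalIntegral.integral_of_le (by norm_num)]
    apply setIntegral_eq_of_subset_of_forall_sdiff_eq_zero measurableSet_Ioi
    · intro x hx; exact hx.1
    · intro x hx
      exact hf x fun h => hx.2 ⟨hx.1, h.2.le⟩
  have hgi := L2.intervalIntegrable (derL F) (b := 3) (by norm_num)
  have hcst : ∀ z : ℂ, AbsolutelyContinuousOnInterval (fun _ : ℝ => z) 0 3 := fun z =>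
    (contDiff_const (n := 1)).contDiffOn.absolutelyContinuousOnInterval
  have hH := ((hφ.of_le (m := 1) (by norm_num)).contDiffOn (s := uIcc (0 : ℝ) 3)).absolutelyContinuousOnInterval.fun_smul
    ((hcst C).fun_add (absolutelyContinuous_primitive hgi (c := 0) (by simp)))
  have hF' : ContinuousOn (fun Y => C + ∫ t in (0 : ℝ)..Y, derL F t) (uIcc 0 3) :=
    continuousOn_const.add ((L2.continuousOn_primitive _).mono (by
      rw [uIcc_of_le (by norm_num)]; exact fun x hx => hx.1))
  have hi1 : IntervalIntegrable (fun Y => deriv φ Y • (C + ∫ t in (0 : ℝ)..Y, derL F t)) volume 0 3 :=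
    (hdc.continuousOn.smul hF').intervalIntegrable
  have hi2 : IntervalIntegrable (fun Y => φ Y • derL F Y) volume 0 3 :=
    hgi.continuousOn_smul hφ.continuous.continuousOn
  have e := integral_eq_sub_of_absolutelyContinuous hH (hi1.add hi2) (by
    filter_upwards [hgi.ae_hasDerivAt_integral] with x hx hxm
    have h1 := ((hφ.differentiable (by norm_num)) x).hasDerivAt.smul
      ((hx hxm 0 (by simp)).const_add C)
    convert! h1 using 1
    exact add_comm _ _)
  rw [intervalIntegral.integral_add hi1 hi2] at e
  have e1 : ∫ Y in (0 : ℝ)..3, deriv φ Y • (C + ∫ t in (0 : ℝ)..Y, derL F t)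
      = ∫ Y in Ioi 0, deriv φ Y • valL F Y := by
    rw [← hto _ (fun x hx => by rw [(hz x hx).2, zero_smul])]
    refine integral_congr_ae ?_
    filter_upwards [hval] with Y hY
    rw [hY]
  rw [e1, hint, hto _ (fun x hx => by rw [(hz x hx).1, zero_smul]), neg_add_cancel] at e
  have h1 : φ 0 = 1 := φ.one_of_mem_closedBall (by simp [φ])
  rw [(hz 3 (by simp)).1, h1] at e
  simp only [zero_smul, intervalIntegral.integral_same, add_zero, one_smul, zero_sub] at e
  have hC0 : C = 0 := by rw [← neg_eq_zero]; exact e.symm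
  filter_upwards [hval] with Y hY
  rw [hY, hC0, zero_add]

/-- Cauchy–Schwarz against the indicator of (0, Y], whose norm is √Y. -/
theorem L2.norm_integral_le (f : L2) {Y : ℝ} (hY : 0 ≤ Y) :
    ‖∫ t in (0 : ℝ)..Y, f t‖ ≤ √Y * ‖f‖ := by
  have hr : halfLine.restrict (Ioc 0 Y) = volume.restrict (Ioc 0 Y) := by
    rw [Measure.restrict_restrict measurableSet_Ioc]
    congr 1
    exact inter_eq_left.2 fun x hx => hx.1
  have hm : halfLine (Ioc 0 Y) = ENNReal.ofReal Y := by
    rw [← Measure.restrict_apply_self, hr, Measure.restrict_apply_self, Real.volume_Ioc, sub_zero]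
  have h := L2.inner_indicatorConstLp_one (𝕜 := ℂ) measurableSet_Ioc
    (show halfLine (Ioc 0 Y) ≠ ⊤ by rw [hm]; exact ENNReal.ofReal_ne_top) f
  rw [intervalIntegral.integral_of_le hY, ← hr, ← h]
  refine (norm_inner_le_norm _ _).trans (le_of_eq ?_)
  rw [norm_indicatorConstLp (by norm_num) (by norm_num), measureReal_def, hm, ENNReal.toReal_ofReal hY]
  rw [Real.sqrt_eq_rpow]
  simp

/-- A function vanishing at 0 satisfies |F(Y)|² ≤ Y‖F'‖², so a weight with ∫|k|²Y finite is
controlled by the derivative alone. No zero-order norm enters, which keeps the later bounds uniform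
as α tends to 0. -/
theorem h10_hardy {k : ℝ →ᵇ ℂ} {w : ℝ → ℝ} (hw : IntegrableOn w (Ioi 0))
    (hk : ∀ Y, 0 < Y → ‖k Y‖ ^ 2 * Y ≤ w Y) (F : H10) :
    ‖mulL k (valL F)‖ ^ 2 ≤ (∫ Y in Ioi 0, w Y) * ‖derL F‖ ^ 2 := by
  rw [norm_sq_eq_integral, ← integral_mul_const]
  refine integral_mono_ae (integrable_norm_sq _) (hw.mul_const _) ?_
  filter_upwards [coeFn_mulL k (valL F), h10_eq_primitive F, ae_restrict_mem measurableSet_Ioi]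
    with Y h1 h2 hY
  have hY0 : (0 : ℝ) ≤ Y := le_of_lt hY
  have h3 := L2.norm_integral_le (derL F) hY0
  rw [h1, h2, norm_mul, mul_pow]
  calc ‖k Y‖ ^ 2 * ‖∫ t in (0 : ℝ)..Y, derL F t‖ ^ 2
      ≤ ‖k Y‖ ^ 2 * (√Y * ‖derL F‖) ^ 2 := by gcongr
    _ = (‖k Y‖ ^ 2 * Y) * ‖derL F‖ ^ 2 := by rw [mul_pow, Real.sq_sqrt hY0]; ring
    _ ≤ _ := by gcongr; exact hk Y hY

theorem h10_vanishesAtZero (F : H10) : VanishesAtZero (valL F) :=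
  ⟨_, L2.continuousOn_primitive _, h10_eq_primitive F, by simp⟩

/-! ### The reduced profile -/

/-- A profile `U` on the half line with `∂_Y² U = -θ²`, `∂_Y U = τ θ` and `∂_Y θ = κ θ`, extended
to the line by constants. -/
structure ReducedProfile (m : ℝ) where
  (U τ θ κ : ℝ → ℝ)
  K : ℝ
  s : ℝ
  σ : ℝ
  continuous_U : Continuous U
  continuous_τ : Continuous τ
  continuous_θ : Continuous θ
  continuous_κ : Continuous κ
  U_nonneg : ∀ Y, 0 ≤ U Y
  U_le : ∀ Y, U Y ≤ 1
  θ_pos : ∀ Y, 0 < θ Y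
  abs_τ_le : ∀ Y, |τ Y| ≤ K
  abs_κ_le : ∀ Y, |κ Y| ≤ K
  θ_le : ∀ Y, θ Y ≤ K
  s_pos : 0 < s
  θ_decay : ∀ Y, 0 < Y → θ Y ≤ K * Real.exp (-s * Y)
  σ_pos : 0 < σ
  subsonic : ∀ Y, σ ≤ 1 - m ^ 2 * U Y ^ 2 - 2 * m ^ 2 * U Y * τ Y ^ 2
  hasDerivAt_U : ∀ Y, 0 < Y → HasDerivAt U (τ Y * θ Y) Y
  hasDerivAt_θ : ∀ Y, 0 < Y → HasDerivAt θ (κ Y * θ Y) Y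
  hasDerivAt_τ : ∀ Y, 0 < Y → HasDerivAt τ (-θ Y - κ Y * τ Y) Y

/-- The subsonic and ratio conditions on the profile are assumed for Y > 0 only; this carries them
to Y = 0, the point from which the coefficients are extended to the line. -/
theorem nonneg_Ici_of_nonneg_Ioi {f : ℝ → ℝ} (hf : ContinuousOn f (Ici 0))
    (h : ∀ Y, 0 < Y → 0 ≤ f Y) : ∀ Y, 0 ≤ Y → 0 ≤ f Y := by
  intro Y hY
  rcases hY.eq_or_lt with rfl | hY
  · have h0 : Tendsto f (𝓝[>] 0) (𝓝 (f 0)) := (hf 0 (by simp)).mono_left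
      (nhdsWithin_mono _ Ioi_subset_Ici_self)
    exact ge_of_tendsto h0 (eventually_mem_nhdsWithin.mono fun Y hY => h Y hY)
  · exact h Y hY

theorem hasDerivAt_dProfile {U : ℝ → ℝ} (hU : ContDiffOn ℝ 3 U (Ici 0)) {k : ℕ} (hk : k < 3)
    {Y : ℝ} (hY : 0 < Y) : HasDerivAt (dProfile k U) (dProfile (k + 1) U Y) Y := by
  have hd : DifferentiableOn ℝ (iteratedDerivWithin k U (Ici 0)) (Ici 0) :=
    hU.differentiableOn_iteratedDerivWithin (by exact_mod_cast hk) (uniqueDiffOn_Ici 0)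
  have := (hd Y hY.le).hasDerivWithinAt
  rw [← iteratedDerivWithin_succ] at this
  exact this.hasDerivAt (Ici_mem_nhds hY)

theorem continuousOn_dProfile {U : ℝ → ℝ} (hU : ContDiffOn ℝ 3 U (Ici 0)) {k : ℕ} (hk : k ≤ 3) :
    ContinuousOn (dProfile k U) (Ici 0) :=
  hU.continuousOn_iteratedDerivWithin (by exact_mod_cast hk) (uniqueDiffOn_Ici 0)

theorem continuous_comp_max {f : ℝ → ℝ} (hf : ContinuousOn f (Ici 0)) :
    Continuous fun Y => f (max Y 0) :=
  hf.comp_continuous (by fun_prop) fun Y => mem_Ici.2 (le_max_right _ _)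

theorem hasDerivAt_comp_max {f : ℝ → ℝ} {f' Y : ℝ} (hY : 0 < Y) (hf : HasDerivAt f f' Y) :
    HasDerivAt (fun Y => f (max Y 0)) f' Y :=
  hf.congr_of_eventuallyEq ((eventually_gt_nhds hY).mono fun Z hZ => by
    simp only [max_eq_left hZ.le])

theorem dProfile_zero (U : ℝ → ℝ) : dProfile 0 U = U := by
  funext Y
  simp [dProfile]

/-- The subsonic condition forces U'' < 0 on [0, ∞), so θ = √(-U'') is positive and τ = U'/θ makes
sense. Divided by -U'', the condition becomes the lower bound σ₁ for 1 - m²U² - 2m²Uτ²; it also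
gives τ² ≤ 1/σ₁. The ratio bounds control κ = U'''/(2U'') and, through |U''| ≤ σ₂U', give θ half the
exponential rate of U'. -/
theorem IsBoundaryLayerProfile.exists_reduced {m : ℝ} {U : ℝ → ℝ}
    (hm₀ : 0 < m) (hm₁ : m ^ 2 < 1 / 3) (hU : IsBoundaryLayerProfile m U) :
    ∃ R : ReducedProfile m, ∀ Y, 0 < Y → R.U Y = U Y ∧ dProfile 1 U Y = R.τ Y * R.θ Y ∧
      dProfile 2 U Y = -R.θ Y ^ 2 := by
  obtain ⟨s₀, s₁, s₂, hs₀, hs₁, hs₂, hs⟩ := hU.deriv_bounds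
  obtain ⟨σ₁, hσ₁, hsub⟩ := hU.subsonic
  obtain ⟨σ₂, hσ₂, hrat⟩ := hU.ratio_bounds
  have h3 := hU.contDiffOn
  have c0 : ContinuousOn U (Ici 0) := h3.continuousOn
  have c1 := continuousOn_dProfile h3 (k := 1) (by norm_num)
  have c2 := continuousOn_dProfile h3 (k := 2) (by norm_num)
  have c3 := continuousOn_dProfile h3 (k := 3) (by norm_num)
  have d0 : ∀ Y, 0 < Y → HasDerivAt U (dProfile 1 U Y) Y := fun Y hY => by
    simpa [dProfile_zero] using hasDerivAt_dProfile h3 (k := 0) (by norm_num) hY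
  have d1 : ∀ Y, 0 < Y → HasDerivAt (dProfile 1 U) (dProfile 2 U Y) Y := fun Y hY =>
    hasDerivAt_dProfile h3 (k := 1) (by norm_num) hY
  have d2 : ∀ Y, 0 < Y → HasDerivAt (dProfile 2 U) (dProfile 3 U Y) Y := fun Y hY =>
    hasDerivAt_dProfile h3 (k := 2) (by norm_num) hY
  set D1 := dProfile 1 U
  set D2 := dProfile 2 U
  set D3 := dProfile 3 U
  have p1 : ∀ Y, 0 ≤ Y → 0 < D1 Y := fun Y hY =>
    lt_of_lt_of_le (mul_pos hs₁ (Real.exp_pos _)) (hs Y hY).1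
  have hmono : MonotoneOn U (Ici 0) := by
    apply monotoneOn_of_deriv_nonneg (convex_Ici 0) c0
    · intro Y hY
      rw [interior_Ici] at hY
      exact (d0 Y hY).differentiableAt.differentiableWithinAt
    · intro Y hY
      rw [interior_Ici] at hY
      rw [(d0 Y hY).deriv]
      exact (p1 Y (le_of_lt hY)).le
  have hU0 : ∀ Y, 0 ≤ Y → 0 ≤ U Y := fun Y hY => by
    have := hmono (by simp) hY hY
    rwa [hU.zero] at this
  have hU1 : ∀ Y, 0 ≤ Y → U Y ≤ 1 := fun Y hY =>
    ge_of_tendsto hU.tendsto_one ((eventually_ge_atTop Y).mono fun Z hZ =>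
      hmono hY (le_trans hY hZ) hZ)
  have hsub' : ∀ Y, 0 ≤ Y → 0 ≤ (-D2 Y * (1 - m ^ 2 * U Y ^ 2) - 2 * m ^ 2 * U Y * |D1 Y| ^ 2)
      - σ₁ * (|D2 Y| + |D1 Y| ^ 2) := by
    apply nonneg_Ici_of_nonneg_Ioi
    · fun_prop
    · intro Y hY
      have h := hsub Y hY
      have hpos : 0 < |D2 Y| + |D1 Y| ^ 2 := by
        have := p1 Y hY.le
        positivity
      rw [subsonicH, le_div_iff₀ hpos] at h
      linarith
  have hA : ∀ Y, 0 ≤ Y → 0 < 1 - m ^ 2 * U Y ^ 2 ∧ 1 - m ^ 2 * U Y ^ 2 ≤ 1 := fun Y hY => by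
    have h1 := hU0 Y hY
    have h2 := hU1 Y hY
    have h3 : U Y ^ 2 ≤ 1 := by nlinarith
    constructor <;> nlinarith [sq_nonneg m, sq_nonneg (U Y), mul_nonneg (sq_nonneg m) (sq_nonneg (U Y))]
  have n2 : ∀ Y, 0 ≤ Y → D2 Y < 0 := fun Y hY => by
    have h1 := hsub' Y hY
    have h2 := hA Y hY
    have h3 : 0 < σ₁ * (|D2 Y| + |D1 Y| ^ 2) := by
      have := p1 Y hY
      positivity
    have h4 : 0 ≤ 2 * m ^ 2 * U Y * |D1 Y| ^ 2 := by
      have := hU0 Y hY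
      positivity
    by_contra hn
    have : 0 ≤ D2 Y * (1 - m ^ 2 * U Y ^ 2) := mul_nonneg (not_lt.1 hn) h2.1.le
    linarith
  have hsub'' : ∀ Y, 0 ≤ Y → σ₁ * (-D2 Y + D1 Y ^ 2) + 2 * m ^ 2 * U Y * D1 Y ^ 2
      ≤ -D2 Y * (1 - m ^ 2 * U Y ^ 2) := fun Y hY => by
    have h1 := hsub' Y hY
    rw [abs_of_neg (n2 Y hY), sq_abs] at h1
    linarith
  have hκ' : ∀ Y, 0 ≤ Y → 0 ≤ σ₂ - |D3 Y / D2 Y| := by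
    apply nonneg_Ici_of_nonneg_Ioi
    · exact continuousOn_const.sub (c3.div c2 fun Y hY => (n2 Y hY).ne).abs
    · intro Y hY
      have h := hrat Y hY
      have := p1 Y hY.le
      have h2 : 0 ≤ |D2 Y| / D1 Y := by positivity
      have h3 : 0 ≤ (1 - U Y) / D1 Y := div_nonneg (by linarith [hU1 Y hY.le]) this.le
      linarith
  have hdec : ∀ Y, 0 ≤ Y → 0 ≤ σ₂ * s₂ * Real.exp (-s₀ * Y) - (-D2 Y) := by
    apply nonneg_Ici_of_nonneg_Ioi
    · fun_prop
    · intro Y hY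
      have h := hrat Y hY
      have hp := p1 Y hY.le
      have h2 : 0 ≤ |D3 Y / D2 Y| := abs_nonneg _
      have h3 : 0 ≤ (1 - U Y) / D1 Y := div_nonneg (by linarith [hU1 Y hY.le]) hp.le
      have h4 : |D2 Y| / D1 Y ≤ σ₂ := by linarith
      rw [div_le_iff₀ hp, abs_of_neg (n2 Y hY.le)] at h4
      have := (hs Y hY.le).2
      nlinarith
  set θ : ℝ → ℝ := fun Y => √(-D2 Y) with hθ
  have hθp : ∀ Y, 0 ≤ Y → 0 < θ Y := fun Y hY => Real.sqrt_pos.2 (by linarith [n2 Y hY])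
  have hθ2 : ∀ Y, 0 ≤ Y → θ Y ^ 2 = -D2 Y := fun Y hY => Real.sq_sqrt (by linarith [n2 Y hY])
  have cθ : ContinuousOn θ (Ici 0) := c2.neg.sqrt
  set τ : ℝ → ℝ := fun Y => D1 Y / θ Y with hτ
  have cτ : ContinuousOn τ (Ici 0) := c1.div cθ fun Y hY => (hθp Y hY).ne'
  set κ : ℝ → ℝ := fun Y => D3 Y / D2 Y / 2 with hκ
  have cκ : ContinuousOn κ (Ici 0) := (c3.div c2 fun Y hY => (n2 Y hY).ne).div_const 2
  have dθ : ∀ Y, 0 < Y → HasDerivAt θ (κ Y * θ Y) Y := fun Y hY => by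
    have h := (d2 Y hY).neg.sqrt (by simpa using (n2 Y hY.le).ne)
    convert! h using 1
    have e := hθ2 Y hY.le
    have e2 := hθp Y hY.le
    have e3 := n2 Y hY.le
    show D3 Y / D2 Y / 2 * θ Y = -D3 Y / (2 * θ Y)
    have e4 : D2 Y = -θ Y ^ 2 := by linarith
    rw [e4]
    field_simp
  have dτ : ∀ Y, 0 < Y → HasDerivAt τ (-θ Y - κ Y * τ Y) Y := fun Y hY => by
    have e2 := hθp Y hY.le
    have h := (d1 Y hY).div (dθ Y hY) e2.ne'
    convert! h using 1
    have e := hθ2 Y hY.le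
    have e4 : D2 Y = -θ Y ^ 2 := by linarith
    show -θ Y - κ Y * (D1 Y / θ Y) = _
    rw [e4]
    field_simp
  have hτ2 : ∀ Y, 0 ≤ Y → τ Y ^ 2 * (-D2 Y) = D1 Y ^ 2 := fun Y hY => by
    rw [← hθ2 Y hY, hτ]
    have := hθp Y hY
    field_simp
  have hτb : ∀ Y, 0 ≤ Y → τ Y ^ 2 ≤ 1 / σ₁ := fun Y hY => by
    have h1 := hsub'' Y hY
    have h2 := hτ2 Y hY
    have h3 := n2 Y hY
    have h4 := hA Y hY
    have h5 : 0 ≤ 2 * m ^ 2 * U Y * D1 Y ^ 2 := by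
      have := hU0 Y hY
      positivity
    rw [le_div_iff₀ hσ₁]
    have h6 : σ₁ * D1 Y ^ 2 ≤ -D2 Y := by nlinarith
    rw [← h2] at h6
    have h7 : (τ Y ^ 2 * σ₁) * (-D2 Y) ≤ 1 * (-D2 Y) := by linarith
    exact le_of_mul_le_mul_right h7 (by linarith)
  have hEb : ∀ Y, 0 ≤ Y → σ₁ ≤ 1 - m ^ 2 * U Y ^ 2 - 2 * m ^ 2 * U Y * τ Y ^ 2 := fun Y hY => by
    have h1 := hsub'' Y hY
    have h2 := hτ2 Y hY
    have h3 := n2 Y hY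
    have h5 : 0 ≤ σ₁ * D1 Y ^ 2 := by positivity
    have h7 : σ₁ * (-D2 Y) ≤ (1 - m ^ 2 * U Y ^ 2 - 2 * m ^ 2 * U Y * τ Y ^ 2) * (-D2 Y) := by
      have : 2 * m ^ 2 * U Y * τ Y ^ 2 * (-D2 Y) = 2 * m ^ 2 * U Y * D1 Y ^ 2 := by rw [← h2]; ring
      linarith
    exact le_of_mul_le_mul_right h7 (by linarith)
  set B : ℝ := √(σ₂ * s₂) with hB
  have hθd : ∀ Y, 0 ≤ Y → θ Y ≤ B * Real.exp (-(s₀ / 2) * Y) := fun Y hY => by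
    apply Real.sqrt_le_iff.2 ⟨by positivity, ?_⟩
    have h := hdec Y hY
    rw [mul_pow, hB, Real.sq_sqrt (by positivity), ← Real.exp_nat_mul]
    have : ((2 : ℕ) : ℝ) * (-(s₀ / 2) * Y) = -s₀ * Y := by push_cast; ring
    rw [this]
    linarith
  set K : ℝ := max B (max σ₂ (√(1 / σ₁))) with hK
  -- Composition with max(Y, 0) freezes every function at its value at 0 for negative Y. The
  -- differential relations are only claimed for Y > 0.
  refine ⟨{
    U := fun Y => U (max Y 0)
    τ := fun Y => τ (max Y 0)
    θ := fun Y => θ (max Y 0)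
    κ := fun Y => κ (max Y 0)
    K := K
    s := s₀ / 2
    σ := σ₁
    continuous_U := continuous_comp_max c0
    continuous_τ := continuous_comp_max cτ
    continuous_θ := continuous_comp_max cθ
    continuous_κ := continuous_comp_max cκ
    U_nonneg := fun Y => hU0 _ (le_max_right _ _)
    U_le := fun Y => hU1 _ (le_max_right _ _)
    θ_pos := fun Y => hθp _ (le_max_right _ _)
    abs_τ_le := fun Y => (Real.abs_le_sqrt (hτb _ (le_max_right _ _))).trans
      ((le_max_right _ _).trans (le_max_right _ _))
    abs_κ_le := fun Y => by
      have h := hκ' _ (le_max_right Y 0)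
      rw [hκ, abs_div, abs_two]
      have : σ₂ ≤ K := (le_max_left _ _).trans (le_max_right _ _)
      linarith [abs_nonneg (D3 (max Y 0) / D2 (max Y 0))]
    θ_le := fun Y => by
      refine (hθd _ (le_max_right Y 0)).trans ?_
      have h1 : Real.exp (-(s₀ / 2) * max Y 0) ≤ 1 := by
        rw [Real.exp_le_one_iff]
        have := le_max_right Y 0
        have : 0 ≤ s₀ / 2 * max Y 0 := by positivity
        linarith
      have h2 : B ≤ K := le_max_left _ _
      have h3 : 0 ≤ B := Real.sqrt_nonneg _
      nlinarith [Real.exp_pos (-(s₀ / 2) * max Y 0)]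
    s_pos := by positivity
    θ_decay := fun Y hY => by
      rw [max_eq_left hY.le]
      refine (hθd Y hY.le).trans ?_
      gcongr
      exact le_max_left _ _
    σ_pos := hσ₁
    subsonic := fun Y => hEb _ (le_max_right _ _)
    hasDerivAt_U := fun Y hY => by
      have e := hθp Y hY.le
      convert hasDerivAt_comp_max hY (d0 Y hY) using 1
      simp only [max_eq_left hY.le, hτ]
      field_simp
    hasDerivAt_θ := fun Y hY => by
      simpa only [max_eq_left hY.le] using hasDerivAt_comp_max hY (dθ Y hY)
    hasDerivAt_τ := fun Y hY => by
      simpa only [max_eq_left hY.le] using hasDerivAt_comp_max hY (dτ Y hY) }, fun Y hY => ?_⟩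
  have e := hθp Y hY.le
  simp only [max_eq_left hY.le]
  refine ⟨trivial, ?_, ?_⟩
  · simp only [hτ]; field_simp
  · rw [hθ2 Y hY.le]; ring

/-! ### Coefficients -/

/-- A bounded continuous real function as a complex valued one. -/
def ofRealBCF (f : ℝ → ℝ) (hf : Continuous f) (C : ℝ) (hC : ∀ Y, |f Y| ≤ C) : ℝ →ᵇ ℂ :=
  BoundedContinuousFunction.ofNormedAddCommGroup (fun Y => (f Y : ℂ))
    (Complex.continuous_ofReal.comp hf) C fun Y => by
      rw [Complex.norm_real]; exact hC Y

namespace ReducedProfile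

variable {m : ℝ} (R : ReducedProfile m)

def bU : ℝ →ᵇ ℂ := ofRealBCF R.U R.continuous_U 1 fun Y => by
  rw [abs_of_nonneg (R.U_nonneg Y)]; exact R.U_le Y
def bτ : ℝ →ᵇ ℂ := ofRealBCF R.τ R.continuous_τ R.K R.abs_τ_le
def bθ : ℝ →ᵇ ℂ := ofRealBCF R.θ R.continuous_θ R.K fun Y => by
  rw [abs_of_pos (R.θ_pos Y)]; exact R.θ_le Y
def bκ : ℝ →ᵇ ℂ := ofRealBCF R.κ R.continuous_κ R.K R.abs_κ_le

@[simp] theorem bU_apply (Y : ℝ) : R.bU Y = R.U Y := rfl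
@[simp] theorem bτ_apply (Y : ℝ) : R.bτ Y = R.τ Y := rfl
@[simp] theorem bθ_apply (Y : ℝ) : R.bθ Y = R.θ Y := rfl
@[simp] theorem bκ_apply (Y : ℝ) : R.bκ Y = R.κ Y := rfl

/-- `U - c`. -/
def cz (c : ℂ) : ℝ →ᵇ ℂ := R.bU - c • 1
/-- `A = 1 - m² (U - c)²`. -/
def cA (c : ℂ) : ℝ →ᵇ ℂ := 1 - ((m : ℂ) ^ 2) • R.cz c ^ 2
/-- `E = A - 2 m² (U - c) τ²`, so that `∂_Y (A⁻¹ ∂_Y U) = -θ² A⁻² E`. -/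
def cE (c : ℂ) : ℝ →ᵇ ℂ := R.cA c - (2 * (m : ℂ) ^ 2) • (R.cz c * R.bτ ^ 2)
/-- `A⁻¹`. -/
def ca (c : ℂ) : ℝ →ᵇ ℂ := Ring.inverse (R.cA c)
/-- `E⁻¹`. -/
def ce (c : ℂ) : ℝ →ᵇ ℂ := Ring.inverse (R.cE c)
/-- `∂_Y A`. -/
def cdA (c : ℂ) : ℝ →ᵇ ℂ := (-2 * (m : ℂ) ^ 2) • (R.cz c * R.bτ * R.bθ)
/-- `∂_Y E`. -/
def cdE (c : ℂ) : ℝ →ᵇ ℂ :=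
  R.cdA c - (2 * (m : ℂ) ^ 2) • (R.bτ ^ 3 * R.bθ - (2 : ℂ) • (R.cz c * R.bτ * (R.bθ + R.bκ * R.bτ)))
/-- The multiplier `p = A² / E = -θ² / ∂_Y (A⁻¹ ∂_Y U)`. -/
def cp (c : ℂ) : ℝ →ᵇ ℂ := R.cA c ^ 2 * R.ce c
/-- `∂_Y p - κ p`. -/
def ct (c : ℂ) : ℝ →ᵇ ℂ :=
  (2 : ℂ) • (R.cA c * R.cdA c * R.ce c) - R.cA c ^ 2 * R.cdE c * R.ce c ^ 2 - R.bκ * R.cp c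
/-- `2 θ⁻¹ ∂_Y (A⁻¹)`. -/
def cr₂ (c : ℂ) : ℝ →ᵇ ℂ := (4 * (m : ℂ) ^ 2) • (R.cz c * R.bτ * R.ca c ^ 2)
/-- `θ⁻¹ ∂_Y² (A⁻¹)`. -/
def cr₁ (c : ℂ) : ℝ →ᵇ ℂ := (2 * (m : ℂ) ^ 2) • (R.bθ * (R.bτ ^ 2 * R.ca c ^ 2 - R.cz c * R.ca c ^ 2
  + (4 * (m : ℂ) ^ 2) • (R.cz c ^ 2 * R.bτ ^ 2 * R.ca c ^ 3)))
/-- `A⁻¹ ∂_Y A`. -/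
def cb (c : ℂ) : ℝ →ᵇ ℂ := R.cdA c * R.ca c

/-- The set of admissible spectral parameters. -/
def adm : Set ℂ := {c | IsUnit (R.cA c) ∧ IsUnit (R.cE c)}

@[simp] theorem cz_apply (c : ℂ) (Y : ℝ) : R.cz c Y = R.U Y - c := by simp [cz]

theorem cA_apply (c : ℂ) (Y : ℝ) : R.cA c Y = 1 - (m : ℂ) ^ 2 * (R.U Y - c) ^ 2 := by simp [cA]

theorem cE_apply (c : ℂ) (Y : ℝ) :
    R.cE c Y = 1 - (m : ℂ) ^ 2 * (R.U Y - c) ^ 2 - 2 * (m : ℂ) ^ 2 * ((R.U Y - c) * R.τ Y ^ 2) := by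
  simp [cE, cA_apply]

theorem cA_mul_ca {c : ℂ} (hc : c ∈ R.adm) (Y : ℝ) : R.cA c Y * R.ca c Y = 1 := by
  have := congrArg (fun f : ℝ →ᵇ ℂ => f Y) (Ring.mul_inverse_cancel _ hc.1)
  exact this

theorem cE_mul_ce {c : ℂ} (hc : c ∈ R.adm) (Y : ℝ) : R.cE c Y * R.ce c Y = 1 := by
  have := congrArg (fun f : ℝ →ᵇ ℂ => f Y) (Ring.mul_inverse_cancel _ hc.2)
  exact this

theorem cA_ne {c : ℂ} (hc : c ∈ R.adm) (Y : ℝ) : R.cA c Y ≠ 0 :=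
  left_ne_zero_of_mul_eq_one (R.cA_mul_ca hc Y)

theorem cE_ne {c : ℂ} (hc : c ∈ R.adm) (Y : ℝ) : R.cE c Y ≠ 0 :=
  left_ne_zero_of_mul_eq_one (R.cE_mul_ce hc Y)

theorem ca_apply {c : ℂ} (hc : c ∈ R.adm) (Y : ℝ) : R.ca c Y = (R.cA c Y)⁻¹ :=
  eq_inv_of_mul_eq_one_right (R.cA_mul_ca hc Y)

theorem ce_apply {c : ℂ} (hc : c ∈ R.adm) (Y : ℝ) : R.ce c Y = (R.cE c Y)⁻¹ :=
  eq_inv_of_mul_eq_one_right (R.cE_mul_ce hc Y)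

theorem isUnit_of_le {f : ℝ →ᵇ ℂ} {δ : ℝ} (hδ : 0 < δ) (hf : ∀ Y, δ ≤ ‖f Y‖) : IsUnit f := by
  have hne : ∀ Y, f Y ≠ 0 := fun Y h => by
    have := hf Y
    rw [h, norm_zero] at this
    linarith
  let g : ℝ →ᵇ ℂ := BoundedContinuousFunction.ofNormedAddCommGroup (fun Y => (f Y)⁻¹)
    (f.continuous.inv₀ hne) δ⁻¹ fun Y => by
      rw [norm_inv]; exact inv_anti₀ hδ (hf Y)
  refine IsUnit.of_mul_eq_one g ?_
  ext Y
  exact mul_inv_cancel₀ (hne Y)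

/-- At c = 0 both coefficients are real and bounded below, A by 2/3 and E by the subsonic constant.
A uniform lower bound is what makes the reciprocal a bounded function. -/
theorem zero_mem_adm (hm : m ^ 2 < 1 / 3) : (0 : ℂ) ∈ R.adm := by
  constructor
  · apply isUnit_of_le (δ := 2 / 3) (by norm_num)
    intro Y
    have h1 := R.U_nonneg Y
    have h2 := R.U_le Y
    have : R.cA 0 Y = ((1 - m ^ 2 * R.U Y ^ 2 : ℝ) : ℂ) := by rw [cA_apply]; push_cast; ring
    rw [this, Complex.norm_real, Real.norm_eq_abs]
    refine le_trans ?_ (le_abs_self _)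
    have : R.U Y ^ 2 ≤ 1 := by nlinarith
    nlinarith [sq_nonneg m, sq_nonneg (R.U Y)]
  · apply isUnit_of_le R.σ_pos
    intro Y
    have : R.cE 0 Y = ((1 - m ^ 2 * R.U Y ^ 2 - 2 * m ^ 2 * R.U Y * R.τ Y ^ 2 : ℝ) : ℂ) := by
      rw [cE_apply]; push_cast; ring
    rw [this, Complex.norm_real, Real.norm_eq_abs]
    exact (R.subsonic Y).trans (le_abs_self _)

section differentiable

theorem differentiable_cz : Differentiable ℂ R.cz := by
  unfold cz; fun_prop

theorem differentiable_cA : Differentiable ℂ R.cA := by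
  have := R.differentiable_cz
  unfold cA; fun_prop

theorem differentiable_cE : Differentiable ℂ R.cE := by
  have := R.differentiable_cz
  have := R.differentiable_cA
  unfold cE; fun_prop

theorem differentiable_cdA : Differentiable ℂ R.cdA := by
  have := R.differentiable_cz
  unfold cdA; fun_prop

theorem differentiable_cdE : Differentiable ℂ R.cdE := by
  have := R.differentiable_cz
  have := R.differentiable_cdA
  unfold cdE; fun_prop

theorem isOpen_adm : IsOpen R.adm :=
  (Units.isOpen.preimage R.differentiable_cA.continuous).inter
    (Units.isOpen.preimage R.differentiable_cE.continuous)

variable {R} {c : ℂ}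

theorem differentiableAt_ca (hc : c ∈ R.adm) : DifferentiableAt ℂ R.ca c :=
  (differentiableAt_inverse hc.1).comp c (R.differentiable_cA c)

theorem differentiableAt_ce (hc : c ∈ R.adm) : DifferentiableAt ℂ R.ce c :=
  (differentiableAt_inverse hc.2).comp c (R.differentiable_cE c)

theorem differentiableAt_cp (hc : c ∈ R.adm) : DifferentiableAt ℂ R.cp c := by
  have h1 := R.differentiable_cA c
  have h2 := differentiableAt_ce hc
  unfold cp; fun_prop

theorem differentiableAt_ct (hc : c ∈ R.adm) : DifferentiableAt ℂ R.ct c := by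
  have h1 := R.differentiable_cA c
  have h2 := differentiableAt_ce hc
  have h3 := R.differentiable_cdA c
  have h4 := R.differentiable_cdE c
  have h5 := differentiableAt_cp hc
  unfold ct; fun_prop

theorem differentiableAt_cr₂ (hc : c ∈ R.adm) : DifferentiableAt ℂ R.cr₂ c := by
  have h1 := R.differentiable_cz c
  have h2 := differentiableAt_ca hc
  unfold cr₂; fun_prop

theorem differentiableAt_cr₁ (hc : c ∈ R.adm) : DifferentiableAt ℂ R.cr₁ c := by
  have h1 := R.differentiable_cz c
  have h2 := differentiableAt_ca hc
  unfold cr₁; fun_prop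

theorem differentiableAt_cb (hc : c ∈ R.adm) : DifferentiableAt ℂ R.cb c := by
  have h1 := R.differentiable_cdA c
  have h2 := differentiableAt_ca hc
  unfold cb; fun_prop

end differentiable

/-! ### Bounds for small `c` -/

/-- This is (U - c)p at one point, with x = U and ρ = τ². The derivative at c = 0 is real, and the
factor 1 - 3m²x² in it is positive for 0 ≤ x ≤ 1 when m < 1/√3. The remaining contribution, from ρ ≥
0, then only helps. -/
theorem hasDerivAt_multiplier {m x ρ : ℝ} (hE : 1 - m ^ 2 * x ^ 2 - 2 * m ^ 2 * x * ρ ≠ 0) :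
    HasDerivAt (fun c : ℂ => (x - c) * (1 - (m : ℂ) ^ 2 * (x - c) ^ 2) ^ 2 /
      (1 - (m : ℂ) ^ 2 * (x - c) ^ 2 - 2 * (m : ℂ) ^ 2 * ((x - c) * ρ)))
      ((-((1 - m ^ 2 * x ^ 2) * ((1 - m ^ 2 * x ^ 2) * (1 - 3 * (m ^ 2 * x ^ 2))
        + 8 * m ^ 2 * x * ρ * (m ^ 2 * x ^ 2)) / (1 - m ^ 2 * x ^ 2 - 2 * m ^ 2 * x * ρ) ^ 2) : ℝ) : ℂ)
      0 := by
  have hz : HasDerivAt (fun c : ℂ => (x : ℂ) - c) (-1) 0 := by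
    simpa using (hasDerivAt_id (0 : ℂ)).const_sub (x : ℂ)
  have hA : HasDerivAt (fun c : ℂ => 1 - (m : ℂ) ^ 2 * (x - c) ^ 2)
      (-((m : ℂ) ^ 2 * (2 * (x - 0) * -1))) 0 := by
    simpa using ((hz.pow 2).const_mul ((m : ℂ) ^ 2)).const_sub 1
  have hEd : HasDerivAt (fun c : ℂ => 1 - (m : ℂ) ^ 2 * (x - c) ^ 2 - 2 * (m : ℂ) ^ 2 * ((x - c) * ρ))
      (-((m : ℂ) ^ 2 * (2 * (x - 0) * -1)) - 2 * (m : ℂ) ^ 2 * (-1 * ρ)) 0 :=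
    hA.sub ((hz.mul_const _).const_mul _)
  have hE' : (1 : ℂ) - (m : ℂ) ^ 2 * (x - 0) ^ 2 - 2 * (m : ℂ) ^ 2 * ((x - 0) * ρ) ≠ 0 := by
    have : ((1 - m ^ 2 * x ^ 2 - 2 * m ^ 2 * x * ρ : ℝ) : ℂ) ≠ 0 := by exact_mod_cast hE
    convert this using 1
    push_cast; ring
  have h := (hz.mul (hA.pow 2)).div hEd hE'
  convert! h using 1
  have hE2 : ((1 : ℂ) - (m : ℂ) ^ 2 * x ^ 2 - 2 * (m : ℂ) ^ 2 * x * ρ) ≠ 0 := by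
    convert hE' using 1; ring
  have hE3 : ((1 : ℂ) - (m : ℂ) ^ 2 * (x - 0) ^ 2 - 2 * (m : ℂ) ^ 2 * ((x - 0) * ρ))
    = ((1 : ℂ) - (m : ℂ) ^ 2 * x ^ 2 - 2 * (m : ℂ) ^ 2 * x * ρ) := by ring
  rw [hE3]
  push_cast
  rw [← neg_div]
  congr 1
  simp only [Pi.pow_apply, Pi.mul_apply]
  ring

/-- Second-order Taylor estimate for a holomorphic map. Applied with values in bounded continuous
functions, it bounds the remainder uniformly in Y. -/
theorem exists_norm_sub_sub_smul_le {F : Type*} [NormedAddCommGroup F] [NormedSpace ℂ F]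
    [CompleteSpace F] {g : ℂ → F} (hg : ∀ᶠ c in 𝓝 0, DifferentiableAt ℂ g c) :
    ∃ M : ℝ, ∀ᶠ c in 𝓝 (0 : ℂ), ‖g c - g 0 - c • deriv g 0‖ ≤ M * ‖c‖ ^ 2 := by
  have han : AnalyticAt ℂ g 0 := Complex.analyticAt_iff_eventually_differentiableAt.2 hg
  obtain ⟨q, hq⟩ := han
  have h := hq.isBigO_sub_partialSum_pow 2
  obtain ⟨M, hM⟩ := h.bound
  refine ⟨M, ?_⟩
  filter_upwards [hM] with c hc
  rw [hq.deriv]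
  have : q.partialSum 2 c = g 0 + c • q 1 (fun _ => 1) := by
    rw [FormalMultilinearSeries.partialSum, Finset.sum_range_succ, Finset.sum_range_one,
      ← hq.coeff_zero (fun _ => c)]
    congr 1
    simp
  rw [this, zero_add, ← sub_sub] at hc
  simpa using hc

/-- Bounds on the coefficients that are uniform for `|c| < r`. -/
structure CoefBounds (r M k : ℝ) : Prop where
  pos_M : 0 < M
  pos_k : 0 < k
  k_le : k ≤ 1
  adm : ∀ c, ‖c‖ < r → c ∈ R.adm
  norm_z : ∀ c, ‖c‖ < r → ‖R.cz c‖ ≤ M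
  norm_A : ∀ c, ‖c‖ < r → ‖R.cA c‖ ≤ M
  norm_a : ∀ c, ‖c‖ < r → ‖R.ca c‖ ≤ M
  norm_p : ∀ c, ‖c‖ < r → ‖R.cp c‖ ≤ M
  norm_t : ∀ c, ‖c‖ < r → ‖R.ct c‖ ≤ M
  norm_r₁ : ∀ c, ‖c‖ < r → ‖R.cr₁ c‖ ≤ M
  norm_r₂ : ∀ c, ‖c‖ < r → ‖R.cr₂ c‖ ≤ M
  norm_b : ∀ c, ‖c‖ < r → ‖R.cb c‖ ≤ M
  norm_τ : ‖R.bτ‖ ≤ M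
  norm_θ : ‖R.bθ‖ ≤ M
  norm_κ : ‖R.bκ‖ ≤ M
  re_a : ∀ c, ‖c‖ < r → ∀ Y, k ≤ (R.ca c Y).re
  re_p : ∀ c, ‖c‖ < r → ∀ Y, k ≤ (R.cp c Y).re
  im_zp : ∀ c, ‖c‖ < r → 0 ≤ c.im → ∀ Y, k * c.im - M * ‖c‖ ^ 2 ≤ -(R.cz c Y * R.cp c Y).im
  im_a : ∀ c, ‖c‖ < r → 0 ≤ c.im → ∀ Y, -(M * ‖c‖ * c.im) ≤ -(R.ca c Y).im

/-- The norm and real-part bounds persist near c = 0 by continuity. For `im_zp`, the function (U -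
c)p is real at c = 0 and its c-derivative is real and at most -k, so only the quadratic Taylor
remainder is lost. For `im_a`, one has -Im A⁻¹ = |A⁻¹|² Im A with Im A = 2m²(U - Re c) Im c, and U ≥
0. -/
theorem exists_coefBounds (hm₀ : 0 < m) (hm : m ^ 2 < 1 / 3) :
    ∃ r M k : ℝ, 0 < r ∧ R.CoefBounds r M k := by
  have h0 := R.zero_mem_adm hm
  have hev : ∀ᶠ c in 𝓝 (0 : ℂ), c ∈ R.adm := R.isOpen_adm.mem_nhds h0
  have bd : ∀ h : ℂ → (ℝ →ᵇ ℂ), DifferentiableAt ℂ h 0 → ∀ᶠ c in 𝓝 0, ‖h c‖ ≤ ‖h 0‖ + 1 :=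
    fun h hh => (hh.continuousAt.norm.eventually_lt_const (by linarith)).mono fun _ h => h.le
  have hx : ∀ Y, R.U Y ^ 2 ≤ 1 := fun Y => by nlinarith [R.U_nonneg Y, R.U_le Y]
  have hA0 : ∀ Y, 2 / 3 ≤ 1 - m ^ 2 * R.U Y ^ 2 ∧ 1 - m ^ 2 * R.U Y ^ 2 ≤ 1 := fun Y => by
    constructor <;> nlinarith [hx Y, sq_nonneg m, sq_nonneg (R.U Y), mul_nonneg (sq_nonneg m) (sq_nonneg (R.U Y))]
  have hE0 : ∀ Y, 0 < 1 - m ^ 2 * R.U Y ^ 2 - 2 * m ^ 2 * R.U Y * R.τ Y ^ 2 ∧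
      1 - m ^ 2 * R.U Y ^ 2 - 2 * m ^ 2 * R.U Y * R.τ Y ^ 2 ≤ 1 := fun Y => by
    refine ⟨R.σ_pos.trans_le (R.subsonic Y), ?_⟩
    have : 0 ≤ 2 * m ^ 2 * R.U Y * R.τ Y ^ 2 := by
      have := R.U_nonneg Y
      positivity
    linarith [(hA0 Y).2]
  have eA0 : ∀ Y, R.cA 0 Y = ((1 - m ^ 2 * R.U Y ^ 2 : ℝ) : ℂ) := fun Y => by
    rw [cA_apply]; push_cast; ring
  have eE0 : ∀ Y, R.cE 0 Y = ((1 - m ^ 2 * R.U Y ^ 2 - 2 * m ^ 2 * R.U Y * R.τ Y ^ 2 : ℝ) : ℂ) :=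
    fun Y => by rw [cE_apply]; push_cast; ring
  have hrea : ∀ᶠ c in 𝓝 (0 : ℂ), ∀ Y, 1 / 2 ≤ (R.ca c Y).re := by
    have : ∀ᶠ c in 𝓝 (0 : ℂ), ‖R.ca c - R.ca 0‖ < 1 / 2 := by
      have := ((differentiableAt_ca h0).continuousAt.sub (g := fun _ => R.ca 0) continuousAt_const).norm
      exact this.eventually_lt_const (by simp)
    filter_upwards [this] with c hc Y
    have h1 : |((R.ca c - R.ca 0) Y).re| ≤ 1 / 2 :=
      (Complex.abs_re_le_norm _).trans (((R.ca c - R.ca 0).norm_coe_le_norm Y).trans hc.le)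
    have h2 : 1 ≤ (R.ca 0 Y).re := by
      rw [R.ca_apply h0, eA0, ← Complex.ofReal_inv, Complex.ofReal_re]
      exact (one_le_inv₀ (by linarith [(hA0 Y).1])).2 (hA0 Y).2
    rw [BoundedContinuousFunction.sub_apply, Complex.sub_re] at h1
    linarith [(abs_le.1 h1).1]
  have hrep : ∀ᶠ c in 𝓝 (0 : ℂ), ∀ Y, 2 / 9 ≤ (R.cp c Y).re := by
    have : ∀ᶠ c in 𝓝 (0 : ℂ), ‖R.cp c - R.cp 0‖ < 2 / 9 := by
      have := ((differentiableAt_cp h0).continuousAt.sub (g := fun _ => R.cp 0) continuousAt_const).norm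
      exact this.eventually_lt_const (by simp)
    filter_upwards [this] with c hc Y
    have h1 : |((R.cp c - R.cp 0) Y).re| ≤ 2 / 9 :=
      (Complex.abs_re_le_norm _).trans (((R.cp c - R.cp 0).norm_coe_le_norm Y).trans hc.le)
    have h2 : 4 / 9 ≤ (R.cp 0 Y).re := by
      have : R.cp 0 Y = ((((1 - m ^ 2 * R.U Y ^ 2) ^ 2) *
          (1 - m ^ 2 * R.U Y ^ 2 - 2 * m ^ 2 * R.U Y * R.τ Y ^ 2)⁻¹ : ℝ) : ℂ) := by
        rw [cp, BoundedContinuousFunction.coe_mul, Pi.mul_apply, R.ce_apply h0, eE0,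
          BoundedContinuousFunction.coe_pow, Pi.pow_apply, eA0]
        push_cast; rfl
      rw [this, Complex.ofReal_re]
      have h3 := (one_le_inv₀ (hE0 Y).1).2 (hE0 Y).2
      have h4 : 4 / 9 ≤ (1 - m ^ 2 * R.U Y ^ 2) ^ 2 := by nlinarith [(hA0 Y).1]
      nlinarith
    rw [BoundedContinuousFunction.sub_apply, Complex.sub_re] at h1
    linarith [(abs_le.1 h1).1]
  obtain ⟨M₀, hM₀⟩ := exists_norm_sub_sub_smul_le (g := fun c => R.cz c * R.cp c)
    (hev.mono fun c hc => (R.differentiable_cz c).mul (differentiableAt_cp hc))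
  have hdiff : DifferentiableAt ℂ (fun c => R.cz c * R.cp c) 0 :=
    (R.differentiable_cz 0).mul (differentiableAt_cp h0)
  have hder : ∀ Y, deriv (fun c => R.cz c * R.cp c) 0 Y =
      ((-((1 - m ^ 2 * R.U Y ^ 2) * ((1 - m ^ 2 * R.U Y ^ 2) * (1 - 3 * (m ^ 2 * R.U Y ^ 2))
        + 8 * m ^ 2 * R.U Y * R.τ Y ^ 2 * (m ^ 2 * R.U Y ^ 2)) /
          (1 - m ^ 2 * R.U Y ^ 2 - 2 * m ^ 2 * R.U Y * R.τ Y ^ 2) ^ 2) : ℝ) : ℂ) := fun Y => by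
    have h1 := ((BoundedContinuousFunction.evalCLM ℂ Y).hasFDerivAt
      (x := R.cz 0 * R.cp 0)).comp_hasDerivAt (0 : ℂ) hdiff.hasDerivAt
    have h2 := hasDerivAt_multiplier (m := m) (x := R.U Y) (ρ := R.τ Y ^ 2) (hE0 Y).1.ne'
    refine h1.unique (h2.congr_of_eventuallyEq ?_)
    filter_upwards [hev] with c hc
    show (R.cz c * R.cp c) Y = _
    rw [BoundedContinuousFunction.coe_mul, Pi.mul_apply, cp, BoundedContinuousFunction.coe_mul,
      Pi.mul_apply, R.ce_apply hc, BoundedContinuousFunction.coe_pow, Pi.pow_apply, cA_apply,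
      cE_apply, cz_apply, div_eq_mul_inv]
    push_cast
    ring
  -- 2/9 is half of the lower bound 4/9 of p at c = 0. The second entry bounds the modulus of the
  -- derivative of (U - c)p from below, by A ≥ 2/3 and E ≤ 1.
  set k : ℝ := min (2 / 9) (4 / 9 * (1 - 3 * m ^ 2)) with hk
  have hk0 : 0 < k := lt_min (by norm_num) (by nlinarith)
  have hder' : ∀ Y, (deriv (fun c => R.cz c * R.cp c) 0 Y).re ≤ -k ∧
      (deriv (fun c => R.cz c * R.cp c) 0 Y).im = 0 := fun Y => by
    rw [hder]
    refine ⟨?_, Complex.ofReal_im _⟩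
    rw [Complex.ofReal_re]
    apply neg_le_neg
    refine (min_le_right _ _).trans ?_
    rw [le_div_iff₀ (by have := (hE0 Y).1; positivity)]
    have e1 : (1 - m ^ 2 * R.U Y ^ 2 - 2 * m ^ 2 * R.U Y * R.τ Y ^ 2) ^ 2 ≤ 1 := by
      nlinarith [hE0 Y]
    have e2 : 1 - 3 * m ^ 2 ≤ 1 - 3 * (m ^ 2 * R.U Y ^ 2) := by nlinarith [hx Y, sq_nonneg m]
    have e3 : 0 ≤ 8 * m ^ 2 * R.U Y * R.τ Y ^ 2 * (m ^ 2 * R.U Y ^ 2) := by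
      have := R.U_nonneg Y
      positivity
    have e4 := (hA0 Y).1
    have e5 : 0 ≤ 1 - 3 * m ^ 2 := by linarith
    calc 4 / 9 * (1 - 3 * m ^ 2) * (1 - m ^ 2 * R.U Y ^ 2 - 2 * m ^ 2 * R.U Y * R.τ Y ^ 2) ^ 2
        ≤ 4 / 9 * (1 - 3 * m ^ 2) * 1 := by gcongr
      _ = 2 / 3 * (2 / 3 * (1 - 3 * m ^ 2)) := by ring
      _ ≤ (1 - m ^ 2 * R.U Y ^ 2) * ((1 - m ^ 2 * R.U Y ^ 2) * (1 - 3 * (m ^ 2 * R.U Y ^ 2))) := by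
          gcongr
      _ ≤ _ := by
          gcongr
          linarith
  have hzp0 : ∀ Y, (R.cz 0 Y * R.cp 0 Y).im = 0 := fun Y => by
    rw [cp, BoundedContinuousFunction.coe_mul, Pi.mul_apply, R.ce_apply h0, eE0,
      BoundedContinuousFunction.coe_pow, Pi.pow_apply, eA0, cz_apply, sub_zero]
    rw [← Complex.ofReal_inv, ← Complex.ofReal_pow, ← Complex.ofReal_mul, ← Complex.ofReal_mul,
      Complex.ofReal_im]
  have hall := hev.and <| hrea.and <| hrep.and <| hM₀.and <|
    (bd _ (R.differentiable_cz 0)).and <| (bd _ (R.differentiable_cA 0)).and <|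
    (bd _ (differentiableAt_ca h0)).and <| (bd _ (differentiableAt_cp h0)).and <|
    (bd _ (differentiableAt_ct h0)).and <| (bd _ (differentiableAt_cr₁ h0)).and <|
    (bd _ (differentiableAt_cr₂ h0)).and (bd _ (differentiableAt_cb h0))
  obtain ⟨r, hr, hball⟩ := Metric.eventually_nhds_iff.1 hall
  simp only [dist_zero_right] at hball
  set Ma := ‖R.ca 0‖ + 1 with hMa
  set M : ℝ := |M₀| + (‖R.cz 0‖ + 1) + (‖R.cA 0‖ + 1) + Ma + (‖R.cp 0‖ + 1)
    + (‖R.ct 0‖ + 1) + (‖R.cr₁ 0‖ + 1) + (‖R.cr₂ 0‖ + 1) + (‖R.cb 0‖ + 1) + ‖R.bτ‖ + ‖R.bθ‖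
    + ‖R.bκ‖ + 2 * m ^ 2 * Ma ^ 2 with hM
  have n1 := norm_nonneg (R.cz 0)
  have n2 := norm_nonneg (R.cA 0)
  have n3 := norm_nonneg (R.ca 0)
  have n4 := norm_nonneg (R.cp 0)
  have n5 := norm_nonneg (R.ct 0)
  have n6 := norm_nonneg (R.cr₁ 0)
  have n7 := norm_nonneg (R.cr₂ 0)
  have n8 := norm_nonneg (R.cb 0)
  have n9 := norm_nonneg R.bτ
  have n10 := norm_nonneg R.bθ
  have n11 := norm_nonneg R.bκ
  have n12 : 0 ≤ 2 * m ^ 2 * Ma ^ 2 := by positivity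
  have n13 := abs_nonneg M₀
  refine ⟨r, M, k, hr, ?_⟩
  exact
  { pos_M := by linarith
    pos_k := hk0
    k_le := (min_le_left _ _).trans (by norm_num)
    adm := fun c hc => (hball hc).1
    norm_z := fun c hc => (hball hc).2.2.2.2.1.trans (by linarith)
    norm_A := fun c hc => (hball hc).2.2.2.2.2.1.trans (by linarith)
    norm_a := fun c hc => (hball hc).2.2.2.2.2.2.1.trans (by linarith)
    norm_p := fun c hc => (hball hc).2.2.2.2.2.2.2.1.trans (by linarith)
    norm_t := fun c hc => (hball hc).2.2.2.2.2.2.2.2.1.trans (by linarith)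
    norm_r₁ := fun c hc => (hball hc).2.2.2.2.2.2.2.2.2.1.trans (by linarith)
    norm_r₂ := fun c hc => (hball hc).2.2.2.2.2.2.2.2.2.2.1.trans (by linarith)
    norm_b := fun c hc => (hball hc).2.2.2.2.2.2.2.2.2.2.2.trans (by linarith)
    norm_τ := by linarith
    norm_θ := by linarith
    norm_κ := by linarith
    re_a := fun c hc Y => le_trans ((min_le_left _ _).trans (by norm_num)) ((hball hc).2.1 Y)
    re_p := fun c hc Y => le_trans (min_le_left _ _) ((hball hc).2.2.1 Y)
    im_zp := fun c hc hci Y => by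
      have h1 := (hball hc).2.2.2.1
      set D := deriv (fun c => R.cz c * R.cp c) 0 with hD
      have h2 : |((R.cz c * R.cp c - R.cz 0 * R.cp 0 - c • D) Y).im| ≤ M * ‖c‖ ^ 2 := by
        refine (Complex.abs_im_le_norm _).trans ((BoundedContinuousFunction.norm_coe_le_norm _ Y).trans
          (h1.trans ?_))
        have : M₀ ≤ M := by linarith [le_abs_self M₀]
        gcongr
      simp only [BoundedContinuousFunction.coe_sub, BoundedContinuousFunction.coe_mul, Pi.sub_apply,
        Pi.mul_apply, BoundedContinuousFunction.coe_smul, smul_eq_mul,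
        Complex.sub_im, hzp0 Y, Complex.mul_im c (D Y), (hder' Y).2, mul_zero, zero_add, sub_zero] at h2
      have h3 := (hder' Y).1
      have h4 := (abs_le.1 h2).2
      nlinarith
    im_a := fun c hc hci Y => by
      have hadm := (hball hc).1
      have hna : ‖R.ca c Y‖ ≤ Ma :=
        ((R.ca c).norm_coe_le_norm Y).trans (hball hc).2.2.2.2.2.2.1
      have e1 : -(R.ca c Y).im = (R.cA c Y).im * ‖R.ca c Y‖ ^ 2 := by
        rw [R.ca_apply hadm, Complex.inv_im, norm_inv, inv_pow, ← Complex.normSq_eq_norm_sq]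
        ring
      have e2 : (R.cA c Y).im = 2 * m ^ 2 * (R.U Y - c.re) * c.im := by
        rw [cA_apply]
        simp [pow_two, Complex.mul_re, Complex.mul_im]
        ring
      rw [e1, e2]
      have h1 := R.U_nonneg Y
      have h2 : -‖c‖ ≤ R.U Y - c.re := by
        have := (abs_le.1 (Complex.abs_re_le_norm c)).2
        linarith
      have h3 : -(2 * m ^ 2 * ‖c‖ * c.im) ≤ 2 * m ^ 2 * (R.U Y - c.re) * c.im := by
        have : 2 * m ^ 2 * c.im * (-‖c‖) ≤ 2 * m ^ 2 * c.im * (R.U Y - c.re) := by gcongr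
        linarith
      calc -(M * ‖c‖ * c.im) ≤ -(2 * m ^ 2 * Ma ^ 2 * ‖c‖ * c.im) := by
            have : 2 * m ^ 2 * Ma ^ 2 ≤ M := by linarith
            gcongr
        _ ≤ -(2 * m ^ 2 * ‖R.ca c Y‖ ^ 2 * ‖c‖ * c.im) := by gcongr
        _ = -(2 * m ^ 2 * ‖c‖ * c.im) * ‖R.ca c Y‖ ^ 2 := by ring
        _ ≤ _ := by gcongr }

end ReducedProfile

namespace ReducedProfile

variable {m : ℝ} (R : ReducedProfile m)

/-! ### The operators -/

/-- The form operator of `-Λ` on `H¹₀`. -/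
def opΛ (α : ℝ) (c : ℂ) : H10 →L[ℂ] H10 :=
  (adjoint derL).comp ((mulL (R.ca c)).comp derL) + (adjoint valL).comp (((α : ℂ) ^ 2) • valL)

/-- The inverse of `Λ` with Dirichlet condition, applied to `θ f`. -/
def opΨ (α : ℝ) (c : ℂ) : H10 →L[ℂ] H10 :=
  -((Ring.inverse (R.opΛ α c)).comp ((adjoint valL).comp ((mulL R.bθ).comp valL)))

/-- The second derivative of the stream function. -/
def opΨ₂ (α : ℝ) (c : ℂ) : H10 →L[ℂ] L2 :=
  (mulL (R.cb c)).comp (derL.comp (R.opΨ α c))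
    + (mulL (R.cA c)).comp (((α : ℂ) ^ 2) • valL.comp (R.opΨ α c) + (mulL R.bθ).comp valL)

/-- The flux `θ⁻¹ (A⁻¹ ∂_Y³ Ψ - α² ∂_Y Ψ)`. -/
def opJ (α : ℝ) (c : ℂ) : H10 →L[ℂ] L2 :=
  derL + ((mulL R.bκ).comp valL - (mulL (R.cr₂ c)).comp (R.opΨ₂ α c)
    - (mulL (R.cr₁ c)).comp (derL.comp (R.opΨ α c)))

/-- The operator of the weighted weak formulation of the Orr-Sommerfeld equation. -/
def opL (α n : ℝ) (c : ℂ) : H10 →L[ℂ] H10 :=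
  (adjoint derL).comp ((-(Complex.I / n)) • (mulL (R.cp c)).comp (R.opJ α c))
    + (adjoint valL).comp ((-(Complex.I / n)) • (mulL (R.ct c)).comp (R.opJ α c)
      + (mulL (R.cz c * R.cp c)).comp valL
      + (-(Complex.I * (α : ℂ) ^ 2 / n)) • (mulL (R.cp c)).comp valL
      + (mulL R.bθ).comp (valL.comp (R.opΨ α c)))

/-- The solution operator of the weighted weak formulation. -/
def sol (α n : ℝ) (c : ℂ) : L2 →L[ℂ] H10 :=
  (Ring.inverse (R.opL α n c)).comp ((adjoint valL).comp (mulL (R.cp c)))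

theorem inner_self_L2 (f : L2) : ⟪f, f⟫_ℂ = ((‖f‖ ^ 2 : ℝ) : ℂ) := by
  rw [inner_self_eq_norm_sq_to_K]
  norm_cast

/-- Lax–Milgram. Only the modulus of the form has to be bounded below, so the real part may serve
for Λ and the imaginary part for the Orr–Sommerfeld operator. -/
theorem isUnit_of_coercive {T : H10 →L[ℂ] H10} {δ : ℝ} (hδ : 0 < δ)
    (h : ∀ F, δ * ‖F‖ ^ 2 ≤ ‖⟪F, T F⟫_ℂ‖) : IsUnit T := by
  apply ContinuousLinearMap.isUnit_of_forall_le_norm_inner_map (𝕜 := ℂ) T (c := ⟨δ, hδ.le⟩) hδ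
  intro F
  rw [norm_inner_symm, mul_comm]
  exact h F

theorem inverse_apply {T : H10 →L[ℂ] H10} (h : IsUnit T) (F : H10) : T (Ring.inverse T F) = F := by
  have := congrArg (fun S : H10 →L[ℂ] H10 => S F) (Ring.mul_inverse_cancel T h)
  exact this

/-- The constant of a Hardy inequality with weight `θ`. -/
def IsHardy (H : ℝ) : Prop := 0 < H ∧ ∀ F : H10, ‖mulL R.bθ (valL F)‖ ≤ H * ‖derL F‖

/-- The exponential decay of θ and sY ≤ exp(sY) give θ²Y ≤ (K²/s) exp(-sY), an integrable majorant
for `h10_hardy`. -/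
theorem exists_isHardy : ∃ H, R.IsHardy H := by
  set w : ℝ → ℝ := fun Y => R.K ^ 2 / R.s * Real.exp (-R.s * Y) with hw
  have hwi : IntegrableOn w (Ioi 0) := by
    have := (exp_neg_integrableOn_Ioi 0 R.s_pos).const_mul (R.K ^ 2 / R.s)
    exact this
  refine ⟨√(∫ Y in Ioi 0, w Y) + 1, by positivity, fun F => ?_⟩
  have h := h10_hardy (k := R.bθ) hwi (fun Y hY => ?_) F
  · have h2 := Real.abs_le_sqrt h
    rw [abs_of_nonneg (norm_nonneg _), Real.sqrt_mul' _ (sq_nonneg _),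
      Real.sqrt_sq (norm_nonneg _)] at h2
    refine h2.trans ?_
    gcongr
    linarith
  · have h1 := R.θ_decay Y hY
    have h2 := R.θ_pos Y
    have h3 := R.s_pos
    rw [bθ_apply, Complex.norm_real, Real.norm_eq_abs, sq_abs]
    have h4 : R.θ Y ^ 2 ≤ (R.K * Real.exp (-R.s * Y)) ^ 2 := by gcongr
    have h5 : R.s * Y ≤ Real.exp (R.s * Y) := by linarith [Real.add_one_le_exp (R.s * Y)]
    have h6 : Real.exp (-R.s * Y) * Real.exp (R.s * Y) = 1 := by
      rw [← Real.exp_add]; simp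
    have h7 := Real.exp_pos (-R.s * Y)
    calc R.θ Y ^ 2 * Y ≤ (R.K * Real.exp (-R.s * Y)) ^ 2 * Y := by gcongr
      _ = R.K ^ 2 / R.s * Real.exp (-R.s * Y) * (Real.exp (-R.s * Y) * (R.s * Y)) := by
          field_simp
      _ ≤ R.K ^ 2 / R.s * Real.exp (-R.s * Y) * (Real.exp (-R.s * Y) * Real.exp (R.s * Y)) := by
          gcongr
      _ = w Y := by rw [h6, mul_one]

/-! ### Coercivity and invertibility of the two operators -/

variable {R} {r M k H : ℝ} {α n : ℝ} {c : ℂ}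

theorem inner_opΛ (F G : H10) : ⟪G, R.opΛ α c F⟫_ℂ =
    ⟪derL G, mulL (R.ca c) (derL F)⟫_ℂ + (α : ℂ) ^ 2 * ⟪valL G, valL F⟫_ℂ := by
  simp only [opΛ, add_apply, ContinuousLinearMap.comp_apply, inner_add_right,
    adjoint_inner_right, smul_apply, inner_smul_right]

theorem opΛ_coercive (hB : R.CoefBounds r M k) (hc : ‖c‖ < r) (F : H10) :
    k * ‖derL F‖ ^ 2 + α ^ 2 * ‖valL F‖ ^ 2 ≤ (⟪F, R.opΛ α c F⟫_ℂ).re := by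
  rw [inner_opΛ, Complex.add_re]
  have h1 := re_inner_mulL_ge (φ := R.ca c) (fun Y _ => hB.re_a c hc Y) (derL F)
  have h2 : ((α : ℂ) ^ 2 * ⟪valL F, valL F⟫_ℂ).re = α ^ 2 * ‖valL F‖ ^ 2 := by
    rw [inner_self_L2, ← Complex.ofReal_pow, ← Complex.ofReal_mul, Complex.ofReal_re]
  rw [h2]
  linarith

/-- The coercivity constant degenerates as α tends to 0, but only invertibility is taken from here.
The quantitative bounds come from `opΨ_energy`. -/
theorem isUnit_opΛ (hB : R.CoefBounds r M k) (hα : 0 < α) (hc : ‖c‖ < r) : IsUnit (R.opΛ α c) := by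
  apply isUnit_of_coercive (δ := min k (α ^ 2)) (lt_min hB.pos_k (by positivity))
  intro F
  refine le_trans ?_ ((opΛ_coercive hB hc F).trans ((le_abs_self _).trans (Complex.abs_re_le_norm _)))
  rw [h10_norm_sq, mul_add, add_comm]
  gcongr
  · exact min_le_left _ _
  · exact min_le_right _ _

theorem inner_opΨ (h : IsUnit (R.opΛ α c)) (F G : H10) :
    ⟪derL G, mulL (R.ca c) (derL (R.opΨ α c F))⟫_ℂ + (α : ℂ) ^ 2 * ⟪valL G, valL (R.opΨ α c F)⟫_ℂ
      = -⟪valL G, mulL R.bθ (valL F)⟫_ℂ := by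
  rw [← inner_opΛ]
  simp only [opΨ, neg_apply, ContinuousLinearMap.comp_apply, map_neg,
    inverse_apply h, inner_neg_right, adjoint_inner_right]

theorem conj_bθ (Y : ℝ) : conj (R.bθ Y) = R.bθ Y := Complex.conj_ofReal _

theorem norm_inner_bθ_le (hH : R.IsHardy H) (F : H10) (g : L2) :
    ‖⟪valL F, mulL R.bθ g⟫_ℂ‖ ≤ H * ‖derL F‖ * ‖g‖ := by
  rw [inner_mulL_comm conj_bθ]
  refine (norm_inner_le_norm _ _).trans ?_
  gcongr
  exact hH.2 F

/-- The equation for Ψ is tested with Ψ. In the source term the weight θ is moved onto Ψ, where the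
Hardy inequality bounds it by ‖∂_YΨ‖, so that no negative power of α appears. -/
theorem opΨ_energy (hB : R.CoefBounds r M k) (hH : R.IsHardy H) (hα : 0 < α) (hc : ‖c‖ < r)
    (F : H10) : k * ‖derL (R.opΨ α c F)‖ ^ 2 + α ^ 2 * ‖valL (R.opΨ α c F)‖ ^ 2
      ≤ H * ‖derL (R.opΨ α c F)‖ * ‖valL F‖ := by
  refine (opΛ_coercive (α := α) hB hc (R.opΨ α c F)).trans ((le_abs_self _).trans
    ((Complex.abs_re_le_norm _).trans ?_))
  rw [inner_opΛ, inner_opΨ (isUnit_opΛ hB hα hc), norm_neg]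
  exact norm_inner_bθ_le hH _ _

theorem norm_der_opΨ_le (hB : R.CoefBounds r M k) (hH : R.IsHardy H) (hα : 0 < α) (hc : ‖c‖ < r)
    (F : H10) : ‖derL (R.opΨ α c F)‖ ≤ H / k * ‖valL F‖ := by
  have h := opΨ_energy hB hH hα hc F
  have hk := hB.pos_k
  have h1 : 0 ≤ α ^ 2 * ‖valL (R.opΨ α c F)‖ ^ 2 := by positivity
  rw [div_mul_eq_mul_div, le_div_iff₀ hk]
  rcases (norm_nonneg (derL (R.opΨ α c F))).eq_or_lt with h0 | h0
  · rw [← h0, zero_mul]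
    have := hH.1
    positivity
  · have : ‖derL (R.opΨ α c F)‖ * (‖derL (R.opΨ α c F)‖ * k)
        ≤ ‖derL (R.opΨ α c F)‖ * (H * ‖valL F‖) := by nlinarith
    exact le_of_mul_le_mul_left this h0

theorem norm_val_opΨ_le (hB : R.CoefBounds r M k) (hH : R.IsHardy H) (hα : 0 < α) (hc : ‖c‖ < r)
    (F : H10) : α * ‖valL (R.opΨ α c F)‖ ≤ H / k * ‖valL F‖ := by
  have h := opΨ_energy hB hH hα hc F
  have h' := norm_der_opΨ_le hB hH hα hc F
  have hk := hB.pos_k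
  have hH0 := hH.1
  have hk1 := hB.k_le
  refine abs_le_of_sq_le_sq' ?_ (by positivity) |>.2
  have e1 : H ≤ H / k := by rw [le_div_iff₀ hk]; nlinarith
  calc (α * ‖valL (R.opΨ α c F)‖) ^ 2 = α ^ 2 * ‖valL (R.opΨ α c F)‖ ^ 2 := by ring
    _ ≤ H * ‖derL (R.opΨ α c F)‖ * ‖valL F‖ := by nlinarith [sq_nonneg ‖derL (R.opΨ α c F)‖]
    _ ≤ H / k * (H / k * ‖valL F‖) * ‖valL F‖ := by gcongr
    _ = (H / k * ‖valL F‖) ^ 2 := by ring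

/-- The constant in the bound of the second derivative. -/
def const₂ (M k H : ℝ) : ℝ := M * (H / k) + M * (H / k + M)

theorem norm_opΨ₂_le (hB : R.CoefBounds r M k) (hH : R.IsHardy H) (hα : 0 < α) (hα1 : α < 1)
    (hc : ‖c‖ < r) (F : H10) : ‖R.opΨ₂ α c F‖ ≤ const₂ M k H * ‖valL F‖ := by
  have h1 := norm_der_opΨ_le hB hH hα hc F
  have h2 := norm_val_opΨ_le hB hH hα hc F
  have hM := hB.pos_M
  simp only [opΨ₂, add_apply, ContinuousLinearMap.comp_apply,
    smul_apply]
  have e1 : ‖((α : ℂ) ^ 2) • valL (R.opΨ α c F)‖ ≤ H / k * ‖valL F‖ := by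
    rw [norm_smul, norm_pow, Complex.norm_real, Real.norm_eq_abs, abs_of_pos hα]
    refine le_trans ?_ h2
    have := norm_nonneg (valL (R.opΨ α c F))
    gcongr
    nlinarith
  have e2 : ‖mulL R.bθ (valL F)‖ ≤ M * ‖valL F‖ := (norm_mulL_le _ _).trans (by
    gcongr; exact hB.norm_θ)
  calc _ ≤ ‖R.cb c‖ * ‖derL (R.opΨ α c F)‖
        + ‖R.cA c‖ * (‖((α : ℂ) ^ 2) • valL (R.opΨ α c F)‖ + ‖mulL R.bθ (valL F)‖) := by
        refine (norm_add_le _ _).trans (add_le_add (norm_mulL_le _ _)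
          ((norm_mulL_le _ _).trans ?_))
        gcongr
        exact norm_add_le _ _
    _ ≤ M * (H / k * ‖valL F‖) + M * (H / k * ‖valL F‖ + M * ‖valL F‖) := by
        gcongr
        · exact hB.norm_b c hc
        · exact hB.norm_A c hc
    _ = _ := by rw [const₂]; ring

/-- The constant in the bound of the lower order part of the flux. -/
def const₃ (M k H : ℝ) : ℝ := M + M * const₂ M k H + M * (H / k)

/-- The formula for J comes from differentiating Λ(Ψ) = θf and solving for A⁻¹∂_Y³Ψ - α²∂_YΨ. The
derivatives of A⁻¹ in the correction terms contain a factor U' or U'', hence θ, so division by θ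
leaves bounded coefficients. -/
theorem norm_opJ_sub_le (hB : R.CoefBounds r M k) (hH : R.IsHardy H) (hα : 0 < α) (hα1 : α < 1)
    (hc : ‖c‖ < r) (F : H10) : ‖R.opJ α c F - derL F‖ ≤ const₃ M k H * ‖valL F‖ := by
  have h1 := norm_der_opΨ_le hB hH hα hc F
  have h2 := norm_opΨ₂_le hB hH hα hα1 hc F
  have hM := hB.pos_M
  simp only [opJ, add_apply, ContinuousLinearMap.comp_apply,
    sub_apply, add_sub_cancel_left]
  calc _ ≤ ‖R.bκ‖ * ‖valL F‖ + ‖R.cr₂ c‖ * ‖R.opΨ₂ α c F‖ + ‖R.cr₁ c‖ * ‖derL (R.opΨ α c F)‖ := by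
        refine (norm_sub_le _ _).trans (add_le_add ((norm_sub_le _ _).trans (add_le_add ?_ ?_)) ?_)
        all_goals exact norm_mulL_le _ _
    _ ≤ M * ‖valL F‖ + M * (const₂ M k H * ‖valL F‖) + M * (H / k * ‖valL F‖) := by
        gcongr
        · exact hB.norm_κ
        · exact hB.norm_r₂ c hc
        · exact hB.norm_r₁ c hc
    _ = _ := by rw [const₃]; ring

/-- The constant that governs how small the spectral parameter has to be. -/
def const₄ (M k H : ℝ) : ℝ :=
  M + M * (H / k) ^ 2 + M * const₃ M k H + M ^ 2 * (const₃ M k H + 1) ^ 2 / (2 * k)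

theorem inner_opL (F : H10) : ⟪F, R.opL α n c F⟫_ℂ =
    -(Complex.I / n) * ⟪derL F, mulL (R.cp c) (R.opJ α c F)⟫_ℂ
    + (-(Complex.I / n) * ⟪valL F, mulL (R.ct c) (R.opJ α c F)⟫_ℂ
      + ⟪valL F, mulL (R.cz c * R.cp c) (valL F)⟫_ℂ
      + -(Complex.I * (α : ℂ) ^ 2 / n) * ⟪valL F, mulL (R.cp c) (valL F)⟫_ℂ
      + ⟪valL F, mulL R.bθ (valL (R.opΨ α c F))⟫_ℂ) := by
  simp only [opL, add_apply, ContinuousLinearMap.comp_apply, inner_add_right,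
    adjoint_inner_right, smul_apply, inner_smul_right]

theorem im_inner_mulL_ge {φ : ℝ →ᵇ ℂ} {k : ℝ} (hφ : ∀ Y, 0 < Y → k ≤ -(φ Y).im) (f : L2) :
    k * ‖f‖ ^ 2 ≤ -(⟪f, mulL φ f⟫_ℂ).im := by
  have h := re_inner_mulL_ge (φ := Complex.I • φ) (k := k) (fun Y hY => by
    simpa using hφ Y hY) f
  rw [map_smul, smul_apply, inner_smul_right] at h
  simpa using h

theorem re_inner_p_opJ_ge (hB : R.CoefBounds r M k) (hH : R.IsHardy H) (hα : 0 < α) (hα1 : α < 1)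
    (hc : ‖c‖ < r) (F : H10) :
    k * ‖derL F‖ ^ 2 - M * const₃ M k H * ‖derL F‖ * ‖valL F‖
      ≤ (⟪derL F, mulL (R.cp c) (R.opJ α c F)⟫_ℂ).re := by
  have hJ := norm_opJ_sub_le hB hH hα hα1 hc F
  obtain ⟨g, hg⟩ : ∃ g, R.opJ α c F = derL F + g := ⟨R.opJ α c F - derL F, by abel⟩
  rw [hg, add_sub_cancel_left] at hJ
  rw [hg, map_add, inner_add_right, Complex.add_re]
  have hM := hB.pos_M
  have h1 := re_inner_mulL_ge (φ := R.cp c) (fun Y _ => hB.re_p c hc Y) (derL F)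
  have h2 : |(⟪derL F, mulL (R.cp c) g⟫_ℂ).re| ≤ ‖derL F‖ * (M * (const₃ M k H * ‖valL F‖)) :=
    (Complex.abs_re_le_norm _).trans ((norm_inner_le_norm _ _).trans (by
      gcongr
      refine (norm_mulL_le _ _).trans ?_
      gcongr
      exact hB.norm_p c hc))
  nlinarith [(abs_le.1 h2).1]

theorem re_inner_t_opJ_ge (hB : R.CoefBounds r M k) (hH : R.IsHardy H) (hα : 0 < α) (hα1 : α < 1)
    (hc : ‖c‖ < r) (F : H10) :
    -(‖valL F‖ * (M * (‖derL F‖ + const₃ M k H * ‖valL F‖)))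
      ≤ (⟪valL F, mulL (R.ct c) (R.opJ α c F)⟫_ℂ).re := by
  have hJ := norm_opJ_sub_le hB hH hα hα1 hc F
  have hM := hB.pos_M
  have hJ' : ‖R.opJ α c F‖ ≤ ‖derL F‖ + const₃ M k H * ‖valL F‖ := by
    have := norm_add_le (derL F) (R.opJ α c F - derL F)
    rw [add_sub_cancel] at this
    linarith
  have h2 : |(⟪valL F, mulL (R.ct c) (R.opJ α c F)⟫_ℂ).re|
      ≤ ‖valL F‖ * (M * (‖derL F‖ + const₃ M k H * ‖valL F‖)) :=
    (Complex.abs_re_le_norm _).trans ((norm_inner_le_norm _ _).trans (by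
      gcongr
      refine (norm_mulL_le _ _).trans ?_
      gcongr
      exact hB.norm_t c hc))
  exact (abs_le.1 h2).1

/-- Since Λ(Ψ) = θF, the nonlocal term is the conjugate of ⟨Ψ, θF⟩, which the equation for Ψ tested
with Ψ turns into the energy of Ψ. The α² part is real and drops out; the rest is governed by the
sign of Im A⁻¹. -/
theorem im_inner_opΨ_ge (hB : R.CoefBounds r M k) (hH : R.IsHardy H) (hα : 0 < α)
    (hc : ‖c‖ < r) (hci : 0 < c.im) (F : H10) :
    -(M * ‖c‖ * c.im * ((H / k) ^ 2 * ‖valL F‖ ^ 2)) ≤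
      -(⟪valL F, mulL R.bθ (valL (R.opΨ α c F))⟫_ℂ).im := by
  have hM := hB.pos_M
  have e1 := inner_opΨ (isUnit_opΛ hB hα hc) F (R.opΨ α c F)
  rw [inner_self_L2, ← Complex.ofReal_pow, ← Complex.ofReal_mul] at e1
  have e2 : -(⟪valL F, mulL R.bθ (valL (R.opΨ α c F))⟫_ℂ).im
      = -(⟪derL (R.opΨ α c F), mulL (R.ca c) (derL (R.opΨ α c F))⟫_ℂ).im := by
    have e := congrArg Complex.im e1
    rw [Complex.add_im, Complex.ofReal_im, Complex.neg_im, add_zero] at e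
    rw [inner_mulL_comm conj_bθ, ← inner_conj_symm, Complex.conj_im, e]
  have e3 := im_inner_mulL_ge (φ := R.ca c) (fun Y _ => hB.im_a c hc hci.le Y)
    (derL (R.opΨ α c F))
  have e4 := norm_der_opΨ_le hB hH hα hc F
  have e5 : ‖derL (R.opΨ α c F)‖ ^ 2 ≤ (H / k) ^ 2 * ‖valL F‖ ^ 2 := by
    rw [← mul_pow]; gcongr
  have e6 : M * ‖c‖ * c.im * ‖derL (R.opΨ α c F)‖ ^ 2
      ≤ M * ‖c‖ * c.im * ((H / k) ^ 2 * ‖valL F‖ ^ 2) := by gcongr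
  rw [e2]
  linarith

theorem im_inner_opL (F : H10) : -(⟪F, R.opL α n c F⟫_ℂ).im =
    1 / n * (⟪derL F, mulL (R.cp c) (R.opJ α c F)⟫_ℂ).re
    + 1 / n * (⟪valL F, mulL (R.ct c) (R.opJ α c F)⟫_ℂ).re
    + -(⟪valL F, mulL (R.cz c * R.cp c) (valL F)⟫_ℂ).im
    + α ^ 2 / n * (⟪valL F, mulL (R.cp c) (valL F)⟫_ℂ).re
    + -(⟪valL F, mulL R.bθ (valL (R.opΨ α c F))⟫_ℂ).im := by
  have e1 : ∀ w : ℂ, (-(Complex.I / n) * w).im = -(1 / n * w.re) := fun w => by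
    have : -(Complex.I / n) * w = ((-(1 / n) : ℝ) : ℂ) * (Complex.I * w) := by push_cast; ring
    rw [this, Complex.im_ofReal_mul, Complex.I_mul_im]; ring
  have e2 : ∀ w : ℂ, (-(Complex.I * (α : ℂ) ^ 2 / n) * w).im = -(α ^ 2 / n * w.re) := fun w => by
    have : -(Complex.I * (α : ℂ) ^ 2 / n) * w = ((-(α ^ 2 / n) : ℝ) : ℂ) * (Complex.I * w) := by
      push_cast; ring
    rw [this, Complex.im_ofReal_mul, Complex.I_mul_im]; ring
  rw [inner_opL]
  simp only [Complex.add_im, e1, e2]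
  ring

/-- Here X = ‖F'‖, Z = ‖F‖, q = |c|, and a, b, d, e, f are the five contributions in `im_inner_opL`.
Young's inequality spends half of kX²/n on the mixed terms. What is left is Z² times 1/n, |c|² or
|c| Im c, each at most γ Im c, and the smallness of γ absorbs it into half of k Im c Z². -/
theorem coercive_arith {M k C h γ n ci q X Z a b d e f : ℝ} (hM : 0 < M) (hk : 0 < k) (hC : 0 ≤ C)
    (hγ : γ * (M + M * h ^ 2 + M * C + M ^ 2 * (C + 1) ^ 2 / (2 * k)) ≤ k / 2) (hn : 0 < n)
    (_hq0 : 0 ≤ q) (hq : q ≤ γ) (hq2 : q ^ 2 ≤ γ * ci) (hci : 0 < ci) (hn2 : 1 / n ≤ γ * ci)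
    (ha : k * X ^ 2 - M * C * X * Z ≤ a)
    (hb : -(Z * (M * (X + C * Z))) ≤ b) (hd : (k * ci - M * q ^ 2) * Z ^ 2 ≤ d) (he : 0 ≤ e)
    (hf : -(M * q * ci * (h ^ 2 * Z ^ 2)) ≤ f) :
    k / 2 * (X ^ 2 / n + ci * Z ^ 2) ≤ 1 / n * a + 1 / n * b + d + e + f := by
  have hn' : 0 < 1 / n := by positivity
  have s1 := mul_le_mul_of_nonneg_left ha hn'.le
  have s2 := mul_le_mul_of_nonneg_left hb hn'.le
  -- The mixed terms of the p and t contributions, with coefficients MC and M, are treated together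
  -- by completing the square.
  have y1 : M * (C + 1) * X * Z ≤ k / 2 * X ^ 2 + M ^ 2 * (C + 1) ^ 2 / (2 * k) * Z ^ 2 := by
    have : 0 ≤ (k * X - M * (C + 1) * Z) ^ 2 / (2 * k) := by positivity
    have e : (k * X - M * (C + 1) * Z) ^ 2 / (2 * k)
      = k / 2 * X ^ 2 - M * (C + 1) * X * Z + M ^ 2 * (C + 1) ^ 2 / (2 * k) * Z ^ 2 := by
      field_simp
      ring
    linarith
  have y2 := mul_le_mul_of_nonneg_left y1 hn'.le
  set D := M ^ 2 * (C + 1) ^ 2 / (2 * k) with hD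
  have hD0 : 0 ≤ D := by positivity
  have y3 : 1 / n * ((M * C + D) * Z ^ 2) ≤ γ * ci * ((M * C + D) * Z ^ 2) := by gcongr
  have y4 : M * q ^ 2 * Z ^ 2 ≤ M * (γ * ci) * Z ^ 2 := by gcongr
  have y5 : M * q * ci * (h ^ 2 * Z ^ 2) ≤ M * γ * ci * (h ^ 2 * Z ^ 2) := by gcongr
  have y6 : γ * (M + M * h ^ 2 + M * C + D) * (ci * Z ^ 2) ≤ k / 2 * (ci * Z ^ 2) := by gcongr
  have y7 : γ * (M + M * h ^ 2 + M * C + D) * (ci * Z ^ 2) = γ * ci * ((M * C + D) * Z ^ 2)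
      + M * (γ * ci) * Z ^ 2 + M * γ * ci * (h ^ 2 * Z ^ 2) := by ring
  have y8 : X ^ 2 / n = 1 / n * X ^ 2 := by ring
  rw [y8]
  linarith

/-- The parameters belong to the range in which the weak formulation is coercive. -/
structure Admissible (R : ReducedProfile m) (r M k H γ α n : ℝ) (c : ℂ) : Prop where
  bounds : R.CoefBounds r M k
  hardy : R.IsHardy H
  small : γ * const₄ M k H ≤ k / 2
  pos_γ : 0 < γ
  γ_le : γ ≤ 1
  pos_α : 0 < α
  α_lt : α < 1
  pos_n : 0 < n
  lt_r : ‖c‖ < r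
  le_γ : ‖c‖ ≤ γ
  sq_le : ‖c‖ ^ 2 ≤ γ * c.im
  pos_im : 0 < c.im
  inv_n : 1 / n ≤ γ * c.im

variable {γ : ℝ}

theorem Admissible.mem_adm (h : Admissible R r M k H γ α n c) : c ∈ R.adm :=
  h.bounds.adm c h.lt_r

theorem const₃_nonneg (hM : 0 < M) (hk : 0 < k) (hH : 0 < H) : 0 ≤ const₃ M k H := by
  rw [const₃, const₂]; positivity

/-- The central estimate. Each term of minus the imaginary part has its own lower bound, and the α²
term is simply nonnegative because Re p > 0. -/
theorem opL_coercive (h : Admissible R r M k H γ α n c) (F : H10) :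
    k / 2 * (‖derL F‖ ^ 2 / n + c.im * ‖valL F‖ ^ 2) ≤ -(⟪F, R.opL α n c F⟫_ℂ).im := by
  have hB := h.bounds
  have hn := h.pos_n
  have t4 : 0 ≤ (⟪valL F, mulL (R.cp c) (valL F)⟫_ℂ).re := by
    have h1 := re_inner_mulL_ge (φ := R.cp c) (fun Y _ => hB.re_p c h.lt_r Y) (valL F)
    have := hB.pos_k
    exact le_trans (by positivity) h1
  rw [im_inner_opL]
  refine coercive_arith hB.pos_M hB.pos_k (const₃_nonneg hB.pos_M hB.pos_k h.hardy.1) h.small hn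
    (norm_nonneg c) h.le_γ h.sq_le h.pos_im h.inv_n
    (re_inner_p_opJ_ge hB h.hardy h.pos_α h.α_lt h.lt_r F)
    (re_inner_t_opJ_ge hB h.hardy h.pos_α h.α_lt h.lt_r F)
    (im_inner_mulL_ge (fun Y _ => hB.im_zp c h.lt_r h.pos_im.le Y) _)
    (by positivity) (im_inner_opΨ_ge hB h.hardy h.pos_α h.lt_r h.pos_im F)

theorem isUnit_opL (h : Admissible R r M k H γ α n c) : IsUnit (R.opL α n c) := by
  have hk := h.bounds.pos_k
  have hn := h.pos_n
  have hci := h.pos_im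
  apply isUnit_of_coercive (δ := k / 2 * min (1 / n) c.im) (by positivity)
  intro F
  refine le_trans ?_ ((opL_coercive h F).trans ((neg_le_abs _).trans (Complex.abs_im_le_norm _)))
  rw [h10_norm_sq, mul_assoc, mul_add, add_comm]
  have e : ‖derL F‖ ^ 2 / n = 1 / n * ‖derL F‖ ^ 2 := by ring
  rw [e]
  gcongr
  · exact min_le_left _ _
  · exact min_le_right _ _

/-! ### Energy estimates of the weak solution -/

theorem opL_sol (h : Admissible R r M k H γ α n c) (G : L2) :
    R.opL α n c (R.sol α n c G) = (adjoint valL) (mulL (R.cp c) G) := by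
  rw [sol, ContinuousLinearMap.comp_apply, inverse_apply (isUnit_opL h)]
  rfl

theorem sol_energy (h : Admissible R r M k H γ α n c) (G : L2) :
    k / 2 * (‖derL (R.sol α n c G)‖ ^ 2 / n + c.im * ‖valL (R.sol α n c G)‖ ^ 2)
      ≤ M * ‖valL (R.sol α n c G)‖ * ‖G‖ := by
  refine (opL_coercive h _).trans ((neg_le_abs _).trans ((Complex.abs_im_le_norm _).trans ?_))
  rw [opL_sol h, adjoint_inner_right]
  refine (norm_inner_le_norm _ _).trans ?_
  have h1 := (norm_mulL_le (R.cp c) G).trans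
    (mul_le_mul_of_nonneg_right (h.bounds.norm_p c h.lt_r) (norm_nonneg G))
  calc _ ≤ ‖valL (R.sol α n c G)‖ * (M * ‖G‖) := by gcongr
    _ = _ := by ring

theorem norm_val_sol_le (h : Admissible R r M k H γ α n c) (G : L2) :
    ‖valL (R.sol α n c G)‖ ≤ 2 * M / k * (1 / c.im * ‖G‖) := by
  have hE := sol_energy h G
  have hk := h.bounds.pos_k
  have hn := h.pos_n
  have hci := h.pos_im
  have hM := h.bounds.pos_M
  set X := ‖derL (R.sol α n c G)‖
  set Z := ‖valL (R.sol α n c G)‖ with hZ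
  have hX : 0 ≤ X ^ 2 / n := by positivity
  rcases (norm_nonneg (valL (R.sol α n c G))).eq_or_lt with h0 | h0
  · rw [hZ, ← h0]; positivity
  · have e1 : Z * (k / 2 * c.im * Z) ≤ Z * (M * ‖G‖) := by nlinarith
    have e2 := le_of_mul_le_mul_left e1 h0
    have e3 : 2 * M / k * (1 / c.im * ‖G‖) = (M * ‖G‖) / (k / 2 * c.im) := by field_simp
    rw [e3, le_div_iff₀ (by positivity)]
    linarith

/-- Inserting the bound for ‖f‖ into the right side of the energy inequality gives ‖f'‖² ≲ (n / Im
c)‖G‖². -/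
theorem norm_der_sol_le (h : Admissible R r M k H γ α n c) (G : L2) :
    ‖derL (R.sol α n c G)‖ ≤ 2 * M / k * (√n / √c.im * ‖G‖) := by
  have hE := sol_energy h G
  have hZ := norm_val_sol_le h G
  have hk := h.bounds.pos_k
  have hn := h.pos_n
  have hci := h.pos_im
  have hM := h.bounds.pos_M
  refine (abs_le_of_sq_le_sq' ?_ (by positivity)).2
  have e1 : (2 * M / k * (√n / √c.im * ‖G‖)) ^ 2
      = 2 * n / k * (M * (2 * M / k * (1 / c.im * ‖G‖)) * ‖G‖) := by
    rw [mul_pow, mul_pow (√n / √c.im), div_pow (√n), Real.sq_sqrt hn.le, Real.sq_sqrt hci.le]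
    field_simp
  rw [e1]
  have e2 : 0 ≤ c.im * ‖valL (R.sol α n c G)‖ ^ 2 := by positivity
  have e3 : ‖derL (R.sol α n c G)‖ ^ 2 = 2 * n / k * (k / 2 * (‖derL (R.sol α n c G)‖ ^ 2 / n)) := by
    field_simp
  rw [e3]
  refine mul_le_mul_of_nonneg_left ?_ (by positivity)
  calc k / 2 * (‖derL (R.sol α n c G)‖ ^ 2 / n)
      ≤ k / 2 * (‖derL (R.sol α n c G)‖ ^ 2 / n + c.im * ‖valL (R.sol α n c G)‖ ^ 2) := by
        gcongr; linarith
    _ ≤ _ := hE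
    _ ≤ _ := by gcongr

end ReducedProfile

/-! ### Representatives of elements of `L²` -/

section representatives

variable {f g : L2} {F G : ℝ → ℂ}

theorem rep_add (hf : f =ᵐ[halfLine] F) (hg : g =ᵐ[halfLine] G) :
    (f + g : L2) =ᵐ[halfLine] fun Y => F Y + G Y := by
  filter_upwards [Lp.coeFn_add f g, hf, hg] with Y h1 h2 h3
  rw [h1, Pi.add_apply, h2, h3]

theorem rep_sub (hf : f =ᵐ[halfLine] F) (hg : g =ᵐ[halfLine] G) :
    (f - g : L2) =ᵐ[halfLine] fun Y => F Y - G Y := by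
  filter_upwards [Lp.coeFn_sub f g, hf, hg] with Y h1 h2 h3
  rw [h1, Pi.sub_apply, h2, h3]

theorem rep_smul (z : ℂ) (hf : f =ᵐ[halfLine] F) :
    (z • f : L2) =ᵐ[halfLine] fun Y => z * F Y := by
  filter_upwards [Lp.coeFn_smul z f, hf] with Y h1 h2
  rw [h1, Pi.smul_apply, h2, smul_eq_mul]

theorem rep_mulL (φ : ℝ →ᵇ ℂ) (hf : f =ᵐ[halfLine] F) :
    mulL φ f =ᵐ[halfLine] fun Y => φ Y * F Y := by
  filter_upwards [coeFn_mulL φ f, hf] with Y h1 h2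
  rw [h1, h2]

end representatives

namespace ReducedProfile

variable {m : ℝ} (R : ReducedProfile m)

/-! ### Derivatives of the coefficients -/

section derivatives

variable (c : ℂ) {Y : ℝ}

theorem hasDerivAt_cz (hY : 0 < Y) : HasDerivAt (R.cz c) (R.bτ Y * R.bθ Y) Y := by
  have h := ((R.hasDerivAt_U Y hY).ofReal_comp).sub_const c
  have e : (R.cz c : ℝ → ℂ) = fun Y => (R.U Y : ℂ) - c := funext fun Y => R.cz_apply c Y
  rw [e]
  convert! h using 1
  simp

theorem hasDerivAt_bθ (hY : 0 < Y) : HasDerivAt R.bθ (R.bκ Y * R.bθ Y) Y := by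
  have h := (R.hasDerivAt_θ Y hY).ofReal_comp
  convert! h using 1
  simp

theorem hasDerivAt_bτ (hY : 0 < Y) : HasDerivAt R.bτ (-R.bθ Y - R.bκ Y * R.bτ Y) Y := by
  have h := (R.hasDerivAt_τ Y hY).ofReal_comp
  convert! h using 1
  simp

theorem cdA_apply (Y : ℝ) : R.cdA c Y = -2 * (m : ℂ) ^ 2 * (R.cz c Y * R.bτ Y * R.bθ Y) := rfl

theorem cdE_apply (Y : ℝ) : R.cdE c Y = R.cdA c Y - 2 * (m : ℂ) ^ 2 * (R.bτ Y ^ 3 * R.bθ Y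
    - 2 * (R.cz c Y * R.bτ Y * (R.bθ Y + R.bκ Y * R.bτ Y))) := rfl

theorem cA_eq (Y : ℝ) : R.cA c Y = 1 - (m : ℂ) ^ 2 * R.cz c Y ^ 2 := rfl

theorem cE_eq (Y : ℝ) : R.cE c Y = R.cA c Y - 2 * (m : ℂ) ^ 2 * (R.cz c Y * R.bτ Y ^ 2) := rfl

theorem hasDerivAt_cA (hY : 0 < Y) : HasDerivAt (R.cA c) (R.cdA c Y) Y := by
  have h := (((R.hasDerivAt_cz c hY).pow 2).const_mul ((m : ℂ) ^ 2)).const_sub 1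
  refine (h.congr_deriv ?_)
  rw [cdA_apply]
  push_cast
  ring

theorem hasDerivAt_cE (hY : 0 < Y) : HasDerivAt (R.cE c) (R.cdE c Y) Y := by
  have h := (R.hasDerivAt_cA c hY).sub
    (((R.hasDerivAt_cz c hY).mul ((R.hasDerivAt_bτ hY).pow 2)).const_mul (2 * (m : ℂ) ^ 2))
  refine (h.congr_deriv ?_)
  rw [cdE_apply]
  simp only [Pi.pow_apply]
  push_cast
  ring

/-- The κ terms cancel because (τθ)' = U'' = -θ², so a whole factor θ² survives. -/
theorem hasDerivAt_cdA (hY : 0 < Y) : HasDerivAt (R.cdA c)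
    (-2 * (m : ℂ) ^ 2 * R.bθ Y ^ 2 * (R.bτ Y ^ 2 - R.cz c Y)) Y := by
  have h := (((R.hasDerivAt_cz c hY).mul (R.hasDerivAt_bτ hY)).mul (R.hasDerivAt_bθ hY)).const_mul
    (-2 * (m : ℂ) ^ 2)
  refine (h.congr_deriv ?_)
  simp only [Pi.mul_apply]
  ring

variable {c}

theorem hasDerivAt_ca (hc : c ∈ R.adm) (hY : 0 < Y) :
    HasDerivAt (R.ca c) (-R.cdA c Y * R.ca c Y ^ 2) Y := by
  have h := (R.hasDerivAt_cA c hY).inv (R.cA_ne hc Y)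
  have e : (R.ca c : ℝ → ℂ) = (⇑(R.cA c))⁻¹ := funext fun Y => R.ca_apply hc Y
  rw [e]
  refine (h.congr_deriv ?_)
  rw [Pi.inv_apply]
  field_simp

end derivatives

/-! ### The stream function -/

section stream

variable (α n : ℝ) (c : ℂ) (G : L2)

/-- The stream function. -/
def ψ₀ : L2 := valL (R.opΨ α c (R.sol α n c G))
/-- `∂_Y Ψ`. -/
def ψ₁ : L2 := derL (R.opΨ α c (R.sol α n c G))
/-- `∂_Y² Ψ`. -/
def ψ₂ : L2 := R.opΨ₂ α c (R.sol α n c G)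
/-- `θ⁻¹ Λ(Ψ)`. -/
def f₀ : L2 := valL (R.sol α n c G)
/-- The derivative of `θ⁻¹ Λ(Ψ)`. -/
def f₁ : L2 := derL (R.sol α n c G)
/-- `A⁻¹ ∂_Y³ Ψ - α² ∂_Y Ψ`. -/
def flux₀ : L2 := mulL R.bθ (R.opJ α c (R.sol α n c G))
/-- The derivative of the flux. -/
def flux₁ : L2 := (Complex.I * n) • (mulL (R.cz c * R.bθ) (R.f₀ α n c G)
  - (Complex.I * (α : ℂ) ^ 2 / n) • mulL R.bθ (R.f₀ α n c G)
  + mulL (R.bθ ^ 2 * R.cE c * R.ca c ^ 2) (R.ψ₀ α n c G) - mulL R.bθ G)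
/-- `∂_Y³ Ψ`. -/
def ψ₃ : L2 := mulL (R.cA c) (R.flux₀ α n c G + ((α : ℂ) ^ 2) • R.ψ₁ α n c G)
/-- `∂_Y⁴ Ψ`. -/
def ψ₄ : L2 := mulL (R.cdA c) (R.flux₀ α n c G + ((α : ℂ) ^ 2) • R.ψ₁ α n c G)
  + mulL (R.cA c) (R.flux₁ α n c G + ((α : ℂ) ^ 2) • R.ψ₂ α n c G)

theorem rep_ψ₂ : R.ψ₂ α n c G =ᵐ[halfLine] fun Y => R.cb c Y * R.ψ₁ α n c G Y
    + R.cA c Y * ((α : ℂ) ^ 2 * R.ψ₀ α n c G Y + R.bθ Y * R.f₀ α n c G Y) :=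
  rep_add (rep_mulL _ .rfl) (rep_mulL _ (rep_add (rep_smul _ .rfl) (rep_mulL _ .rfl)))

theorem rep_opJ : R.opJ α c (R.sol α n c G) =ᵐ[halfLine] fun Y => R.f₁ α n c G Y
    + (R.bκ Y * R.f₀ α n c G Y - R.cr₂ c Y * R.ψ₂ α n c G Y - R.cr₁ c Y * R.ψ₁ α n c G Y) :=
  rep_add .rfl (rep_sub (rep_sub (rep_mulL _ .rfl) (rep_mulL _ .rfl)) (rep_mulL _ .rfl))

theorem rep_flux₀ : R.flux₀ α n c G =ᵐ[halfLine] fun Y => R.bθ Y * (R.f₁ α n c G Y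
    + (R.bκ Y * R.f₀ α n c G Y - R.cr₂ c Y * R.ψ₂ α n c G Y - R.cr₁ c Y * R.ψ₁ α n c G Y)) :=
  rep_mulL _ (R.rep_opJ α n c G)

theorem rep_flux₁ : R.flux₁ α n c G =ᵐ[halfLine] fun Y =>
    Complex.I * n * (R.cz c Y * R.bθ Y * R.f₀ α n c G Y
      - Complex.I * (α : ℂ) ^ 2 / n * (R.bθ Y * R.f₀ α n c G Y)
      + R.bθ Y ^ 2 * R.cE c Y * R.ca c Y ^ 2 * R.ψ₀ α n c G Y - R.bθ Y * G Y) :=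
  rep_smul _ (rep_sub (rep_add (rep_sub (rep_mulL _ .rfl) (rep_smul _ (rep_mulL _ .rfl)))
    (rep_mulL _ .rfl)) (rep_mulL _ .rfl))

theorem rep_ψ₃ : R.ψ₃ α n c G =ᵐ[halfLine] fun Y => R.cA c Y * (R.flux₀ α n c G Y
    + (α : ℂ) ^ 2 * R.ψ₁ α n c G Y) :=
  rep_mulL _ (rep_add .rfl (rep_smul _ .rfl))

theorem rep_ψ₄ : R.ψ₄ α n c G =ᵐ[halfLine] fun Y => R.cdA c Y * (R.flux₀ α n c G Y
    + (α : ℂ) ^ 2 * R.ψ₁ α n c G Y) + R.cA c Y * (R.flux₁ α n c G Y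
    + (α : ℂ) ^ 2 * R.ψ₂ α n c G Y) :=
  rep_add (rep_mulL _ (rep_add .rfl (rep_smul _ .rfl)))
    (rep_mulL _ (rep_add .rfl (rep_smul _ .rfl)))

variable {R α n c} {r M k H γ : ℝ}

theorem isWeakDeriv_ψ₀ : IsWeakDeriv (R.ψ₀ α n c G) (R.ψ₁ α n c G) := h10_isWeakDeriv _

theorem isWeakDeriv_f₀ : IsWeakDeriv (R.f₀ α n c G) (R.f₁ α n c G) := h10_isWeakDeriv _

/-- The weak formulation of Λ(Ψ) = θf, tested on H¹₀, read as a weak derivative. -/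
theorem isWeakDeriv_a_mul_ψ₁ (h : Admissible R r M k H γ α n c) :
    IsWeakDeriv (fun Y => R.ca c Y * R.ψ₁ α n c G Y)
      (fun Y => (α : ℂ) ^ 2 * R.ψ₀ α n c G Y + R.bθ Y * R.f₀ α n c G Y) := by
  have hw : IsWeakDeriv (mulL (R.ca c) (R.ψ₁ α n c G))
      (((α : ℂ) ^ 2) • R.ψ₀ α n c G + mulL R.bθ (R.f₀ α n c G) : L2) := by
    apply isWeakDeriv_of_forall_h10
    intro F
    have e := inner_opΨ (isUnit_opΛ (α := α) h.bounds h.pos_α h.lt_r) (R.sol α n c G) F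
    rw [inner_add_right, inner_smul_right]
    unfold ψ₀ ψ₁ f₀
    linear_combination e
  exact hw.congr (rep_mulL _ .rfl) (rep_add (rep_smul _ .rfl) (rep_mulL _ .rfl))

theorem isWeakDeriv_ψ₁ (h : Admissible R r M k H γ α n c) :
    IsWeakDeriv (R.ψ₁ α n c G) (R.ψ₂ α n c G) := by
  have hw := (isWeakDeriv_a_mul_ψ₁ G h).mul_left (fun Y hY => R.hasDerivAt_cA c hY)
    (R.cdA c).continuous.continuousOn
  refine hw.congr (.of_forall fun Y => ?_) ?_
  · show R.cA c Y * (R.ca c Y * R.ψ₁ α n c G Y) = _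
    rw [← mul_assoc, R.cA_mul_ca h.mem_adm, one_mul]
  · filter_upwards [R.rep_ψ₂ α n c G] with Y hY
    rw [hY]
    show _ = R.cdA c Y * R.ca c Y * _ + _
    ring

theorem isWeakDeriv_θ_mul_f₀ : IsWeakDeriv (fun Y => R.bθ Y * R.f₀ α n c G Y)
    (fun Y => R.bθ Y * (R.f₁ α n c G Y + R.bκ Y * R.f₀ α n c G Y)) := by
  have hw := (isWeakDeriv_f₀ (R := R) (α := α) (n := n) (c := c) G).mul_left
    (fun Y hY => R.hasDerivAt_bθ hY) (R.bκ * R.bθ).continuous.continuousOn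
  refine hw.congr .rfl (.of_forall fun Y => ?_)
  ring

/-- The formula for ∂_Y²Ψ is differentiated, and the combination α²Ψ + θf that arises is expressed
again through ∂_Y²Ψ and ∂_YΨ. The result is A(θJ + α²∂_YΨ), which justifies the definition of J. -/
theorem isWeakDeriv_ψ₂ (h : Admissible R r M k H γ α n c) :
    IsWeakDeriv (R.ψ₂ α n c G) (R.ψ₃ α n c G) := by
  have hb : ∀ Y, 0 < Y → HasDerivAt (fun Y => R.cdA c Y * R.ca c Y)
      (-2 * (m : ℂ) ^ 2 * R.bθ Y ^ 2 * (R.bτ Y ^ 2 - R.cz c Y) * R.ca c Y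
        + R.cdA c Y * (-R.cdA c Y * R.ca c Y ^ 2)) Y := fun Y hY =>
    (R.hasDerivAt_cdA c hY).mul (R.hasDerivAt_ca h.mem_adm hY)
  have h1 := (isWeakDeriv_ψ₁ G h).mul_left hb (by fun_prop)
  have h2 := (((isWeakDeriv_ψ₀ (R := R) (α := α) (n := n) (c := c) G).const_mul
    ((α : ℂ) ^ 2)).add
    (isWeakDeriv_θ_mul_f₀ (R := R) (α := α) (n := n) (c := c) G)).mul_left
    (fun Y hY => R.hasDerivAt_cA c hY) (R.cdA c).continuous.continuousOn
  refine (h1.add h2).congr (R.rep_ψ₂ α n c G).symm ?_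
  filter_upwards [R.rep_ψ₂ α n c G, R.rep_ψ₃ α n c G, R.rep_flux₀ α n c G] with Y e2 e3 e4
  rw [e3, e4]
  have hA := R.cA_ne h.mem_adm Y
  have hr2 : R.cr₂ c Y = 4 * (m : ℂ) ^ 2 * (R.cz c Y * R.bτ Y * R.ca c Y ^ 2) := rfl
  have hr1 : R.cr₁ c Y = 2 * (m : ℂ) ^ 2 * (R.bθ Y * (R.bτ Y ^ 2 * R.ca c Y ^ 2
    - R.cz c Y * R.ca c Y ^ 2 + 4 * (m : ℂ) ^ 2 * (R.cz c Y ^ 2 * R.bτ Y ^ 2 * R.ca c Y ^ 3))) := rfl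
  have hbb : R.cb c Y = R.cdA c Y * R.ca c Y := rfl
  rw [hr2, hr1]
  have e2' : (α : ℂ) ^ 2 * R.ψ₀ α n c G Y + R.bθ Y * R.f₀ α n c G Y
      = R.ca c Y * (R.ψ₂ α n c G Y - R.cb c Y * R.ψ₁ α n c G Y) := by
    rw [e2, R.ca_apply h.mem_adm]
    field_simp
    ring
  rw [e2', hbb, cdA_apply, R.ca_apply h.mem_adm]
  field_simp
  ring

theorem isWeakDeriv_p_mul_opJ (h : Admissible R r M k H γ α n c) :
    IsWeakDeriv (fun Y => -(Complex.I / n) * (R.cp c Y * R.opJ α c (R.sol α n c G) Y))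
      (fun Y => -(Complex.I / n) * (R.ct c Y * R.opJ α c (R.sol α n c G) Y)
        + R.cz c Y * R.cp c Y * R.f₀ α n c G Y
        + -(Complex.I * (α : ℂ) ^ 2 / n) * (R.cp c Y * R.f₀ α n c G Y)
        + R.bθ Y * R.ψ₀ α n c G Y - R.cp c Y * G Y) := by
  have hw : IsWeakDeriv ((-(Complex.I / n)) • mulL (R.cp c) (R.opJ α c (R.sol α n c G)) : L2)
      ((-(Complex.I / n)) • mulL (R.ct c) (R.opJ α c (R.sol α n c G))
        + mulL (R.cz c * R.cp c) (R.f₀ α n c G)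
        + (-(Complex.I * (α : ℂ) ^ 2 / n)) • mulL (R.cp c) (R.f₀ α n c G)
        + mulL R.bθ (R.ψ₀ α n c G) - mulL (R.cp c) G : L2) := by
    apply isWeakDeriv_of_forall_h10
    intro F
    have e := congrArg (fun z => ⟪F, z⟫_ℂ) (opL_sol h G)
    simp only [opL, add_apply, ContinuousLinearMap.comp_apply, inner_add_right,
      adjoint_inner_right, smul_apply] at e
    simp only [inner_sub_right, inner_add_right]
    unfold ψ₀ f₀
    linear_combination e
  exact hw.congr (rep_smul _ (rep_mulL _ .rfl)) (rep_sub (rep_add (rep_add (rep_add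
    (rep_smul _ (rep_mulL _ .rfl)) (rep_mulL _ .rfl)) (rep_smul _ (rep_mulL _ .rfl)))
    (rep_mulL _ .rfl)) (rep_mulL _ .rfl))

/-- The weight is undone by multiplying the weak equation by inθ/p = inθEA⁻². As t = ∂_Yp - κp, the
term with t cancels against the derivative of θ/p, and the unweighted Orr–Sommerfeld equation is
left, solved for the derivative of the flux. -/
theorem isWeakDeriv_flux₀ (h : Admissible R r M k H γ α n c) :
    IsWeakDeriv (R.flux₀ α n c G) (R.flux₁ α n c G) := by
  have hs : ∀ Y, 0 < Y → HasDerivAt (fun Y => Complex.I * n * (R.bθ Y * (R.cE c Y * R.ca c Y ^ 2)))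
      (Complex.I * n * (R.bκ Y * R.bθ Y * (R.cE c Y * R.ca c Y ^ 2) + R.bθ Y *
        (R.cdE c Y * R.ca c Y ^ 2 + R.cE c Y * (2 * R.ca c Y * (-R.cdA c Y * R.ca c Y ^ 2))))) Y :=
    fun Y hY => by
      have := ((R.hasDerivAt_bθ hY).mul ((R.hasDerivAt_cE c hY).mul
        ((R.hasDerivAt_ca h.mem_adm hY).pow 2))).const_mul (Complex.I * n)
      refine this.congr_deriv ?_
      simp only [Pi.pow_apply, Pi.mul_apply]
      push_cast
      ring
  have hw := (isWeakDeriv_p_mul_opJ G h).mul_left hs (by fun_prop)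
  have hn : (n : ℂ) ≠ 0 := by exact_mod_cast h.pos_n.ne'
  have hcp : ∀ Y, R.cp c Y = R.cA c Y ^ 2 * R.ce c Y := fun Y => rfl
  have hct : ∀ Y, R.ct c Y = 2 * (R.cA c Y * R.cdA c Y * R.ce c Y)
    - R.cA c Y ^ 2 * R.cdE c Y * R.ce c Y ^ 2 - R.bκ Y * R.cp c Y := fun Y => rfl
  refine hw.congr ?_ ?_
  · filter_upwards [rep_mulL R.bθ (f := R.opJ α c (R.sol α n c G)) .rfl] with Y hY
    rw [flux₀, hY, hcp, R.ca_apply h.mem_adm, R.ce_apply h.mem_adm]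
    have hA := R.cA_ne h.mem_adm Y
    have hE := R.cE_ne h.mem_adm Y
    field_simp
    rw [Complex.I_sq]
    ring
  · filter_upwards [R.rep_flux₁ α n c G] with Y hY
    rw [hY, hct, hcp, R.ca_apply h.mem_adm, R.ce_apply h.mem_adm]
    have hA := R.cA_ne h.mem_adm Y
    have hE := R.cE_ne h.mem_adm Y
    field_simp
    ring

theorem isWeakDeriv_ψ₃ (h : Admissible R r M k H γ α n c) :
    IsWeakDeriv (R.ψ₃ α n c G) (R.ψ₄ α n c G) := by
  have hw := ((isWeakDeriv_flux₀ G h).add ((isWeakDeriv_ψ₁ G h).const_mul ((α : ℂ) ^ 2))).mul_left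
    (fun Y hY => R.hasDerivAt_cA c hY) (R.cdA c).continuous.continuousOn
  exact hw.congr (R.rep_ψ₃ α n c G).symm (R.rep_ψ₄ α n c G).symm

end stream

end ReducedProfile

namespace ReducedProfile

variable {m : ℝ} (R : ReducedProfile m)

/-! ### The pressure and the tangential velocity -/

section fields

variable (α n : ℝ) (c : ℂ) (G a₀ b₀ b₁ : L2)

/-- The pressure `m⁻² ϱ` for the source `(a₀, b₀)`. -/
def pr₀ : L2 := -mulL (R.ca c) ((Complex.I / n) • (R.ψ₃ α n c G - ((α : ℂ) ^ 2) • R.ψ₁ α n c G)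
  + mulL (R.cz c) (R.ψ₁ α n c G) - mulL R.bτ (mulL R.bθ (R.ψ₀ α n c G))
  + (Complex.I * α)⁻¹ • a₀)
/-- The derivative of the pressure. -/
def pr₁ : L2 := -(Complex.I * (α : ℂ) ^ 2 / n) • (R.ψ₂ α n c G - ((α : ℂ) ^ 2) • R.ψ₀ α n c G)
  - ((α : ℂ) ^ 2) • mulL (R.cz c) (R.ψ₀ α n c G) - b₀
/-- The second derivative of the pressure. -/
def pr₂ : L2 := ((α : ℂ) ^ 2) • mulL (R.cA c) (R.pr₀ α n c G a₀)
  - (2 * (α : ℂ) ^ 2) • mulL R.bτ (mulL R.bθ (R.ψ₀ α n c G)) - ((Complex.I * α) • a₀ + b₁)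

/-- The tangential velocity. -/
def ve₀ : L2 := R.ψ₁ α n c G - ((m : ℂ) ^ 2) • mulL (R.cz c) (R.pr₀ α n c G a₀)
/-- The derivative of the tangential velocity. -/
def ve₁ : L2 := R.ψ₂ α n c G - ((m : ℂ) ^ 2) • (mulL R.bτ (mulL R.bθ (R.pr₀ α n c G a₀))
  + mulL (R.cz c) (R.pr₁ α n c G b₀))
/-- The second derivative of the tangential velocity. -/
def ve₂ : L2 := R.ψ₃ α n c G + ((m : ℂ) ^ 2) • (mulL R.bθ (mulL R.bθ (R.pr₀ α n c G a₀))
  - (2 : ℂ) • mulL R.bτ (mulL R.bθ (R.pr₁ α n c G b₀))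
  - mulL (R.cz c) (R.pr₂ α n c G a₀ b₁))

theorem rep_neg {f : L2} {F : ℝ → ℂ} (hf : f =ᵐ[halfLine] F) :
    (-f : L2) =ᵐ[halfLine] fun Y => -F Y := by
  filter_upwards [Lp.coeFn_neg f, hf] with Y h1 h2
  rw [h1, Pi.neg_apply, h2]

theorem rep_pr₀ : R.pr₀ α n c G a₀ =ᵐ[halfLine] fun Y =>
    -(R.ca c Y * (Complex.I / n * (R.ψ₃ α n c G Y - (α : ℂ) ^ 2 * R.ψ₁ α n c G Y)
      + R.cz c Y * R.ψ₁ α n c G Y - R.bτ Y * (R.bθ Y * R.ψ₀ α n c G Y)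
      + (Complex.I * α)⁻¹ * a₀ Y)) :=
  rep_neg (rep_mulL _ (rep_add (rep_sub (rep_add (rep_smul _ (rep_sub .rfl (rep_smul _ .rfl)))
    (rep_mulL _ .rfl)) (rep_mulL _ (rep_mulL _ .rfl))) (rep_smul _ .rfl)))

theorem rep_pr₁ : R.pr₁ α n c G b₀ =ᵐ[halfLine] fun Y =>
    -(Complex.I * (α : ℂ) ^ 2 / n) * (R.ψ₂ α n c G Y - (α : ℂ) ^ 2 * R.ψ₀ α n c G Y)
      - (α : ℂ) ^ 2 * (R.cz c Y * R.ψ₀ α n c G Y) - b₀ Y :=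
  rep_sub (rep_sub (rep_smul _ (rep_sub .rfl (rep_smul _ .rfl))) (rep_smul _ (rep_mulL _ .rfl))) .rfl

theorem rep_pr₂ : R.pr₂ α n c G a₀ b₁ =ᵐ[halfLine] fun Y =>
    (α : ℂ) ^ 2 * (R.cA c Y * R.pr₀ α n c G a₀ Y)
      - 2 * (α : ℂ) ^ 2 * (R.bτ Y * (R.bθ Y * R.ψ₀ α n c G Y))
      - (Complex.I * α * a₀ Y + b₁ Y) :=
  rep_sub (rep_sub (rep_smul _ (rep_mulL _ .rfl)) (rep_smul _ (rep_mulL _ (rep_mulL _ .rfl))))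
    (rep_add (rep_smul _ .rfl) .rfl)

theorem rep_ve₀ : R.ve₀ α n c G a₀ =ᵐ[halfLine] fun Y =>
    R.ψ₁ α n c G Y - (m : ℂ) ^ 2 * (R.cz c Y * R.pr₀ α n c G a₀ Y) :=
  rep_sub .rfl (rep_smul _ (rep_mulL _ .rfl))

theorem rep_ve₁ : R.ve₁ α n c G a₀ b₀ =ᵐ[halfLine] fun Y =>
    R.ψ₂ α n c G Y - (m : ℂ) ^ 2 * (R.bτ Y * (R.bθ Y * R.pr₀ α n c G a₀ Y)
      + R.cz c Y * R.pr₁ α n c G b₀ Y) :=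
  rep_sub .rfl (rep_smul _ (rep_add (rep_mulL _ (rep_mulL _ .rfl)) (rep_mulL _ .rfl)))

theorem rep_ve₂ : R.ve₂ α n c G a₀ b₀ b₁ =ᵐ[halfLine] fun Y =>
    R.ψ₃ α n c G Y + (m : ℂ) ^ 2 * (R.bθ Y * (R.bθ Y * R.pr₀ α n c G a₀ Y)
      - 2 * (R.bτ Y * (R.bθ Y * R.pr₁ α n c G b₀ Y)) - R.cz c Y * R.pr₂ α n c G a₀ b₁ Y) :=
  rep_add .rfl (rep_smul _ (rep_sub (rep_sub (rep_mulL _ (rep_mulL _ .rfl))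
    (rep_smul _ (rep_mulL _ (rep_mulL _ .rfl)))) (rep_mulL _ .rfl)))

variable {R α n c G a₀ b₀ b₁} {a₁ : L2} {r M k H γ : ℝ}

theorem hasDerivAt_τθ {Y : ℝ} (hY : 0 < Y) :
    HasDerivAt (fun Y => R.bτ Y * R.bθ Y) (-R.bθ Y ^ 2) Y := by
  refine ((R.hasDerivAt_bτ hY).mul (R.hasDerivAt_bθ hY)).congr_deriv ?_
  ring

theorem isWeakDeriv_ca_mul (hc : c ∈ R.adm) (ha : IsWeakDeriv a₀ a₁) :
    IsWeakDeriv (fun Y => R.ca c Y * a₀ Y)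
      (fun Y => -R.cdA c Y * R.ca c Y ^ 2 * a₀ Y + R.ca c Y * a₁ Y) :=
  ha.mul_left (fun Y hY => R.hasDerivAt_ca hc hY) (by fun_prop)

/-- The Orr–Sommerfeld equation, with source θG = Ω, is the compatibility of the two momentum
equations: `pr₀` comes from the first, `pr₁` from the second. In the derivative of `pr₀` the flux
derivative is replaced by means of the equation, and the derivative of A⁻¹s₁ by s₂ - Ω. -/
theorem isWeakDeriv_pr₀ (h : Admissible R r M k H γ α n c) (ha : IsWeakDeriv a₀ a₁)
    (hG : ∀ᵐ Y ∂halfLine, R.bθ Y * G Y = b₀ Y - (Complex.I * α)⁻¹ *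
      (-R.cdA c Y * R.ca c Y ^ 2 * a₀ Y + R.ca c Y * a₁ Y)) :
    IsWeakDeriv (R.pr₀ α n c G a₀) (R.pr₁ α n c G b₀) := by
  have hn : (n : ℂ) ≠ 0 := by exact_mod_cast h.pos_n.ne'
  have h1 := (((isWeakDeriv_flux₀ G h).add ((isWeakDeriv_ψ₁ G h).const_mul ((α : ℂ) ^ 2))).sub
    ((isWeakDeriv_a_mul_ψ₁ G h).const_mul ((α : ℂ) ^ 2))).const_mul (Complex.I / n)
  have h2 := (isWeakDeriv_a_mul_ψ₁ G h).mul_left (fun Y hY => R.hasDerivAt_cz c hY)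
    (R.bτ * R.bθ).continuous.continuousOn
  have h3 := (isWeakDeriv_ψ₀ (R := R) (α := α) (n := n) (c := c) G).mul_left
    (fun Y hY => (R.hasDerivAt_ca h.mem_adm hY).mul (hasDerivAt_τθ (R := R) hY)) (by fun_prop)
  have h4 := (isWeakDeriv_ca_mul h.mem_adm ha).const_mul (Complex.I * α)⁻¹
  refine ((((h1.add h2).sub h3).add h4).const_mul (-1)).congr ?_ ?_
  · filter_upwards [R.rep_pr₀ α n c G a₀, R.rep_ψ₃ α n c G] with Y e1 e2
    rw [e1, e2]
    have hA := R.cA_mul_ca h.mem_adm Y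
    simp only [Pi.mul_apply]
    linear_combination (Complex.I / n * (R.flux₀ α n c G Y + (α : ℂ) ^ 2 * R.ψ₁ α n c G Y)) * hA
  · filter_upwards [R.rep_pr₁ α n c G b₀, R.rep_flux₁ α n c G, hG] with Y e1 e2 e3
    rw [e1, e2]
    have e3' : (Complex.I * α)⁻¹ * (-R.cdA c Y * R.ca c Y ^ 2 * a₀ Y + R.ca c Y * a₁ Y)
      = b₀ Y - R.bθ Y * G Y := by rw [e3]; ring
    rw [e3', cE_eq, cdA_apply]
    have hA := R.cA_mul_ca h.mem_adm Y
    simp only [Pi.mul_apply]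
    have hI : Complex.I / n * (Complex.I * n) = -1 := by
      field_simp
      exact Complex.I_sq
    set w := R.cz c Y * R.bθ Y * R.f₀ α n c G Y
      - Complex.I * (α : ℂ) ^ 2 / n * (R.bθ Y * R.f₀ α n c G Y)
      + R.bθ Y ^ 2 * (R.cA c Y - 2 * (m : ℂ) ^ 2 * (R.cz c Y * R.bτ Y ^ 2)) * R.ca c Y ^ 2
        * R.ψ₀ α n c G Y - R.bθ Y * G Y with hw
    linear_combination (-w) * hI - hw + (R.bθ Y ^ 2 * R.ca c Y * R.ψ₀ α n c G Y) * hA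

/-- The third derivative of Ψ is eliminated through the definition of the pressure. Hence the second
derivative of the pressure is bounded by the pressure, θΨ and the divergence of the source, which is
why div(s₁, s₂) enters the estimates. -/
theorem isWeakDeriv_pr₁ (h : Admissible R r M k H γ α n c) (hb : IsWeakDeriv b₀ b₁) :
    IsWeakDeriv (R.pr₁ α n c G b₀) (R.pr₂ α n c G a₀ b₁) := by
  have hα : (α : ℂ) ≠ 0 := by exact_mod_cast h.pos_α.ne'
  have h1 := ((isWeakDeriv_ψ₂ G h).sub ((isWeakDeriv_ψ₀ (R := R) (α := α) (n := n) (c := c)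
    G).const_mul ((α : ℂ) ^ 2))).const_mul (-(Complex.I * (α : ℂ) ^ 2 / n))
  have h2 := ((isWeakDeriv_ψ₀ (R := R) (α := α) (n := n) (c := c) G).mul_left
    (fun Y hY => R.hasDerivAt_cz c hY) (R.bτ * R.bθ).continuous.continuousOn).const_mul
    ((α : ℂ) ^ 2)
  refine ((h1.sub h2).sub hb).congr (R.rep_pr₁ α n c G b₀).symm ?_
  filter_upwards [R.rep_pr₂ α n c G a₀ b₁, R.rep_pr₀ α n c G a₀] with Y e1 e2
  rw [e1, e2]
  have hA := R.cA_mul_ca h.mem_adm Y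
  have hI : (α : ℂ) ^ 2 * (Complex.I * α)⁻¹ = -(Complex.I * α) := by
    rw [mul_inv, Complex.inv_I]
    field_simp
  linear_combination ((α : ℂ) ^ 2 * (Complex.I / n * (R.ψ₃ α n c G Y - (α : ℂ) ^ 2 * R.ψ₁ α n c G Y)
      + R.cz c Y * R.ψ₁ α n c G Y - R.bτ Y * (R.bθ Y * R.ψ₀ α n c G Y)
      + (Complex.I * α)⁻¹ * a₀ Y)) * hA + a₀ Y * hI

theorem isWeakDeriv_ve₀ (h : Admissible R r M k H γ α n c)
    (hp : IsWeakDeriv (R.pr₀ α n c G a₀) (R.pr₁ α n c G b₀)) :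
    IsWeakDeriv (R.ve₀ α n c G a₀) (R.ve₁ α n c G a₀ b₀) := by
  have h1 := (hp.mul_left (fun Y hY => R.hasDerivAt_cz c hY)
    (R.bτ * R.bθ).continuous.continuousOn).const_mul ((m : ℂ) ^ 2)
  refine ((isWeakDeriv_ψ₁ G h).sub h1).congr (R.rep_ve₀ α n c G a₀).symm ?_
  filter_upwards [R.rep_ve₁ α n c G a₀ b₀] with Y e1
  rw [e1]
  ring

/-- This is the only derivative of the velocity in which ∂_Y³Ψ appears without a factor 1/n, so only
here the weaker bound with √(n / Im c) is needed. -/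
theorem isWeakDeriv_ve₁ (h : Admissible R r M k H γ α n c)
    (hp : IsWeakDeriv (R.pr₀ α n c G a₀) (R.pr₁ α n c G b₀))
    (hp' : IsWeakDeriv (R.pr₁ α n c G b₀) (R.pr₂ α n c G a₀ b₁)) :
    IsWeakDeriv (R.ve₁ α n c G a₀ b₀) (R.ve₂ α n c G a₀ b₀ b₁) := by
  have h1 := ((hp.mul_left (fun Y hY => hasDerivAt_τθ (R := R) hY) (by fun_prop)).add
    (hp'.mul_left (fun Y hY => R.hasDerivAt_cz c hY)
    (R.bτ * R.bθ).continuous.continuousOn)).const_mul ((m : ℂ) ^ 2)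
  refine ((isWeakDeriv_ψ₂ G h).sub h1).congr ?_ ?_
  · filter_upwards [R.rep_ve₁ α n c G a₀ b₀] with Y e1
    rw [e1]
    ring
  · filter_upwards [R.rep_ve₂ α n c G a₀ b₀ b₁] with Y e1
    rw [e1]
    ring

end fields

end ReducedProfile

namespace ReducedProfile

variable {m : ℝ} {R : ReducedProfile m} {r M k H γ α n : ℝ} {c : ℂ}

/-! ### Estimates of the stream function -/

theorem Admissible.im_le (h : Admissible R r M k H γ α n c) : c.im ≤ 1 :=
  ((le_abs_self _).trans (Complex.abs_im_le_norm c)).trans (h.le_γ.trans h.γ_le)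

theorem Admissible.one_le_n_mul_im (h : Admissible R r M k H γ α n c) : 1 ≤ n * c.im := by
  have h1 := h.inv_n
  rw [div_le_iff₀ h.pos_n] at h1
  have := mul_le_mul_of_nonneg_right h.γ_le (mul_pos h.pos_im h.pos_n).le
  linarith

theorem Admissible.one_le_n (h : Admissible R r M k H γ α n c) : 1 ≤ n :=
  h.one_le_n_mul_im.trans (mul_le_of_le_one_right h.pos_n.le h.im_le)

theorem Admissible.inv_im_le (h : Admissible R r M k H γ α n c) : 1 / c.im ≤ √n / √c.im := by
  have hci := h.pos_im
  rw [← Real.sqrt_div' _ hci.le]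
  apply Real.le_sqrt_of_sq_le
  rw [div_pow, one_pow, div_le_div_iff₀ (by positivity) hci]
  nlinarith [h.one_le_n_mul_im]

/-- Since n / Im c ≥ 1, it dominates its square root. Consequently the viscous term (i/n)∂_Y³Ψ in
the pressure costs no more than 1 / Im c. -/
theorem Admissible.inv_n_mul_le (h : Admissible R r M k H γ α n c) :
    1 / n * (√n / √c.im) ≤ 1 / c.im := by
  have hci := h.pos_im
  have hn := h.pos_n
  rw [← Real.sqrt_div' _ hci.le]
  have : √(n / c.im) ≤ n / c.im := by
    rw [Real.sqrt_le_left (by positivity)]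
    have : 1 ≤ n / c.im := (one_le_div hci).2 (h.im_le.trans h.one_le_n)
    nlinarith
  calc _ ≤ 1 / n * (n / c.im) := by gcongr
    _ = 1 / c.im := by field_simp

theorem exists_stream_bound (R : ReducedProfile m) (r M k H : ℝ) : ∃ K : ℝ, 1 ≤ K ∧ M ≤ K ∧
    ∀ γ α n c, Admissible R r M k H γ α n c → ∀ G : L2,
      α * ‖R.ψ₀ α n c G‖ ≤ K * (1 / c.im * ‖G‖) ∧ ‖R.ψ₁ α n c G‖ ≤ K * (1 / c.im * ‖G‖) ∧
      ‖R.ψ₂ α n c G‖ ≤ K * (1 / c.im * ‖G‖) ∧ ‖mulL R.bθ (R.ψ₀ α n c G)‖ ≤ K * (1 / c.im * ‖G‖) ∧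
      ‖R.ψ₃ α n c G‖ ≤ K * (√n / √c.im * ‖G‖) := by
  -- Positivity of M, k and H is only available from an admissible choice of parameters; without one
  -- the bounds are vacuous.
  by_cases hex : ∃ γ α n c, Admissible R r M k H γ α n c
  swap
  · exact ⟨max 1 M, le_max_left _ _, le_max_right _ _,
      fun γ α n c h => (hex ⟨γ, α, n, c, h⟩).elim⟩
  obtain ⟨_, _, _, _, h₀⟩ := hex
  have hM := h₀.bounds.pos_M
  have hk := h₀.bounds.pos_k
  have hH := h₀.hardy.1
  have hC₃ := const₃_nonneg hM hk hH
  have hC₂ : 0 ≤ const₂ M k H := by rw [const₂]; positivity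
  set L := 2 * M / k with hL
  have hL0 : 0 < L := by positivity
  set K₃ := M * (M * (L + const₃ M k H * L) + H / k * L) with hK₃
  refine ⟨1 + M + H / k * L + const₂ M k H * L + H * (H / k * L) + K₃, ?_, ?_, ?_⟩
  · have : 0 ≤ M + H / k * L + const₂ M k H * L + H * (H / k * L) + K₃ := by positivity
    linarith
  · have : 0 ≤ 1 + H / k * L + const₂ M k H * L + H * (H / k * L) + K₃ := by positivity
    linarith
  intro γ α n c h G
  have hci := h.pos_im
  have hn := h.pos_n
  have hf := norm_val_sol_le h G
  have hd := norm_der_sol_le h G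
  rw [← hL] at hf hd
  set X := 1 / c.im * ‖G‖ with hX
  set W := √n / √c.im * ‖G‖ with hW
  have hX0 : 0 ≤ X := by positivity
  have hW0 : 0 ≤ W := by positivity
  have hXW : X ≤ W := mul_le_mul_of_nonneg_right h.inv_im_le (norm_nonneg _)
  have b0 : α * ‖R.ψ₀ α n c G‖ ≤ H / k * L * X := by
    refine (norm_val_opΨ_le h.bounds h.hardy h.pos_α h.lt_r _).trans ?_
    rw [mul_assoc]; gcongr
  have b1 : ‖R.ψ₁ α n c G‖ ≤ H / k * L * X := by
    refine (norm_der_opΨ_le h.bounds h.hardy h.pos_α h.lt_r _).trans ?_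
    rw [mul_assoc]; gcongr
  have b2 : ‖R.ψ₂ α n c G‖ ≤ const₂ M k H * L * X := by
    refine (norm_opΨ₂_le h.bounds h.hardy h.pos_α h.α_lt h.lt_r _).trans ?_
    rw [mul_assoc]; gcongr
  have bθ : ‖mulL R.bθ (R.ψ₀ α n c G)‖ ≤ H * (H / k * L) * X := by
    refine (h.hardy.2 _).trans ?_
    rw [mul_assoc]; gcongr
    exact b1
  have bJ : ‖R.opJ α c (R.sol α n c G)‖ ≤ (L + const₃ M k H * L) * W := by
    have e := norm_opJ_sub_le h.bounds h.hardy h.pos_α h.α_lt h.lt_r (R.sol α n c G)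
    have e' := norm_add_le (derL (R.sol α n c G))
      (R.opJ α c (R.sol α n c G) - derL (R.sol α n c G))
    rw [add_sub_cancel] at e'
    have : const₃ M k H * ‖valL (R.sol α n c G)‖ ≤ const₃ M k H * (L * W) := by
      gcongr
      exact hf.trans (by gcongr)
    linarith
  have b3 : ‖R.ψ₃ α n c G‖ ≤ K₃ * W := by
    refine (norm_mulL_le _ _).trans ?_
    rw [hK₃, mul_assoc]
    have hα2 : ‖((α : ℂ) ^ 2) • R.ψ₁ α n c G‖ ≤ H / k * L * W := by
      rw [norm_smul, norm_pow, Complex.norm_real, Real.norm_of_nonneg h.pos_α.le]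
      have : α ^ 2 ≤ 1 := pow_le_one₀ h.pos_α.le h.α_lt.le
      calc _ ≤ 1 * ‖R.ψ₁ α n c G‖ := by gcongr
        _ ≤ H / k * L * X := by rw [one_mul]; exact b1
        _ ≤ _ := by gcongr
    have hfl : ‖R.flux₀ α n c G‖ ≤ M * ((L + const₃ M k H * L) * W) := by
      refine (norm_mulL_le _ _).trans ?_
      gcongr
      exact h.bounds.norm_θ
    gcongr
    · exact h.bounds.norm_A c h.lt_r
    · refine (norm_add_le _ _).trans ?_
      linarith
  have p1 : 0 ≤ H / k * L := by positivity
  have p2 : 0 ≤ const₂ M k H * L := by positivity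
  have p3 : 0 ≤ H * (H / k * L) := by positivity
  have p4 : 0 ≤ K₃ := by positivity
  refine ⟨b0.trans ?_, b1.trans ?_, b2.trans ?_, bθ.trans ?_, b3.trans ?_⟩ <;> gcongr <;> linarith

/-! ### Estimates of the pressure and the tangential velocity -/

theorem norm_mulL_le_of_le {φ : ℝ →ᵇ ℂ} {f : L2} {a b : ℝ} (hφ : ‖φ‖ ≤ a) (hf : ‖f‖ ≤ b) :
    ‖mulL φ f‖ ≤ a * b :=
  (norm_mulL_le φ f).trans (mul_le_mul hφ hf (norm_nonneg _) ((norm_nonneg _).trans hφ))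

theorem norm_smul_le_of_le {z : ℂ} {f : L2} {a b : ℝ} (hz : ‖z‖ ≤ a) (hf : ‖f‖ ≤ b) :
    ‖z • f‖ ≤ a * b := by
  rw [norm_smul]
  exact mul_le_mul hz hf (norm_nonneg _) ((norm_nonneg _).trans hz)

theorem norm_sub_le_of_le₂ {f g : L2} {a b : ℝ} (hf : ‖f‖ ≤ a) (hg : ‖g‖ ≤ b) :
    ‖f - g‖ ≤ a + b := (norm_sub_le f g).trans (add_le_add hf hg)

/-- Ψ itself enters only as α²Ψ, bounded by α‖Ψ‖, or as θΨ, bounded by Hardy, so no power of 1/α is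
lost except in the source term (iα)⁻¹s₁ of the pressure. -/
theorem exists_fields_bound (hm : m ^ 2 ≤ 1) (R : ReducedProfile m) (r M k H : ℝ) :
    ∃ K : ℝ, 1 ≤ K ∧
    ∀ γ α n c, Admissible R r M k H γ α n c → ∀ G a₀ b₀ b₁ : L2, ∀ X S W : ℝ,
      X = 1 / c.im * ‖G‖ →
      S = X + 1 / α * ‖a₀‖ + ‖b₀‖ + ‖(Complex.I * (α : ℂ)) • a₀ + b₁‖ →
      W = √n / √c.im * ‖G‖ + 1 / α * ‖a₀‖ + ‖b₀‖ + ‖(Complex.I * (α : ℂ)) • a₀ + b₁‖ →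
      α * ‖R.ψ₀ α n c G‖ ≤ K * S ∧ ‖R.ψ₁ α n c G‖ ≤ K * S ∧ ‖R.ψ₂ α n c G‖ ≤ K * S ∧
      ‖R.pr₀ α n c G a₀‖ ≤ K * S ∧ ‖R.pr₁ α n c G b₀‖ ≤ K * S ∧ ‖R.pr₂ α n c G a₀ b₁‖ ≤ K * S ∧
      ‖R.ve₀ α n c G a₀‖ ≤ K * S ∧ ‖R.ve₁ α n c G a₀ b₀‖ ≤ K * S ∧
      ‖R.ve₂ α n c G a₀ b₀ b₁‖ ≤ K * W := by
  obtain ⟨K, hK1, hMK, hK⟩ := exists_stream_bound R r M k H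
  -- A generous common constant: the pressure and its derivatives cost at most 8K⁴, and the second
  -- derivative of the velocity two further multiplications at most, with numerical factors summing
  -- to less than 40.
  refine ⟨40 * K ^ 6, ?_, ?_⟩
  · nlinarith [one_le_pow₀ hK1 (n := 6)]
  intro γ α n c h G a₀ b₀ b₁ X S W hX hS hW
  obtain ⟨e0, e1, e2, eθ, e3⟩ := hK γ α n c h G
  rw [← hX] at e0 e1 e2 eθ
  have hci := h.pos_im
  have hn := h.pos_n
  have hα := h.pos_α
  have hK0 : 0 ≤ K := by linarith
  have hB := h.bounds
  have hX0 : 0 ≤ X := by rw [hX]; positivity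
  have hXW : X ≤ √n / √c.im * ‖G‖ := by
    rw [hX]; exact mul_le_mul_of_nonneg_right h.inv_im_le (norm_nonneg _)
  have hWn : 1 / n * (√n / √c.im * ‖G‖) ≤ X := by
    rw [hX, ← mul_assoc]; exact mul_le_mul_of_nonneg_right h.inv_n_mul_le (norm_nonneg _)
  have s1 : 0 ≤ 1 / α * ‖a₀‖ := by positivity
  have s2 := norm_nonneg b₀
  have s3 := norm_nonneg ((Complex.I * (α : ℂ)) • a₀ + b₁)
  have hXS : X ≤ S := by linarith
  have hS0 : 0 ≤ S := hX0.trans hXS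
  have hSW : S ≤ W := by linarith
  have hW0 : 0 ≤ W := hS0.trans hSW
  have hnz : ‖(Complex.I / n : ℂ)‖ = 1 / n := by
    rw [norm_div, Complex.norm_I, Complex.norm_real, Real.norm_of_nonneg hn.le]
  have hα2 : ‖((α : ℂ) ^ 2)‖ ≤ α := by
    rw [norm_pow, Complex.norm_real, Real.norm_of_nonneg hα.le]
    nlinarith [h.α_lt]
  have hα2' : ‖((α : ℂ) ^ 2)‖ ≤ 1 := hα2.trans h.α_lt.le
  have hin : 1 / n ≤ 1 := by rw [div_le_one hn]; exact h.one_le_n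
  have hm2 : ‖((m : ℂ) ^ 2)‖ ≤ 1 := by
    rw [norm_pow, Complex.norm_real, Real.norm_eq_abs, sq_abs]; exact hm
  have nz : ‖R.cz c‖ ≤ K := (hB.norm_z c h.lt_r).trans hMK
  have nA : ‖R.cA c‖ ≤ K := (hB.norm_A c h.lt_r).trans hMK
  have na : ‖R.ca c‖ ≤ K := (hB.norm_a c h.lt_r).trans hMK
  have nτ : ‖R.bτ‖ ≤ K := hB.norm_τ.trans hMK
  have nθ : ‖R.bθ‖ ≤ K := hB.norm_θ.trans hMK
  have aψ : ‖((α : ℂ) ^ 2) • R.ψ₀ α n c G‖ ≤ K * X := by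
    rw [norm_smul]
    exact (mul_le_mul_of_nonneg_right hα2 (norm_nonneg _)).trans e0
  have pow2 : K ≤ K ^ 2 := le_self_pow₀ hK1 (by norm_num)
  have mono : ∀ {a b : ℕ}, a ≤ b → K ^ a ≤ K ^ b := fun hab => pow_le_pow_right₀ hK1 hab
  have d3 : ‖(Complex.I / n : ℂ) • R.ψ₃ α n c G‖ ≤ K * X := by
    rw [norm_smul, hnz]
    calc _ ≤ 1 / n * (K * (√n / √c.im * ‖G‖)) := by gcongr
      _ = K * (1 / n * (√n / √c.im * ‖G‖)) := by ring
      _ ≤ _ := by gcongr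
  have p0 : ‖R.pr₀ α n c G a₀‖ ≤ 5 * K ^ 3 * S := by
    have q1 : ‖(Complex.I / n : ℂ) • (R.ψ₃ α n c G - ((α : ℂ) ^ 2) • R.ψ₁ α n c G)‖
        ≤ K * X + 1 * (1 * (K * X)) := by
      rw [smul_sub]
      exact norm_sub_le_of_le₂ d3 (norm_smul_le_of_le (hnz.trans_le hin)
        (norm_smul_le_of_le hα2' e1))
    have q2 := norm_mulL_le_of_le nz e1
    have q3 := norm_mulL_le_of_le nτ eθ
    have q4 : ‖(Complex.I * (α : ℂ))⁻¹ • a₀‖ ≤ 1 / α * ‖a₀‖ := by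
      rw [norm_smul, norm_inv, norm_mul, Complex.norm_I, one_mul, Complex.norm_real,
        Real.norm_of_nonneg hα.le, one_div]
    rw [pr₀, norm_neg]
    refine (norm_mulL_le_of_le na (norm_add_le_of_le (norm_sub_le_of_le₂ (norm_add_le_of_le q1 q2)
      q3) q4)).trans ?_
    have t : K * X + 1 * (1 * (K * X)) + K * (K * X) + K * (K * X) + 1 / α * ‖a₀‖ ≤ 5 * K ^ 2 * S := by
      have t1 : K * X ≤ K ^ 2 * S := by gcongr
      have t2 : K * (K * X) ≤ K ^ 2 * S := by rw [← mul_assoc, ← sq]; gcongr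
      have t3 : 1 / α * ‖a₀‖ ≤ K ^ 2 * S :=
        le_trans (by linarith) (le_mul_of_one_le_left hS0 (one_le_pow₀ hK1))
      linarith
    calc _ ≤ K * (5 * K ^ 2 * S) := by gcongr
      _ = _ := by ring
  have p1 : ‖R.pr₁ α n c G b₀‖ ≤ 5 * K ^ 3 * S := by
    have hz : ‖-(Complex.I * (α : ℂ) ^ 2 / n)‖ ≤ 1 := by
      have : -(Complex.I * (α : ℂ) ^ 2 / n) = -((Complex.I / n) * (α : ℂ) ^ 2) := by ring
      rw [this, norm_neg, norm_mul, hnz]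
      exact mul_le_one₀ hin (norm_nonneg _) hα2'
    have q1 := norm_smul_le_of_le hz (norm_sub_le_of_le₂ e2 aψ)
    have q2 : ‖((α : ℂ) ^ 2) • mulL (R.cz c) (R.ψ₀ α n c G)‖ ≤ K * (K * X) := by
      rw [← map_smul]
      exact norm_mulL_le_of_le nz aψ
    refine (norm_sub_le_of_le₂ (norm_sub_le_of_le₂ q1 q2) le_rfl).trans ?_
    have t1 : K * X ≤ K ^ 3 * S := by
      have := mono (a := 1) (b := 3) (by norm_num)
      rw [pow_one] at this
      gcongr
    have t2 : K * (K * X) ≤ K ^ 3 * S := by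
      have := mono (a := 2) (b := 3) (by norm_num)
      rw [← mul_assoc, ← sq]; gcongr
    have t3 : ‖b₀‖ ≤ K ^ 3 * S :=
      le_trans (by linarith) (le_mul_of_one_le_left hS0 (one_le_pow₀ hK1))
    have t4 : 0 ≤ K ^ 3 * S := by positivity
    linarith
  have p2 : ‖R.pr₂ α n c G a₀ b₁‖ ≤ 8 * K ^ 4 * S := by
    have q1 := norm_smul_le_of_le hα2' (norm_mulL_le_of_le nA p0)
    have q2 : ‖(2 * (α : ℂ) ^ 2) • mulL R.bτ (mulL R.bθ (R.ψ₀ α n c G))‖ ≤ 2 * (K * (K * X)) := by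
      refine norm_smul_le_of_le ?_ (norm_mulL_le_of_le nτ eθ)
      rw [norm_mul, Complex.norm_two]
      linarith
    refine (norm_sub_le_of_le₂ (norm_sub_le_of_le₂ q1 q2) le_rfl).trans ?_
    have t2 : K * (K * X) ≤ K ^ 4 * S := by
      have := mono (a := 2) (b := 4) (by norm_num)
      rw [← mul_assoc, ← sq]; gcongr
    have t3 : ‖(Complex.I * (α : ℂ)) • a₀ + b₁‖ ≤ K ^ 4 * S :=
      le_trans (by linarith) (le_mul_of_one_le_left hS0 (one_le_pow₀ hK1))
    linarith
  have k1 : K ≤ K ^ 6 := le_self_pow₀ hK1 (by norm_num)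
  have k0 : (1 : ℝ) ≤ K ^ 6 := one_le_pow₀ hK1
  have f1 : K * X ≤ K ^ 6 * S := by gcongr
  have f2 : K ^ 3 * S ≤ K ^ 6 * S := mul_le_mul_of_nonneg_right (mono (by norm_num)) hS0
  have f3 : K ^ 4 * S ≤ K ^ 6 * S := mul_le_mul_of_nonneg_right (mono (by norm_num)) hS0
  have f4 : K ^ 5 * S ≤ K ^ 6 * S := mul_le_mul_of_nonneg_right (mono (by norm_num)) hS0
  have f5 : K ^ 6 * S ≤ K ^ 6 * W := by gcongr
  have f6 : 0 ≤ K ^ 6 * S := by positivity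
  refine ⟨by linarith, by linarith, by linarith, by linarith, by linarith, by linarith, ?_, ?_, ?_⟩
  · refine (norm_sub_le_of_le₂ e1 (norm_smul_le_of_le hm2 (norm_mulL_le_of_le nz p0))).trans ?_
    linarith
  · refine (norm_sub_le_of_le₂ e2 (norm_smul_le_of_le hm2 (norm_add_le_of_le (norm_mulL_le_of_le nτ
      (norm_mulL_le_of_le nθ p0)) (norm_mulL_le_of_le nz p1)))).trans ?_
    linarith
  · refine (norm_add_le_of_le e3 (norm_smul_le_of_le hm2 (norm_sub_le_of_le₂ (norm_sub_le_of_le₂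
      (norm_mulL_le_of_le nθ (norm_mulL_le_of_le nθ p0))
      (norm_smul_le_of_le Complex.norm_two.le (norm_mulL_le_of_le nτ (norm_mulL_le_of_le nθ p1))))
      (norm_mulL_le_of_le nz p2)))).trans ?_
    have f7 : K * (√n / √c.im * ‖G‖) ≤ K ^ 6 * W := by
      have : √n / √c.im * ‖G‖ ≤ W := by linarith
      gcongr
    linarith

end ReducedProfile

/-! ### Elements of Sobolev spaces from their derivatives -/

/-- The element of `H²(ℝ₊)` with derivatives `f₀`, `f₁`, `f₂`, if there is one. -/
def toSobolev₂ (f₀ f₁ f₂ : L2) : SobolevH 2 :=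
  (sobolevSubmodule 2).orthogonalProjectionOnto (WithLp.toLp 2 ![f₀, f₁, f₂])

theorem toSobolev₂_mem {f₀ f₁ f₂ : L2} (h₁ : IsWeakDeriv f₀ f₁) (h₂ : IsWeakDeriv f₁ f₂) :
    (WithLp.toLp 2 ![f₀, f₁, f₂] : PiLp 2 fun _ : Fin 3 => L2) ∈ sobolevSubmodule 2 := by
  intro j
  fin_cases j
  · exact h₁
  · exact h₂

/-- On genuine triples of derivatives the projection is the identity. Defining the map by a
projection makes it bounded and linear on all triples, so it preserves analyticity in c. -/
theorem coe_toSobolev₂ {f₀ f₁ f₂ : L2} (h₁ : IsWeakDeriv f₀ f₁) (h₂ : IsWeakDeriv f₁ f₂) :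
    (toSobolev₂ f₀ f₁ f₂ : PiLp 2 fun _ : Fin 3 => L2) 0 = f₀ := by
  have h := (sobolevSubmodule 2).orthogonalProjectionOnto_mem_subspace_eq_self
    ⟨_, toSobolev₂_mem h₁ h₂⟩
  rw [toSobolev₂, h]
  rfl

theorem sobolevNorm_two_le {f : ℝ → ℂ} {f₀ f₁ f₂ : L2} (h₁ : IsWeakDeriv f₀ f₁)
    (h₂ : IsWeakDeriv f₁ f₂) (hf : f₀ =ᵐ[halfLine] f) {B : ℝ} (b₀ : ‖f₀‖ ≤ B) (b₁ : ‖f₁‖ ≤ B)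
    (b₂ : ‖f₂‖ ≤ B) : sobolevNorm 2 f ≤ ENNReal.ofReal (3 * B) := by
  refine (iInf₂_le (⟨_, toSobolev₂_mem h₁ h₂⟩ : SobolevH 2) hf).trans ?_
  rw [← ofReal_norm]
  apply ENNReal.ofReal_le_ofReal
  have hB : 0 ≤ B := (norm_nonneg _).trans b₀
  rw [Submodule.coe_norm, PiLp.norm_eq_of_L2, Fin.sum_univ_three]
  apply Real.sqrt_le_iff.2 ⟨by positivity, ?_⟩
  change ‖f₀‖ ^ 2 + ‖f₁‖ ^ 2 + ‖f₂‖ ^ 2 ≤ _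
  have c0 := pow_le_pow_left₀ (norm_nonneg _) b₀ 2
  have c1 := pow_le_pow_left₀ (norm_nonneg _) b₁ 2
  have c2 := pow_le_pow_left₀ (norm_nonneg _) b₂ 2
  nlinarith

theorem sobolevNorm_one_le {f : ℝ → ℂ} {f₀ f₁ : L2} (h₁ : IsWeakDeriv f₀ f₁)
    (hf : f₀ =ᵐ[halfLine] f) {B : ℝ} (b₀ : ‖f₀‖ ≤ B) (b₁ : ‖f₁‖ ≤ B) :
    sobolevNorm 1 f ≤ ENNReal.ofReal (2 * B) := by
  have hmem : (WithLp.toLp 2 ![f₀, f₁] : PiLp 2 fun _ : Fin 2 => L2) ∈ sobolevSubmodule 1 := by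
    intro j
    fin_cases j
    exact h₁
  refine (iInf₂_le (⟨_, hmem⟩ : SobolevH 1) hf).trans ?_
  rw [← ofReal_norm]
  apply ENNReal.ofReal_le_ofReal
  have hB : 0 ≤ B := (norm_nonneg _).trans b₀
  rw [Submodule.coe_norm, PiLp.norm_eq_of_L2, Fin.sum_univ_two]
  apply Real.sqrt_le_iff.2 ⟨by positivity, ?_⟩
  change ‖f₀‖ ^ 2 + ‖f₁‖ ^ 2 ≤ _
  have c0 := pow_le_pow_left₀ (norm_nonneg _) b₀ 2
  have c1 := pow_le_pow_left₀ (norm_nonneg _) b₁ 2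
  nlinarith

theorem l2Norm_eq {f : ℝ → ℂ} {g : L2} (h : f =ᵐ[halfLine] g) : l2Norm f = ENNReal.ofReal ‖g‖ := by
  rw [l2Norm, eLpNorm_congr_ae h, ofReal_norm, Lp.enorm_def]

theorem weakDeriv_ae_of_ae {f f' g : ℝ → ℂ} (hf : f =ᵐ[halfLine] f') (h : IsWeakDeriv f' g) :
    weakDeriv f =ᵐ[halfLine] g :=
  (h.congr hf.symm .rfl).weakDeriv_eq

theorem laplacian_ae {f f' g k : ℝ → ℂ} (α : ℝ) (hf : f =ᵐ[halfLine] f') (h : IsWeakDeriv f' g)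
    (h' : IsWeakDeriv g k) :
    laplacian α f =ᵐ[halfLine] fun Y => k Y - (α : ℂ) ^ 2 * f' Y := by
  filter_upwards [weakDeriv_ae_of_ae (weakDeriv_ae_of_ae hf h) h', hf] with Y h1 h2
  rw [laplacian, h1, h2]

theorem divergence_ae {u v w : ℝ → ℂ} (α : ℝ) (h : IsWeakDeriv v w) :
    divergence α u v =ᵐ[halfLine] fun Y => Complex.I * α * u Y + w Y := by
  filter_upwards [h.weakDeriv_eq] with Y h1
  rw [divergence, h1]

theorem IsWeakDeriv.smul_L2 {f g : L2} (h : IsWeakDeriv f g) (z : ℂ) :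
    IsWeakDeriv (z • f : L2) (z • g : L2) :=
  (h.const_mul z).congr (rep_smul z .rfl).symm (rep_smul z .rfl).symm

theorem IsWeakDeriv.sub_L2 {f g f' g' : L2} (h : IsWeakDeriv f g) (h' : IsWeakDeriv f' g') :
    IsWeakDeriv (f - f' : L2) (g - g' : L2) :=
  (h.sub h').congr (rep_sub .rfl .rfl).symm (rep_sub .rfl .rfl).symm

namespace ReducedProfile

variable {m : ℝ} (R : ReducedProfile m)

/-! ### The relation to the boundary layer profile -/

/-- `R` consists of the functions `U`, `τ`, `θ` associated with the profile `U`. -/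
def Represents (U : ℝ → ℝ) : Prop :=
  ∀ Y, 0 < Y → R.U Y = U Y ∧ dProfile 1 U Y = R.τ Y * R.θ Y ∧ dProfile 2 U Y = -R.θ Y ^ 2

variable {R} {U : ℝ → ℝ} {α : ℝ} {c : ℂ}

theorem ae_halfLine_pos : ∀ᵐ Y ∂halfLine, 0 < Y := ae_restrict_mem measurableSet_Ioi

theorem bθ_ne (Y : ℝ) : R.bθ Y ≠ 0 := by
  rw [bθ_apply]
  exact_mod_cast (R.θ_pos Y).ne'

theorem Represents.sub_eq (hR : R.Represents U) (c : ℂ) {Y : ℝ} (hY : 0 < Y) :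
    (U Y : ℂ) - c = R.cz c Y := by
  rw [← (hR Y hY).1, cz_apply]

theorem Represents.coeffA_eq (hR : R.Represents U) (c : ℂ) {Y : ℝ} (hY : 0 < Y) :
    coeffA m U c Y = R.cA c Y := by
  rw [coeffA, hR.sub_eq c hY, cA_eq]

theorem Represents.inv_coeffA (hR : R.Represents U) (hc : c ∈ R.adm) {Y : ℝ} (hY : 0 < Y) :
    (coeffA m U c Y)⁻¹ = R.ca c Y := by
  rw [hR.coeffA_eq c hY, R.ca_apply hc]

theorem Represents.dProfile_one (hR : R.Represents U) {Y : ℝ} (hY : 0 < Y) :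
    (dProfile 1 U Y : ℂ) = R.bτ Y * R.bθ Y := by
  rw [(hR Y hY).2.1]
  simp

theorem Represents.weighted_eq (hR : R.Represents U) (f : ℝ → ℂ) {Y : ℝ} (hY : 0 < Y) :
    weighted U f Y = (R.bθ Y)⁻¹ * f Y := by
  have hθ := R.θ_pos Y
  rw [weighted, (hR Y hY).2.2, abs_neg, abs_of_nonneg (by positivity), ← Real.rpow_natCast,
    ← Real.rpow_mul hθ.le]
  norm_num
  rw [Real.rpow_neg_one]
  simp

theorem Represents.omegaOp_ae (hR : R.Represents U) (hc : c ∈ R.adm) {a₀ a₁ : L2}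
    (ha : IsWeakDeriv a₀ a₁) (b₀ : ℝ → ℂ) :
    omegaOp m U α c a₀ b₀ =ᵐ[halfLine] fun Y => b₀ Y - (Complex.I * α)⁻¹ *
      (-R.cdA c Y * R.ca c Y ^ 2 * a₀ Y + R.ca c Y * a₁ Y) := by
  have h := weakDeriv_ae_of_ae (f := fun Z => (coeffA m U c Z)⁻¹ * a₀ Z)
    (ae_halfLine_pos.mono fun Y hY => by
      show (coeffA m U c Y)⁻¹ * a₀ Y = _
      rw [hR.inv_coeffA hc hY]) (isWeakDeriv_ca_mul hc ha)
  filter_upwards [h] with Y hY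
  rw [omegaOp, hY]

/-- E collects the two contributions U'' = -θ² and (U')² = τ²θ² over the common factor -θ²A⁻². -/
theorem Represents.weakDeriv_inv_coeffA_mul_ae (hR : R.Represents U) (hc : c ∈ R.adm) :
    weakDeriv (fun Z => (coeffA m U c Z)⁻¹ * dProfile 1 U Z) =ᵐ[halfLine]
      fun Y => -(R.bθ Y ^ 2 * R.cE c Y * R.ca c Y ^ 2) := by
  refine weakDeriv_ae_of_ae (f' := fun Y => R.ca c Y * (R.bτ Y * R.bθ Y)) ?_
    (isWeakDeriv_of_hasDerivAt (fun Y hY => ?_) ?_)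
  · filter_upwards [ae_halfLine_pos] with Y hY
    rw [hR.inv_coeffA hc hY, hR.dProfile_one hY]
  · refine ((R.hasDerivAt_ca hc hY).mul (hasDerivAt_τθ (R := R) hY)).congr_deriv ?_
    have hA := R.cA_mul_ca hc Y
    rw [cE_eq, cdA_apply]
    linear_combination (-R.bθ Y ^ 2 * R.ca c Y) * (-hA)
  · fun_prop

/-! ### The compressible Orr-Sommerfeld equation -/

section equations

variable {G : L2} {r M k H γ ε : ℝ}

theorem lambdaOp_ae (hR : R.Represents U) (h : Admissible R r M k H γ α (nParam α ε) c) :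
    lambdaOp m U α c (R.ψ₀ α (nParam α ε) c G) =ᵐ[halfLine]
      fun Y => R.bθ Y * R.f₀ α (nParam α ε) c G Y := by
  have h1 := weakDeriv_ae_of_ae (f := fun Z => (coeffA m U c Z)⁻¹ *
    weakDeriv (R.ψ₀ α (nParam α ε) c G) Z) (by
      filter_upwards [ae_halfLine_pos, (isWeakDeriv_ψ₀ (R := R) (α := α) (n := nParam α ε) (c := c)
        G).weakDeriv_eq] with Y hY e
      rw [hR.inv_coeffA h.mem_adm hY, e]) (isWeakDeriv_a_mul_ψ₁ G h)
  filter_upwards [h1] with Y e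
  rw [lambdaOp, e]
  ring

/-- A⁻¹∂_YΔ_αΨ equals the flux plus α²∂_YΨ - α²A⁻¹∂_YΨ. In its derivative minus α²Δ_αΨ the terms
α²∂_Y²Ψ cancel, and -α²Λ(Ψ) = -α²θf remains besides the derivative of the flux. -/
theorem lambdaOp_laplacian_ae (hR : R.Represents U) (h : Admissible R r M k H γ α (nParam α ε) c) :
    lambdaOp m U α c (laplacian α (R.ψ₀ α (nParam α ε) c G)) =ᵐ[halfLine] fun Y =>
      R.flux₁ α (nParam α ε) c G Y - (α : ℂ) ^ 2 * (R.bθ Y * R.f₀ α (nParam α ε) c G Y) := by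
  have h0 := laplacian_ae α .rfl (isWeakDeriv_ψ₀ G) (isWeakDeriv_ψ₁ G h)
  have h1 := weakDeriv_ae_of_ae h0 ((isWeakDeriv_ψ₂ G h).sub
    ((isWeakDeriv_ψ₀ G).const_mul ((α : ℂ) ^ 2)))
  have h2 := weakDeriv_ae_of_ae (f := fun Z => (coeffA m U c Z)⁻¹ *
      weakDeriv (laplacian α (R.ψ₀ α (nParam α ε) c G)) Z) (by
    filter_upwards [ae_halfLine_pos, h1, R.rep_ψ₃ α (nParam α ε) c G] with Y hY e e'
    rw [hR.inv_coeffA h.mem_adm hY, e, e']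
    show _ = R.flux₀ α (nParam α ε) c G Y + (α : ℂ) ^ 2 * R.ψ₁ α (nParam α ε) c G Y
      - (α : ℂ) ^ 2 * (R.ca c Y * R.ψ₁ α (nParam α ε) c G Y)
    linear_combination (R.flux₀ α (nParam α ε) c G Y + (α : ℂ) ^ 2 * R.ψ₁ α (nParam α ε) c G Y)
      * R.cA_mul_ca h.mem_adm Y)
    (((isWeakDeriv_flux₀ G h).add ((isWeakDeriv_ψ₁ G h).const_mul ((α : ℂ) ^ 2))).sub
      ((isWeakDeriv_a_mul_ψ₁ G h).const_mul ((α : ℂ) ^ 2)))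
  filter_upwards [h0, h2] with Y e0 e2
  rw [lambdaOp, e2, e0]
  ring

theorem orrSommerfeld_ae (hR : R.Represents U) (h : Admissible R r M k H γ α (nParam α ε) c) :
    orrSommerfeld m U α ε c (R.ψ₀ α (nParam α ε) c G) =ᵐ[halfLine] fun Y => R.bθ Y * G Y := by
  have hn : (nParam α ε : ℂ) ≠ 0 := by exact_mod_cast h.pos_n.ne'
  filter_upwards [ae_halfLine_pos, lambdaOp_ae (G := G) hR h, lambdaOp_laplacian_ae (G := G) hR h,
    hR.weakDeriv_inv_coeffA_mul_ae h.mem_adm, R.rep_flux₁ α (nParam α ε) c G] with Y hY e1 e2 e3 e4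
  rw [orrSommerfeld, e1, e2, e3, e4, hR.sub_eq c hY]
  have hI : Complex.I / (nParam α ε) * (Complex.I * (nParam α ε)) = -1 := by
    field_simp
    exact Complex.I_sq
  linear_combination (R.cz c Y * R.bθ Y * R.f₀ α (nParam α ε) c G Y
      - Complex.I * (α : ℂ) ^ 2 / (nParam α ε) * (R.bθ Y * R.f₀ α (nParam α ε) c G Y)
      + R.bθ Y ^ 2 * R.cE c Y * R.ca c Y ^ 2 * R.ψ₀ α (nParam α ε) c G Y - R.bθ Y * G Y) * hI

theorem solvesOrrSommerfeld (hR : R.Represents U) (h : Admissible R r M k H γ α (nParam α ε) c)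
    {s₁ s₂ : ℝ → ℂ} (hG : ∀ᵐ Y ∂halfLine, omegaOp m U α c s₁ s₂ Y = R.bθ Y * G Y) :
    SolvesOrrSommerfeld m U α ε c s₁ s₂ (R.ψ₀ α (nParam α ε) c G) := by
  have hΛ := lambdaOp_ae (G := G) hR h
  refine ⟨?_, h10_vanishesAtZero _, ?_, ?_, ?_⟩
  · filter_upwards [orrSommerfeld_ae (G := G) hR h, hG] with Y e1 e2
    rw [e1, e2]
  · obtain ⟨g, g1, g2, g3⟩ := h10_vanishesAtZero (R.sol α (nParam α ε) c G)
    refine ⟨fun Y => R.bθ Y * g Y, R.bθ.continuous.continuousOn.mul g1, ?_, by simp only [g3, mul_zero]⟩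
    filter_upwards [hΛ, g2] with Y e1 e2
    rw [e1, ← e2]
    rfl
  · have : weighted U (lambdaOp m U α c (R.ψ₀ α (nParam α ε) c G)) =ᵐ[halfLine]
        R.f₀ α (nParam α ε) c G := by
      filter_upwards [ae_halfLine_pos, hΛ] with Y hY e1
      rw [hR.weighted_eq _ hY, e1, inv_mul_cancel_left₀ (bθ_ne Y)]
    rw [l2wNorm, l2Norm_eq this]
    exact ENNReal.ofReal_lt_top
  · have h1 := weakDeriv_ae_of_ae hΛ (isWeakDeriv_θ_mul_f₀ G)
    have : weighted U (weakDeriv (lambdaOp m U α c (R.ψ₀ α (nParam α ε) c G))) =ᵐ[halfLine]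
        (R.f₁ α (nParam α ε) c G + mulL R.bκ (R.f₀ α (nParam α ε) c G) : L2) := by
      filter_upwards [ae_halfLine_pos, h1, rep_add (f := R.f₁ α (nParam α ε) c G) .rfl
        (rep_mulL R.bκ (f := R.f₀ α (nParam α ε) c G) .rfl)] with Y hY e1 e2
      rw [hR.weighted_eq _ hY, e1, e2, inv_mul_cancel_left₀ (bθ_ne Y)]
    rw [l2wNorm, l2Norm_eq this]
    exact ENNReal.ofReal_lt_top

/-! ### The quasi-compressible system -/

variable {a₀ a₁ b₀ : L2}

/-- With √ε = α/n, the continuity equation is the definition of the tangential velocity, the first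
momentum equation is the definition of the pressure multiplied by iαA, where A = 1 - m²z², and the
second is the formula for the derivative of the pressure. -/
theorem solvesQuasiCompressible (hm : 0 < m) (hε : 0 < ε) (hR : R.Represents U)
    (h : Admissible R r M k H γ α (nParam α ε) c) (ha : IsWeakDeriv a₀ a₁)
    (hG : ∀ᵐ Y ∂halfLine, R.bθ Y * G Y = b₀ Y - (Complex.I * α)⁻¹ *
      (-R.cdA c Y * R.ca c Y ^ 2 * a₀ Y + R.ca c Y * a₁ Y)) :
    SolvesQuasiCompressible m U α ε c a₀ b₀
      (((m : ℂ) ^ 2) • R.pr₀ α (nParam α ε) c G a₀ : L2) (R.ve₀ α (nParam α ε) c G a₀)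
      ((-Complex.I * α) • R.ψ₀ α (nParam α ε) c G : L2) := by
  have hp := isWeakDeriv_pr₀ h ha hG
  have hm' : (m : ℂ) ≠ 0 := by exact_mod_cast hm.ne'
  have hα : (α : ℂ) ≠ 0 := by exact_mod_cast h.pos_α.ne'
  have hn : (nParam α ε : ℂ) ≠ 0 := by exact_mod_cast h.pos_n.ne'
  have hsε : (√ε : ℂ) = α / nParam α ε := by
    have : √ε = α / nParam α ε := by
      have h1 : √ε ≠ 0 := (Real.sqrt_pos.2 hε).ne'
      have h2 := h.pos_α.ne'
      rw [nParam]
      field_simp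
    rw [this]
    push_cast
    rfl
  have rp := rep_smul ((m : ℂ) ^ 2) (f := R.pr₀ α (nParam α ε) c G a₀) .rfl
  have rv := rep_smul (-Complex.I * α) (f := R.ψ₀ α (nParam α ε) c G) .rfl
  refine ⟨?_, ?_, ?_, ?_⟩
  · filter_upwards [ae_halfLine_pos, rp, R.rep_ve₀ α (nParam α ε) c G a₀,
      divergence_ae (u := R.ve₀ α (nParam α ε) c G a₀) α ((isWeakDeriv_ψ₀ G).smul_L2 (-Complex.I * α)),
      rep_smul (-Complex.I * α) (f := R.ψ₁ α (nParam α ε) c G) .rfl] with Y hY e1 e2 e3 e4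
    rw [hR.sub_eq c hY, e3, e1, e2, e4]
    ring
  · have hL := laplacian_ae (f := fun Z => R.ve₀ α (nParam α ε) c G a₀ Z + (U Z - c) *
        (((m : ℂ) ^ 2) • R.pr₀ α (nParam α ε) c G a₀ : L2) Z) α (by
      filter_upwards [ae_halfLine_pos, rp, R.rep_ve₀ α (nParam α ε) c G a₀] with Y hY e1 e2
      rw [hR.sub_eq c hY, e1, e2]
      show _ = R.ψ₁ α (nParam α ε) c G Y
      ring) (isWeakDeriv_ψ₁ G h) (isWeakDeriv_ψ₂ G h)
    filter_upwards [ae_halfLine_pos, hL, rp, rv, R.rep_ve₀ α (nParam α ε) c G a₀,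
      R.rep_pr₀ α (nParam α ε) c G a₀] with Y hY e1 e2 e3 e4 e5
    rw [e1, e2, e3, e4, hR.sub_eq c hY, hR.dProfile_one hY, hsε]
    have hA := R.cA_mul_ca h.mem_adm Y
    have e6 : R.cA c Y * R.pr₀ α (nParam α ε) c G a₀ Y = -(Complex.I / (nParam α ε) *
        (R.ψ₃ α (nParam α ε) c G Y - (α : ℂ) ^ 2 * R.ψ₁ α (nParam α ε) c G Y)
      + R.cz c Y * R.ψ₁ α (nParam α ε) c G Y - R.bτ Y * (R.bθ Y * R.ψ₀ α (nParam α ε) c G Y)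
      + (Complex.I * α)⁻¹ * a₀ Y) := by
      rw [e5]
      linear_combination (-(Complex.I / (nParam α ε) *
        (R.ψ₃ α (nParam α ε) c G Y - (α : ℂ) ^ 2 * R.ψ₁ α (nParam α ε) c G Y)
      + R.cz c Y * R.ψ₁ α (nParam α ε) c G Y - R.bτ Y * (R.bθ Y * R.ψ₀ α (nParam α ε) c G Y)
      + (Complex.I * α)⁻¹ * a₀ Y)) * hA
    have hI : Complex.I * α * (Complex.I / (nParam α ε)) = -(α / nParam α ε) := by
      linear_combination (α / nParam α ε : ℂ) * Complex.I_sq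
    have hI' : Complex.I * α * (Complex.I * α)⁻¹ = 1 :=
      mul_inv_cancel₀ (mul_ne_zero Complex.I_ne_zero hα)
    have hmm : ((m : ℂ) ^ 2)⁻¹ * (m : ℂ) ^ 2 = 1 := inv_mul_cancel₀ (pow_ne_zero 2 hm')
    rw [cA_eq] at e6
    linear_combination (-(Complex.I * α)) * e6
      - (Complex.I * α * R.pr₀ α (nParam α ε) c G a₀ Y) * hmm
      + (R.ψ₃ α (nParam α ε) c G Y - (α : ℂ) ^ 2 * R.ψ₁ α (nParam α ε) c G Y) * hI
      + a₀ Y * hI'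
  · have hL := laplacian_ae α .rfl ((isWeakDeriv_ψ₀ G).smul_L2 (-Complex.I * α))
      ((isWeakDeriv_ψ₁ G h).smul_L2 (-Complex.I * α))
    filter_upwards [ae_halfLine_pos, hL, rv, rep_smul (-Complex.I * α)
      (f := R.ψ₂ α (nParam α ε) c G) .rfl, (hp.smul_L2 ((m : ℂ) ^ 2)).weakDeriv_eq,
      rep_smul ((m : ℂ) ^ 2) (f := R.pr₁ α (nParam α ε) c G b₀) .rfl,
      R.rep_pr₁ α (nParam α ε) c G b₀] with Y hY e1 e2 e3 e4 e5 e6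
    rw [e1, e2, e3, e4, e5, e6, hR.sub_eq c hY, hsε]
    have hmm : ((m : ℂ) ^ 2)⁻¹ * (m : ℂ) ^ 2 = 1 := inv_mul_cancel₀ (pow_ne_zero 2 hm')
    rw [← mul_assoc (((m : ℂ) ^ 2)⁻¹), hmm]
    linear_combination ((α : ℂ) ^ 2 * R.cz c Y * R.ψ₀ α (nParam α ε) c G Y) * Complex.I_sq
  · obtain ⟨g, g1, g2, g3⟩ := h10_vanishesAtZero (R.opΨ α c (R.sol α (nParam α ε) c G))
    refine ⟨fun Y => -Complex.I * α * g Y, continuousOn_const.mul g1, ?_, by simp only [g3, mul_zero]⟩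
    filter_upwards [rv, g2] with Y e1 e2
    rw [e1, ← e2]
    rfl

theorem isStreamFunction (hm : 0 < m) (hR : R.Represents U)
    (h : Admissible R r M k H γ α (nParam α ε) c) :
    IsStreamFunction m U α ε c a₀
      (((m : ℂ) ^ 2) • R.pr₀ α (nParam α ε) c G a₀ : L2) (R.ve₀ α (nParam α ε) c G a₀)
      ((-Complex.I * α) • R.ψ₀ α (nParam α ε) c G : L2) (R.ψ₀ α (nParam α ε) c G) := by
  have hm' : (m : ℂ) ≠ 0 := by exact_mod_cast hm.ne'
  have h0 := (isWeakDeriv_ψ₀ (R := R) (α := α) (n := nParam α ε) (c := c) G).weakDeriv_eq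
  have rp := rep_smul ((m : ℂ) ^ 2) (f := R.pr₀ α (nParam α ε) c G a₀) .rfl
  have rv := rep_smul (-Complex.I * α) (f := R.ψ₀ α (nParam α ε) c G) .rfl
  refine ⟨?_, ?_, ?_⟩
  · filter_upwards [ae_halfLine_pos, rp, R.rep_ve₀ α (nParam α ε) c G a₀, h0] with Y hY e1 e2 e3
    rw [hR.sub_eq c hY, e1, e2, e3]
    ring
  · filter_upwards [rv] with Y e1
    rw [e1]
  · filter_upwards [ae_halfLine_pos, rp, R.rep_pr₀ α (nParam α ε) c G a₀, h0,
      laplacian_ae α h0 (isWeakDeriv_ψ₁ G h) (isWeakDeriv_ψ₂ G h)] with Y hY e1 e2 e3 e4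
    have hmm : ((m : ℂ) ^ 2)⁻¹ * (m : ℂ) ^ 2 = 1 := inv_mul_cancel₀ (pow_ne_zero 2 hm')
    rw [e1, e4, e3, hR.sub_eq c hY, hR.inv_coeffA h.mem_adm hY, hR.dProfile_one hY, ← mul_assoc,
      hmm, e2]
    ring

end equations

end ReducedProfile

namespace ReducedProfile

variable {m : ℝ} {R : ReducedProfile m} {r M k H γ α n : ℝ} {c : ℂ}

/-! ### Analytic dependence on the spectral parameter -/

section analytic

theorem differentiableAt_mulL {φ : ℂ → ℝ →ᵇ ℂ} (h : DifferentiableAt ℂ φ c) :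
    DifferentiableAt ℂ (fun c => mulL (φ c)) c :=
  mulL.differentiableAt.comp c h

theorem differentiableAt_mulL_apply {φ : ℂ → ℝ →ᵇ ℂ} {f : ℂ → L2} (h : DifferentiableAt ℂ φ c)
    (hf : DifferentiableAt ℂ f c) : DifferentiableAt ℂ (fun c => mulL (φ c) (f c)) c :=
  (differentiableAt_mulL h).clm_apply hf

/-- The form operator depends holomorphically on c through A⁻¹ alone, and inversion is holomorphic
at invertible operators. -/
theorem differentiableAt_opΨ (h : Admissible R r M k H γ α n c) :
    DifferentiableAt ℂ (R.opΨ α) c := by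
  have h1 : DifferentiableAt ℂ (R.opΛ α) c := by
    unfold opΛ
    exact DifferentiableAt.fun_add (𝕜 := ℂ) (F := H10 →L[ℂ] H10) ((differentiableAt_const _).clm_comp ((differentiableAt_mulL
      (differentiableAt_ca h.mem_adm)).clm_comp (differentiableAt_const _)))
      (differentiableAt_const _)
  have h2 := DifferentiableAt.inverse (𝕜 := ℂ) (R := H10 →L[ℂ] H10) (h := R.opΛ α) h1
    (isUnit_opΛ h.bounds h.pos_α h.lt_r)
  unfold opΨ
  exact DifferentiableAt.fun_neg (𝕜 := ℂ) (F := H10 →L[ℂ] H10)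
    (h2.clm_comp (differentiableAt_const _))

theorem differentiableAt_opΨ₂ (h : Admissible R r M k H γ α n c) :
    DifferentiableAt ℂ (R.opΨ₂ α) c := by
  have hΨ := differentiableAt_opΨ h
  unfold opΨ₂
  exact ((differentiableAt_mulL (differentiableAt_cb h.mem_adm)).clm_comp
    ((differentiableAt_const _).clm_comp hΨ)).fun_add
    ((differentiableAt_mulL (R.differentiable_cA c)).clm_comp
      ((((differentiableAt_const _).clm_comp hΨ).fun_const_smul _).fun_add (differentiableAt_const _)))

theorem differentiableAt_opJ (h : Admissible R r M k H γ α n c) :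
    DifferentiableAt ℂ (R.opJ α) c := by
  unfold opJ
  exact (differentiableAt_const _).fun_add (((differentiableAt_const _).fun_sub
    ((differentiableAt_mulL (differentiableAt_cr₂ h.mem_adm)).clm_comp
      (differentiableAt_opΨ₂ h))).fun_sub
    ((differentiableAt_mulL (differentiableAt_cr₁ h.mem_adm)).clm_comp
      ((differentiableAt_const _).clm_comp (differentiableAt_opΨ h))))

theorem differentiableAt_opL (h : Admissible R r M k H γ α n c) :
    DifferentiableAt ℂ (R.opL α n) c := by
  have hp := differentiableAt_mulL (differentiableAt_cp h.mem_adm)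
  have ht := differentiableAt_mulL (differentiableAt_ct h.mem_adm)
  have hz := differentiableAt_mulL ((R.differentiable_cz c).mul (differentiableAt_cp h.mem_adm))
  have hJ := differentiableAt_opJ h
  have hΨ := differentiableAt_opΨ h
  have smul : ∀ {T : ℂ → H10 →L[ℂ] L2}, DifferentiableAt ℂ T c → ∀ z : ℂ,
      DifferentiableAt ℂ (fun c => z • T c) c := fun hT z =>
    DifferentiableAt.fun_const_smul (𝕜 := ℂ) (F := H10 →L[ℂ] L2) hT z
  have hpJ := smul (hp.clm_comp hJ) (-(Complex.I / n))
  unfold opL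
  exact DifferentiableAt.fun_add (𝕜 := ℂ) (F := H10 →L[ℂ] H10)
    ((differentiableAt_const _).clm_comp hpJ)
    ((differentiableAt_const _).clm_comp (((((ht.clm_comp hJ).fun_const_smul _).fun_add
      (hz.clm_comp (differentiableAt_const _))).fun_add
      ((hp.clm_comp (differentiableAt_const _)).fun_const_smul _)).fun_add
      ((differentiableAt_const _).clm_comp ((differentiableAt_const _).clm_comp hΨ))))

theorem differentiableAt_sol (h : Admissible R r M k H γ α n c) :
    DifferentiableAt ℂ (R.sol α n) c := by
  have h2 := DifferentiableAt.inverse (𝕜 := ℂ) (R := H10 →L[ℂ] H10) (h := R.opL α n)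
    (differentiableAt_opL h) (isUnit_opL h)
  unfold sol
  exact h2.clm_comp ((differentiableAt_const _).clm_comp
    (differentiableAt_mulL (differentiableAt_cp h.mem_adm)))

variable {G a₀ b₀ b₁ : ℂ → L2}

theorem differentiableAt_sol_apply (h : Admissible R r M k H γ α n c)
    (hG : DifferentiableAt ℂ G c) : DifferentiableAt ℂ (fun c => R.sol α n c (G c)) c :=
  (differentiableAt_sol h).clm_apply hG

theorem differentiableAt_ψ₀ (h : Admissible R r M k H γ α n c) (hG : DifferentiableAt ℂ G c) :
    DifferentiableAt ℂ (fun c => R.ψ₀ α n c (G c)) c :=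
  valL.differentiableAt.comp c
    ((differentiableAt_opΨ h).clm_apply (differentiableAt_sol_apply h hG))

theorem differentiableAt_ψ₁ (h : Admissible R r M k H γ α n c) (hG : DifferentiableAt ℂ G c) :
    DifferentiableAt ℂ (fun c => R.ψ₁ α n c (G c)) c :=
  derL.differentiableAt.comp c
    ((differentiableAt_opΨ h).clm_apply (differentiableAt_sol_apply h hG))

theorem differentiableAt_ψ₂ (h : Admissible R r M k H γ α n c) (hG : DifferentiableAt ℂ G c) :
    DifferentiableAt ℂ (fun c => R.ψ₂ α n c (G c)) c :=
  (differentiableAt_opΨ₂ h).clm_apply (differentiableAt_sol_apply h hG)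

theorem differentiableAt_ψ₃ (h : Admissible R r M k H γ α n c) (hG : DifferentiableAt ℂ G c) :
    DifferentiableAt ℂ (fun c => R.ψ₃ α n c (G c)) c := by
  unfold ψ₃ flux₀
  exact differentiableAt_mulL_apply (R.differentiable_cA c)
    ((differentiableAt_mulL_apply (differentiableAt_const _)
      ((differentiableAt_opJ h).clm_apply (differentiableAt_sol_apply h hG))).fun_add
      ((differentiableAt_ψ₁ h hG).fun_const_smul _))

theorem differentiableAt_pr₀ (h : Admissible R r M k H γ α n c) (hG : DifferentiableAt ℂ G c)
    (ha : DifferentiableAt ℂ a₀ c) : DifferentiableAt ℂ (fun c => R.pr₀ α n c (G c) (a₀ c)) c := by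
  unfold pr₀
  exact (differentiableAt_mulL_apply (differentiableAt_ca h.mem_adm)
    ((((((differentiableAt_ψ₃ h hG).fun_sub ((differentiableAt_ψ₁ h hG).fun_const_smul _)).fun_const_smul _).fun_add
      (differentiableAt_mulL_apply (R.differentiable_cz c) (differentiableAt_ψ₁ h hG))).fun_sub
      (differentiableAt_mulL_apply (differentiableAt_const _)
        (differentiableAt_mulL_apply (differentiableAt_const _) (differentiableAt_ψ₀ h hG)))).fun_add
      (ha.fun_const_smul _))).fun_neg

theorem differentiableAt_pr₁ (h : Admissible R r M k H γ α n c) (hG : DifferentiableAt ℂ G c)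
    (hb : DifferentiableAt ℂ b₀ c) : DifferentiableAt ℂ (fun c => R.pr₁ α n c (G c) (b₀ c)) c := by
  unfold pr₁
  exact ((((differentiableAt_ψ₂ h hG).fun_sub ((differentiableAt_ψ₀ h hG).fun_const_smul _)).fun_const_smul _).fun_sub
    ((differentiableAt_mulL_apply (R.differentiable_cz c)
      (differentiableAt_ψ₀ h hG)).fun_const_smul _)).fun_sub hb

theorem differentiableAt_pr₂ (h : Admissible R r M k H γ α n c) (hG : DifferentiableAt ℂ G c)
    (ha : DifferentiableAt ℂ a₀ c) (hb : DifferentiableAt ℂ b₁ c) :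
    DifferentiableAt ℂ (fun c => R.pr₂ α n c (G c) (a₀ c) (b₁ c)) c := by
  unfold pr₂
  exact (((differentiableAt_mulL_apply (R.differentiable_cA c)
    (differentiableAt_pr₀ h hG ha)).fun_const_smul _).fun_sub
    ((differentiableAt_mulL_apply (differentiableAt_const _)
      (differentiableAt_mulL_apply (differentiableAt_const _)
        (differentiableAt_ψ₀ h hG))).fun_const_smul _)).fun_sub ((ha.fun_const_smul _).fun_add hb)

theorem differentiableAt_ve₀ (h : Admissible R r M k H γ α n c) (hG : DifferentiableAt ℂ G c)
    (ha : DifferentiableAt ℂ a₀ c) : DifferentiableAt ℂ (fun c => R.ve₀ α n c (G c) (a₀ c)) c := by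
  unfold ve₀
  exact (differentiableAt_ψ₁ h hG).fun_sub ((differentiableAt_mulL_apply (R.differentiable_cz c)
    (differentiableAt_pr₀ h hG ha)).fun_const_smul _)

theorem differentiableAt_ve₁ (h : Admissible R r M k H γ α n c) (hG : DifferentiableAt ℂ G c)
    (ha : DifferentiableAt ℂ a₀ c) (hb : DifferentiableAt ℂ b₀ c) :
    DifferentiableAt ℂ (fun c => R.ve₁ α n c (G c) (a₀ c) (b₀ c)) c := by
  unfold ve₁
  exact (differentiableAt_ψ₂ h hG).fun_sub (((differentiableAt_mulL_apply (differentiableAt_const _)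
    (differentiableAt_mulL_apply (differentiableAt_const _) (differentiableAt_pr₀ h hG ha))).fun_add
    (differentiableAt_mulL_apply (R.differentiable_cz c)
      (differentiableAt_pr₁ h hG hb))).fun_const_smul _)

theorem differentiableAt_ve₂ (h : Admissible R r M k H γ α n c) (hG : DifferentiableAt ℂ G c)
    (ha : DifferentiableAt ℂ a₀ c) (hb : DifferentiableAt ℂ b₀ c) (hb' : DifferentiableAt ℂ b₁ c) :
    DifferentiableAt ℂ (fun c => R.ve₂ α n c (G c) (a₀ c) (b₀ c) (b₁ c)) c := by
  unfold ve₂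
  exact (differentiableAt_ψ₃ h hG).fun_add ((((differentiableAt_mulL_apply (differentiableAt_const _)
    (differentiableAt_mulL_apply (differentiableAt_const _) (differentiableAt_pr₀ h hG ha))).fun_sub
    ((differentiableAt_mulL_apply (differentiableAt_const _) (differentiableAt_mulL_apply
      (differentiableAt_const _) (differentiableAt_pr₁ h hG hb))).fun_const_smul _)).fun_sub
    (differentiableAt_mulL_apply (R.differentiable_cz c)
      (differentiableAt_pr₂ h hG ha hb'))).fun_const_smul _)

theorem differentiableAt_toSobolev₂ {f₀ f₁ f₂ : ℂ → L2} (h₀ : DifferentiableAt ℂ f₀ c)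
    (h₁ : DifferentiableAt ℂ f₁ c) (h₂ : DifferentiableAt ℂ f₂ c) :
    DifferentiableAt ℂ (fun c => toSobolev₂ (f₀ c) (f₁ c) (f₂ c)) c := by
  have hp : DifferentiableAt ℂ (fun c => ![f₀ c, f₁ c, f₂ c]) c := by
    rw [differentiableAt_pi]
    intro j
    fin_cases j
    · exact h₀
    · exact h₁
    · exact h₂
  exact ((sobolevSubmodule 2).orthogonalProjectionOnto.comp
    (PiLp.continuousLinearEquiv 2 ℂ (fun _ : Fin 3 => L2)).symm.toContinuousLinearMap).differentiableAt.comp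
    c hp

end analytic

/-! ### The solution -/

open Classical in
/-- The function `|∂_Y² U|^{-1/2} f` as an element of `L²(ℝ₊)`, if it is one. -/
def weightedL2 (U : ℝ → ℝ) (f : ℝ → ℂ) : L2 :=
  if h : MemLp (weighted U f) 2 halfLine then h.toLp _ else 0

theorem weightedL2_eq {U : ℝ → ℝ} {f : ℝ → ℂ} {g : L2} (h : g =ᵐ[halfLine] weighted U f) :
    weightedL2 U f = g := by
  have hm : MemLp (weighted U f) 2 halfLine := (memLp_congr_ae h).1 (Lp.memLp g)
  rw [weightedL2, dif_pos hm]
  exact Lp.ext (hm.coeFn_toLp.trans h.symm)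

/-- A finite weighted norm does not include measurability. That is supplied by the L² representative
of f and the continuity of θ⁻¹. -/
theorem Represents.weightedL2_ae {U : ℝ → ℝ} (hR : R.Represents U) {f : ℝ → ℂ} {g : L2}
    (hf : f =ᵐ[halfLine] g) (h : l2wNorm U f < ⊤) : weightedL2 U f =ᵐ[halfLine] weighted U f := by
  have hm : MemLp (weighted U f) 2 halfLine := by
    refine ⟨?_, h⟩
    have h1 : AEStronglyMeasurable (fun Y => (R.bθ Y)⁻¹ * g Y) halfLine :=
      (R.bθ.continuous.inv₀ bθ_ne).aestronglyMeasurable.mul (Lp.aestronglyMeasurable g)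
    refine h1.congr ?_
    filter_upwards [ae_halfLine_pos, hf] with Y hY e
    rw [hR.weighted_eq _ hY, e]
  rw [weightedL2, dif_pos hm]
  exact hm.coeFn_toLp

variable (R α n c)

section solution

variable (G : L2) (s₁ s₂ : SobolevH 1)

/-- The density. -/
def densityH : SobolevH 2 :=
  toSobolev₂ (((m : ℂ) ^ 2) • R.pr₀ α n c G (s₁.1 0)) (((m : ℂ) ^ 2) • R.pr₁ α n c G (s₂.1 0))
    (((m : ℂ) ^ 2) • R.pr₂ α n c G (s₁.1 0) (s₂.1 1))

/-- The tangential velocity. -/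
def tangentialH : SobolevH 2 :=
  toSobolev₂ (R.ve₀ α n c G (s₁.1 0)) (R.ve₁ α n c G (s₁.1 0) (s₂.1 0))
    (R.ve₂ α n c G (s₁.1 0) (s₂.1 0) (s₂.1 1))

/-- The normal velocity. -/
def normalH : SobolevH 2 :=
  toSobolev₂ ((-Complex.I * α) • R.ψ₀ α n c G) ((-Complex.I * α) • R.ψ₁ α n c G)
    ((-Complex.I * α) • R.ψ₂ α n c G)

end solution

variable {R α n c} {U : ℝ → ℝ} {ε : ℝ}

/-- On an open set of ℂ, complex differentiability already gives analyticity, so pointwise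
differentiability of the building blocks suffices. -/
theorem analyticOnNhd_fields {D : Set ℂ} (hD : IsOpen D)
    (h : ∀ c ∈ D, Admissible R r M k H γ α n c) {G : ℂ → L2} {s₁ s₂ : ℂ → SobolevH 1}
    (hG : AnalyticOnNhd ℂ G D) (hs₁ : AnalyticOnNhd ℂ s₁ D) (hs₂ : AnalyticOnNhd ℂ s₂ D) :
    AnalyticOnNhd ℂ (fun c => R.densityH α n c (G c) (s₁ c) (s₂ c)) D ∧
    AnalyticOnNhd ℂ (fun c => R.tangentialH α n c (G c) (s₁ c) (s₂ c)) D ∧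
    AnalyticOnNhd ℂ (fun c => R.normalH α n c (G c)) D := by
  have comp : ∀ {s : ℂ → SobolevH 1}, AnalyticOnNhd ℂ s D → ∀ j : Fin 2, ∀ c ∈ D,
      DifferentiableAt ℂ (fun c => ((s c).1 j : L2)) c := fun hs j c hc =>
    ((PiLp.proj 2 (fun _ : Fin 2 => L2) j).comp
      (sobolevSubmodule 1).subtypeL).differentiableAt.comp c (hs c hc).differentiableAt
  simp only [Complex.analyticOnNhd_iff_differentiableOn hD]
  refine ⟨fun c hc => DifferentiableAt.differentiableWithinAt ?_,
    fun c hc => DifferentiableAt.differentiableWithinAt ?_,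
    fun c hc => DifferentiableAt.differentiableWithinAt ?_⟩
  all_goals
    have hc' := h c hc
    have g := (hG c hc).differentiableAt
    have a₀ := comp hs₁ 0 c hc
    have b₀ := comp hs₂ 0 c hc
    have b₁ := comp hs₂ 1 c hc
  · exact differentiableAt_toSobolev₂ ((differentiableAt_pr₀ hc' g a₀).fun_const_smul _)
      ((differentiableAt_pr₁ hc' g b₀).fun_const_smul _) ((differentiableAt_pr₂ hc' g a₀ b₁).fun_const_smul _)
  · exact differentiableAt_toSobolev₂ (differentiableAt_ve₀ hc' g a₀)
      (differentiableAt_ve₁ hc' g a₀ b₀) (differentiableAt_ve₂ hc' g a₀ b₀ b₁)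
  · exact differentiableAt_toSobolev₂ ((differentiableAt_ψ₀ hc' g).fun_const_smul _)
      ((differentiableAt_ψ₁ hc' g).fun_const_smul _) ((differentiableAt_ψ₂ hc' g).fun_const_smul _)

end ReducedProfile

/-! ### Assembly of the solution and its bounds -/

namespace ReducedProfile

variable {m : ℝ} {R : ReducedProfile m} {r M k H γ α ε : ℝ} {c : ℂ} {U : ℝ → ℝ}

theorem admissible_of_mem_sigmaQ (hB : R.CoefBounds r M k) (hH : R.IsHardy H) (hγ : 0 < γ)
    (hγ₁ : γ ≤ 1) (hγr : γ ≤ r) (hs : γ * const₄ M k H ≤ k / 2) (hα : 0 < α) (hα₁ : α < 1)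
    (hε : 0 < ε) (hc : c ∈ sigmaQ γ α ε) : Admissible R r M k H γ α (nParam α ε) c := by
  obtain ⟨h1, h2⟩ := hc
  rw [max_lt_iff, inv_mul_lt_iff₀ hγ, inv_mul_lt_iff₀ hγ] at h1
  refine ⟨hB, hH, hs, hγ, hγ₁, hα, hα₁, div_pos hα (Real.sqrt_pos.2 hε), h2.trans_le hγr, h2.le,
    h1.1.le, ?_, ?_⟩
  · exact pos_of_mul_pos_right ((sq_nonneg _).trans_lt h1.1) hγ.le
  · rw [one_div]
    exact h1.2.le

theorem Represents.omegaOp_L2 (hR : R.Represents U) (hc : c ∈ R.adm) (s₁ s₂ : SobolevH 1) :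
    ∃ g : L2, omegaOp m U α c s₁ s₂ =ᵐ[halfLine] g := by
  have ha : IsWeakDeriv (s₁.1 0) (s₁.1 1) := s₁.2 0
  have h1 := hR.omegaOp_ae (α := α) hc ha (s₂.1 0)
  have h2 := rep_mulL (R.cdA c * R.ca c ^ 2) (f := s₁.1 0) .rfl
  have h3 := rep_mulL (R.ca c) (f := s₁.1 1) .rfl
  have h4 := rep_sub (f := s₂.1 0) .rfl (rep_smul (Complex.I * α)⁻¹ (rep_sub h3 h2))
  refine ⟨_, h1.trans (.trans (.of_forall fun Y => ?_) h4.symm)⟩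
  show _ = s₂.1 0 Y - (Complex.I * α)⁻¹ *
    (R.ca c Y * s₁.1 1 Y - R.cdA c Y * R.ca c Y ^ 2 * s₁.1 0 Y)
  ring

theorem exists_orrSommerfeld_solution (hR : R.Represents U)
    (h : Admissible R r M k H γ α (nParam α ε) c) (G : L2) {s₁ s₂ : ℝ → ℂ}
    (hG : ∀ᵐ Y ∂halfLine, omegaOp m U α c s₁ s₂ Y = R.bθ Y * G Y) :
    ∃ Ψ : SobolevH 4, Ψ.1 0 = R.ψ₀ α (nParam α ε) c G ∧
      SolvesOrrSommerfeld m U α ε c s₁ s₂ Ψ := by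
  refine ⟨⟨WithLp.toLp 2 ![R.ψ₀ α (nParam α ε) c G, R.ψ₁ α (nParam α ε) c G,
    R.ψ₂ α (nParam α ε) c G, R.ψ₃ α (nParam α ε) c G, R.ψ₄ α (nParam α ε) c G], ?_⟩, rfl, ?_⟩
  · intro j
    fin_cases j
    · exact isWeakDeriv_ψ₀ G
    · exact isWeakDeriv_ψ₁ G h
    · exact isWeakDeriv_ψ₂ G h
    · exact isWeakDeriv_ψ₃ G h
  · exact solvesOrrSommerfeld hR h hG

theorem divergence_fields_ae (G a₀ : L2) :
    ((Complex.I * α) • (R.ve₀ α (nParam α ε) c G a₀ - R.ψ₁ α (nParam α ε) c G) : L2) =ᵐ[halfLine]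
      divergence α (R.ve₀ α (nParam α ε) c G a₀)
        ((-Complex.I * α) • R.ψ₀ α (nParam α ε) c G : L2) := by
  filter_upwards [divergence_ae (u := R.ve₀ α (nParam α ε) c G a₀) α
      ((isWeakDeriv_ψ₀ G).smul_L2 (-Complex.I * α)),
    rep_smul (-Complex.I * α) (f := R.ψ₁ α (nParam α ε) c G) .rfl,
    rep_smul (Complex.I * α) (f := R.ve₀ α (nParam α ε) c G a₀ - R.ψ₁ α (nParam α ε) c G)
      (rep_sub .rfl .rfl)] with Y e1 e2 e3
  rw [e1, e2, e3]
  ring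

theorem solvability (hm : 0 < m) (hε : 0 < ε) (hR : R.Represents U) {K : ℝ} (hK : 1 ≤ K)
    (h : Admissible R r M k H γ α (nParam α ε) c)
    (hB : ∀ G a₀ b₀ b₁ : L2, ∀ X S W : ℝ, X = 1 / c.im * ‖G‖ →
      S = X + 1 / α * ‖a₀‖ + ‖b₀‖ + ‖(Complex.I * (α : ℂ)) • a₀ + b₁‖ →
      W = √(nParam α ε) / √c.im * ‖G‖ + 1 / α * ‖a₀‖ + ‖b₀‖ +
        ‖(Complex.I * (α : ℂ)) • a₀ + b₁‖ →
      α * ‖R.ψ₀ α (nParam α ε) c G‖ ≤ K * S ∧ ‖R.ψ₁ α (nParam α ε) c G‖ ≤ K * S ∧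
      ‖R.ψ₂ α (nParam α ε) c G‖ ≤ K * S ∧ ‖R.pr₀ α (nParam α ε) c G a₀‖ ≤ K * S ∧
      ‖R.pr₁ α (nParam α ε) c G b₀‖ ≤ K * S ∧ ‖R.pr₂ α (nParam α ε) c G a₀ b₁‖ ≤ K * S ∧
      ‖R.ve₀ α (nParam α ε) c G a₀‖ ≤ K * S ∧ ‖R.ve₁ α (nParam α ε) c G a₀ b₀‖ ≤ K * S ∧
      ‖R.ve₂ α (nParam α ε) c G a₀ b₀ b₁‖ ≤ K * W)
    {s₁ s₂ : SobolevH 1} {G : L2} (hG : G =ᵐ[halfLine] weighted U (omegaOp m U α c s₁ s₂))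
    {ϱ u v : SobolevH 2} (hϱ : ϱ = R.densityH α (nParam α ε) c G s₁ s₂)
    (hu : u = R.tangentialH α (nParam α ε) c G s₁ s₂) (hv : v = R.normalH α (nParam α ε) c G) :
    SolvesQuasiCompressible m U α ε c s₁ s₂ ϱ u v ∧
    (∃ Ψ : SobolevH 4, SolvesOrrSommerfeld m U α ε c s₁ s₂ Ψ ∧
      IsStreamFunction m U α ε c s₁ ϱ u v Ψ) ∧
    sobolevNorm 1 u + sobolevNorm 2 (fun Y => ((m : ℂ) ^ 2)⁻¹ * ϱ Y) + sobolevNorm 2 v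
        + ENNReal.ofReal α⁻¹ * sobolevNorm 1 (divergence α u v)
      ≤ (12 * K).toNNReal * (ENNReal.ofReal (1 / c.im) * l2wNorm U (omegaOp m U α c s₁ s₂)
        + ENNReal.ofReal (1 / α) * l2Norm s₁ + l2Norm s₂ + l2Norm (divergence α s₁ s₂)) ∧
    l2Norm (weakDeriv (weakDeriv u))
      ≤ (12 * K).toNNReal * (ENNReal.ofReal (√(nParam α ε) / √c.im) *
          l2wNorm U (omegaOp m U α c s₁ s₂)
        + ENNReal.ofReal (1 / α) * l2Norm s₁ + l2Norm s₂ + l2Norm (divergence α s₁ s₂)) := by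
  have ha : IsWeakDeriv (s₁.1 0) (s₁.1 1) := s₁.2 0
  have hb : IsWeakDeriv (s₂.1 0) (s₂.1 1) := s₂.2 0
  have hΩ : ∀ᵐ Y ∂halfLine, omegaOp m U α c s₁ s₂ Y = R.bθ Y * G Y := by
    filter_upwards [ae_halfLine_pos, hG] with Y hY e
    rw [e, hR.weighted_eq _ hY, mul_inv_cancel_left₀ (bθ_ne Y)]
  have hG' : ∀ᵐ Y ∂halfLine, R.bθ Y * G Y = s₂.1 0 Y - (Complex.I * α)⁻¹ *
      (-R.cdA c Y * R.ca c Y ^ 2 * s₁.1 0 Y + R.ca c Y * s₁.1 1 Y) := by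
    filter_upwards [hΩ, hR.omegaOp_ae h.mem_adm ha (s₂.1 0)] with Y e1 e2
    rw [← e1, e2]
  have hp := isWeakDeriv_pr₀ h ha hG'
  have hp' := isWeakDeriv_pr₁ (G := G) (a₀ := s₁.1 0) h hb
  have hw := isWeakDeriv_ve₀ h hp
  have hw' := isWeakDeriv_ve₁ h hp hp'
  have h0 : IsWeakDeriv (R.ψ₀ α (nParam α ε) c G) (R.ψ₁ α (nParam α ε) c G) := isWeakDeriv_ψ₀ G
  have h1 := isWeakDeriv_ψ₁ G h
  have cϱ : ϱ.1 0 = ((m : ℂ) ^ 2) • R.pr₀ α (nParam α ε) c G (s₁.1 0) := by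
    rw [hϱ]; exact coe_toSobolev₂ (hp.smul_L2 _) (hp'.smul_L2 _)
  have cu : u.1 0 = R.ve₀ α (nParam α ε) c G (s₁.1 0) := by
    rw [hu]; exact coe_toSobolev₂ hw hw'
  have cv : v.1 0 = (-Complex.I * α) • R.ψ₀ α (nParam α ε) c G := by
    rw [hv]; exact coe_toSobolev₂ (h0.smul_L2 _) (h1.smul_L2 _)
  rw [cϱ, cu, cv]
  obtain ⟨Ψ, hΨ, hOS⟩ := exists_orrSommerfeld_solution hR h G hΩ
  have hα := h.pos_α
  have hci := h.pos_im
  have hdiv : divergence α s₁ s₂ =ᵐ[halfLine] ((Complex.I * (α : ℂ)) • s₁.1 0 + s₂.1 1 : L2) :=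
    (divergence_ae (u := s₁.1 0) α hb).trans (rep_add (rep_smul _ .rfl) .rfl).symm
  obtain ⟨e0, e1, e2, p0, p1, p2, w0, w1, w2⟩ := hB G (s₁.1 0) (s₂.1 0) (s₂.1 1) _ _ _ rfl rfl rfl
  set S := 1 / c.im * ‖G‖ + 1 / α * ‖s₁.1 0‖ + ‖s₂.1 0‖ +
    ‖(Complex.I * (α : ℂ)) • s₁.1 0 + s₂.1 1‖ with hS
  set W := √(nParam α ε) / √c.im * ‖G‖ + 1 / α * ‖s₁.1 0‖ + ‖s₂.1 0‖ +
    ‖(Complex.I * (α : ℂ)) • s₁.1 0 + s₂.1 1‖ with hW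
  have hS0 : 0 ≤ S := by positivity
  have hW0 : 0 ≤ W := by positivity
  have hKS : 0 ≤ K * S := by positivity
  have rhs : ∀ a : ℝ, 0 ≤ a → ENNReal.ofReal a * l2wNorm U (omegaOp m U α c s₁ s₂)
      + ENNReal.ofReal (1 / α) * l2Norm (s₁.1 0) + l2Norm (s₂.1 0) + l2Norm (divergence α s₁ s₂)
      = ENNReal.ofReal (a * ‖G‖ + 1 / α * ‖s₁.1 0‖ + ‖s₂.1 0‖ +
        ‖(Complex.I * (α : ℂ)) • s₁.1 0 + s₂.1 1‖) := fun a ha => by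
    rw [l2wNorm, l2Norm_eq hG.symm, l2Norm_eq (f := s₁.1 0) .rfl, l2Norm_eq (f := s₂.1 0) .rfl,
      l2Norm_eq hdiv, ← ENNReal.ofReal_mul ha, ← ENNReal.ofReal_mul (by positivity),
      ← ENNReal.ofReal_add (by positivity) (by positivity),
      ← ENNReal.ofReal_add (by positivity) (by positivity),
      ← ENNReal.ofReal_add (by positivity) (by positivity)]
  rw [rhs _ (by positivity), rhs _ (by positivity), ← hS, ← hW]
  have hC : ((12 * K).toNNReal : ℝ≥0∞) = ENNReal.ofReal (12 * K) := rfl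
  have hK0 : 0 ≤ 12 * K := by linarith
  have nα : ‖(-Complex.I * α : ℂ)‖ = α := by
    rw [norm_mul, norm_neg, Complex.norm_I, one_mul, Complex.norm_real, Real.norm_of_nonneg hα.le]
  have nα' : ‖(Complex.I * α : ℂ)‖ = α := by
    rw [norm_mul, Complex.norm_I, one_mul, Complex.norm_real, Real.norm_of_nonneg hα.le]
  have lt_of : ∀ {f : L2}, ‖f‖ ≤ K * S → ‖(-Complex.I * α : ℂ) • f‖ ≤ K * S := fun {f} hf => by
    rw [norm_smul, nα]
    exact (mul_le_of_le_one_left (norm_nonneg _) h.α_lt.le).trans hf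
  rw [hC, ← ENNReal.ofReal_mul hK0, ← ENNReal.ofReal_mul hK0]
  refine ⟨solvesQuasiCompressible hm hε hR h ha hG', ⟨Ψ, hOS, ?_⟩, ?_, ?_⟩
  · rw [hΨ]
    exact isStreamFunction hm hR h
  · have b1 := sobolevNorm_one_le hw .rfl w0 w1
    have b2 : sobolevNorm 2 (fun Y => ((m : ℂ) ^ 2)⁻¹ *
        (((m : ℂ) ^ 2) • R.pr₀ α (nParam α ε) c G (s₁.1 0) : L2) Y) ≤ ENNReal.ofReal (3 * (K * S)) := by
      refine sobolevNorm_two_le hp hp' ?_ p0 p1 p2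
      filter_upwards [rep_smul ((m : ℂ) ^ 2) (f := R.pr₀ α (nParam α ε) c G (s₁.1 0)) .rfl]
        with Y e
      have hm' : (m : ℂ) ≠ 0 := by exact_mod_cast hm.ne'
      rw [e, inv_mul_cancel_left₀ (pow_ne_zero 2 hm')]
    have b3 := sobolevNorm_two_le (h0.smul_L2 (-Complex.I * α)) (h1.smul_L2 (-Complex.I * α)) .rfl
      (B := K * S) (by rw [norm_smul, nα]; exact e0) (lt_of e1) (lt_of e2)
    -- The divergence equals iα(u - ∂_YΨ); its factor α compensates the weight α⁻¹ in the estimate.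
    have b4 := sobolevNorm_one_le (((hw.sub_L2 h1)).smul_L2 (Complex.I * α))
      (divergence_fields_ae G (s₁.1 0)) (B := α * (2 * (K * S)))
      (by rw [norm_smul, nα']; gcongr; exact (norm_sub_le_of_le₂ w0 e1).trans (by linarith))
      (by rw [norm_smul, nα']; gcongr; exact (norm_sub_le_of_le₂ w1 e2).trans (by linarith))
    -- The four norms contribute 2, 3, 3 and 4 times KS, whence the constant 12K.
    refine (add_le_add (add_le_add (add_le_add b1 b2) b3) (mul_le_mul_right b4 _)).trans ?_
    rw [← ENNReal.ofReal_mul (by positivity), ← ENNReal.ofReal_add (by positivity) (by positivity),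
      ← ENNReal.ofReal_add (by positivity) (by positivity),
      ← ENNReal.ofReal_add (by positivity) (by positivity)]
    apply ENNReal.ofReal_le_ofReal
    have : α⁻¹ * (2 * (α * (2 * (K * S)))) = 4 * (K * S) := by
      linear_combination 4 * (K * S) * inv_mul_cancel₀ hα.ne'
    rw [this]
    linarith
  · rw [l2Norm_eq (weakDeriv_ae_of_ae hw.weakDeriv_eq hw')]
    apply ENNReal.ofReal_le_ofReal
    refine w2.trans ?_
    gcongr
    linarith

end ReducedProfile

end QuasiCompressible

end

/-! ### Choice of the constants and conclusion -/

open QuasiCompressible in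
theorem proposition3p2 (m : ℝ) (hm₀ : 0 < m) (hm₁ : m < 1 / √3) (U : ℝ → ℝ)
    (hU : IsBoundaryLayerProfile m U) :
    ∃ γ : ℝ, 0 < γ ∧ ∃ C : ℝ≥0, ∀ α ε : ℝ, 0 < α → α < 1 → 0 < ε →
      ∃ ϱ u v : ℂ → SobolevH 1 → SobolevH 1 → SobolevH 2,
        -- solvability and estimates
        (∀ c ∈ sigmaQ γ α ε, ∀ s₁ s₂ : SobolevH 1, l2wNorm U (omegaOp m U α c s₁ s₂) < ⊤ →
          SolvesQuasiCompressible m U α ε c s₁ s₂ (ϱ c s₁ s₂) (u c s₁ s₂) (v c s₁ s₂) ∧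
          (∃ Ψ : SobolevH 4, SolvesOrrSommerfeld m U α ε c s₁ s₂ Ψ ∧
            IsStreamFunction m U α ε c s₁ (ϱ c s₁ s₂) (u c s₁ s₂) (v c s₁ s₂) Ψ) ∧
          sobolevNorm 1 (u c s₁ s₂)
              + sobolevNorm 2 (fun Y => ((m : ℂ) ^ 2)⁻¹ * ϱ c s₁ s₂ Y)
              + sobolevNorm 2 (v c s₁ s₂)
              + ENNReal.ofReal α⁻¹ * sobolevNorm 1 (divergence α (u c s₁ s₂) (v c s₁ s₂))
            ≤ C * (ENNReal.ofReal (1 / c.im) * l2wNorm U (omegaOp m U α c s₁ s₂)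
              + ENNReal.ofReal (1 / α) * l2Norm s₁ + l2Norm s₂
              + l2Norm (divergence α s₁ s₂)) ∧
          l2Norm (weakDeriv (weakDeriv (u c s₁ s₂)))
            ≤ C * (ENNReal.ofReal (√(nParam α ε) / √c.im) * l2wNorm U (omegaOp m U α c s₁ s₂)
              + ENNReal.ofReal (1 / α) * l2Norm s₁ + l2Norm s₂
              + l2Norm (divergence α s₁ s₂))) ∧
        -- analytic dependence on the spectral parameter
        (∀ D : Set ℂ, IsOpen D → D ⊆ sigmaQ γ α ε → ∀ s₁ s₂ : ℂ → SobolevH 1,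
          AnalyticOnNhd ℂ s₁ D → AnalyticOnNhd ℂ s₂ D →
          AnalyticInL2w U (fun c => omegaOp m U α c (s₁ c) (s₂ c)) D →
          AnalyticOnNhd ℂ (fun c => ϱ c (s₁ c) (s₂ c)) D ∧
          AnalyticOnNhd ℂ (fun c => u c (s₁ c) (s₂ c)) D ∧
          AnalyticOnNhd ℂ (fun c => v c (s₁ c) (s₂ c)) D) := by
  have hm₂ : m ^ 2 < 1 / 3 := by
    have h := mul_self_lt_mul_self hm₀.le hm₁
    rw [div_mul_div_comm, one_mul, Real.mul_self_sqrt (by norm_num)] at h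
    rwa [sq]
  obtain ⟨R, hR⟩ := hU.exists_reduced hm₀ hm₂
  obtain ⟨r, M, k, hr, hB⟩ := R.exists_coefBounds hm₀ hm₂
  obtain ⟨H, hH⟩ := R.exists_isHardy
  obtain ⟨K, hK1, hK⟩ := ReducedProfile.exists_fields_bound (by linarith) R r M k H
  have hk := hB.pos_k
  have hM := hB.pos_M
  have hH0 := hH.1
  have hC₃ := ReducedProfile.const₃_nonneg hM hk hH0
  have hC₄ : 0 < ReducedProfile.const₄ M k H := by rw [ReducedProfile.const₄]; positivity
  -- The entries ensure, in turn, Im c ≤ 1, the coefficient bounds for |c| < r, and the absorption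
  -- in the coercivity estimate. None of them depends on α or ε.
  set γ := min 1 (min r (k / 2 / ReducedProfile.const₄ M k H)) with hγ
  have hγ0 : 0 < γ := by positivity
  have hs : γ * ReducedProfile.const₄ M k H ≤ k / 2 := by
    rw [← le_div_iff₀ hC₄]
    exact (min_le_right _ _).trans (min_le_right _ _)
  refine ⟨γ, hγ0, (12 * K).toNNReal, fun α ε hα hα₁ hε => ?_⟩
  have adm : ∀ c ∈ sigmaQ γ α ε,
      ReducedProfile.Admissible R r M k H γ α (nParam α ε) c := fun c hc =>
    ReducedProfile.admissible_of_mem_sigmaQ hB hH hγ0 (min_le_left _ _)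
      ((min_le_right _ _).trans (min_le_left _ _)) hs hα hα₁ hε hc
  -- The solution is a total function of (c, s₁, s₂), with datum 0 when θ⁻¹Ω is not in L². Along an
  -- analytic family the datum coincides on D with the given analytic representative, so analyticity
  -- transfers.
  refine ⟨fun c s₁ s₂ => R.densityH α (nParam α ε) c
      (ReducedProfile.weightedL2 U (omegaOp m U α c s₁ s₂)) s₁ s₂,
    fun c s₁ s₂ => R.tangentialH α (nParam α ε) c
      (ReducedProfile.weightedL2 U (omegaOp m U α c s₁ s₂)) s₁ s₂,
    fun c s₁ s₂ => R.normalH α (nParam α ε) c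
      (ReducedProfile.weightedL2 U (omegaOp m U α c s₁ s₂)), ?_, ?_⟩
  · intro c hc s₁ s₂ hfin
    have h := adm c hc
    obtain ⟨g, hg⟩ := ReducedProfile.Represents.omegaOp_L2 (α := α) hR h.mem_adm s₁ s₂
    exact ReducedProfile.solvability hm₀ hε hR hK1 h (hK γ α (nParam α ε) c h)
      (ReducedProfile.Represents.weightedL2_ae hR hg hfin) rfl rfl rfl
  · rintro D hD hDs s₁ s₂ hs₁ hs₂ ⟨G, hG, hG'⟩
    obtain ⟨q1, q2, q3⟩ := ReducedProfile.analyticOnNhd_fields hD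
      (fun c hc => adm c (hDs hc)) hG hs₁ hs₂
    exact ⟨q1.congr hD fun c hc => by simp only [ReducedProfile.weightedL2_eq (hG' c hc)],
      q2.congr hD fun c hc => by simp only [ReducedProfile.weightedL2_eq (hG' c hc)],
      q3.congr hD fun c hc => by simp only [ReducedProfile.weightedL2_eq (hG' c hc)]⟩
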